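/- **Problem.** Let $n\ge 2$ nodes be linked by a connected graph with set of edges $E^{\rm comm}$, $E=|E^{\rm comm}|$. Node $i$ holds $\sigma_i>0$ and $m\ge 1$ convex functions $f_{i,j}:\mathbb R^d\to\mathbb R$, where $f_{i,j}$ is $L_{i,j}$-smooth, $L_{i,j}>0$. Let $\theta^\star$ be the minimizer of $\sum_{i=1}^n\big(\sum_{j=1}^m f_{i,j}(\theta)+\frac{\sigma_i}2\|\theta\|^2\big)$. The augmented graph has the center nodes $i$, the virtual nodes $(i,j)$, the communication edges and the virtual edges $i$–$(i,j)$. Every edge $(k,\ell)$ has a weight $\mu_{k\ell}>0$ and a sampling probability $p_{k\ell}$, with $\sum p_{k\ell}=1$. Let $Ae_{k\ell}=\mu_{k\ell}(e^{(k)}-e^{(\ell)})$ be the weighted incidence matrix of the augmented graph, $L$ the Laplacian of the communication graph with weights $\mu_{k\ell}^2$, $\Sigma$ the diagonal matrix with entries $\sigma_i$ at $i$ and $L_{i,j}$ at $(i,j)$, $\lambda_{\min}^+$ the smallest non-zero eigenvalue, $\sigma_A=\lambda_{\min}^+(A^T\Sigma^{-1}A)$, $A^\dagger$ the pseudo-inverse,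 $R_{k\ell}=e_{k\ell}^TA^\dagger Ae_{k\ell}$, $W_{k\ell}=(e^{(k)}-e^{(\ell)})(e^{(k)}-e^{(\ell)})^T$ and $$\rho^2=\min_{k\ell}\frac{\sigma_A}{\Sigma_{kk}^{-1}+\Sigma_{\ell\ell}^{-1}}\,\frac{p_{k\ell}^2}{\mu_{k\ell}^2R_{k\ell}},\qquad \rho>0.$$ The dual function of $\lambda=(\lambda_{k\ell})$, $\lambda_{k\ell}\in\mathbb R^d$, is $F_A^*(\lambda)=\frac12{\rm Tr}(\lambda^TA^T\Sigma^{-1}A\lambda)+\sum_{i,j}\big(f_{i,j}^*(-\mu_{ij}\lambda_{ij})-\frac{\mu_{ij}^2}{2L_{i,j}}\|\lambda_{ij}\|^2\big)$. It has a minimizer; let $\theta_A^\star$ be any of them and $$C_0=\lambda_{\max}(A^T\Sigma^{-2}A)\big[\|A^\dagger A\theta_A^\star\|^2+2\sigma_A^{-1}(F_A^*(0)-F_A^*(\theta_A^\star))\big]\in[0,\infty].$$ **Algorithm (ADFS).** $x_0=v_0=0$. At step $t$: $y_t=\frac{x_t+\rho v_t}{1+\rho}$; sample an edge $(k,\ell)$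 with probability $p_{k\ell}$, independently of the past; with $\tilde\eta_{k\ell}=\frac{\rho\mu_{k\ell}^2}{\sigma_Ap_{k\ell}}$, set $v_{t+1}=z_{t+1}=(1-\rho)v_t+\rho y_t-\tilde\eta_{k\ell}W_{k\ell}\Sigma^{-1}y_t$; if $(k,\ell)$ is the virtual edge to $(i,j)$, replace $v_{t+1}^{(i,j)}$ by ${\rm prox}_{\tilde\eta_{ij}\tilde f^*_{i,j}}(z_{t+1}^{(i,j)})$, where $\tilde f^*_{i,j}(x)=f^*_{i,j}(x)-\frac1{2L_{i,j}}\|x\|^2$, and $v_{t+1}^{(i)}$ by $z_{t+1}^{(i)}+z_{t+1}^{(i,j)}-v_{t+1}^{(i,j)}$; finally $x_{t+1}=y_t+\frac{\rho R_{k\ell}}{p_{k\ell}}(v_{t+1}-(1-\rho)v_t-\rho y_t)$. The output is $\theta_t=\Sigma^{-1}v_t$. **Time.** Each node starts at local time $0$. A communication on $(k,\ell)$ sets the local times of $k$ and $\ell$ to the larger of the two plus $\tau\ge 0$; a step on the virtual edge to $(i,j)$ adds $1$ to the local time of $i$. $T(t)$ is the largest local time after $t$ steps. Let $p_{\rm comm}$,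 $p_{\rm comp}$ be the total probabilities of the communication and of the virtual edges, and $p^{\max}_{\rm comm}=\frac n2\max_k\sum_{\ell\in\mathcal N(k)}p_{k\ell}$ (communication edges only). **Parameters.** Let $\sigma=\max_i\sigma_i$, $\kappa_i=1+\sigma_i^{-1}\sum_jL_{i,j}$, $\kappa_s=\max_i\kappa_i$, $\kappa_{\min}=\min_i\kappa_i$, $r_\kappa=\kappa_{\min}/\kappa_s$, $S_{\rm comp}=\frac1n\sum_{i,j}(1+L_{i,j}\sigma_i^{-1})^{1/2}$ and $\tilde\gamma=\min_{(k,\ell)\in E^{\rm comm}}\frac{\lambda_{\min}^+(L)n^2}{\mu_{k\ell}^2R_{k\ell}E^2}$. Let $0<\Delta_p\le1$ and $c_\tau>0$, and assume: $\mu_{k\ell}^2=\frac12$ for communication edges and $\mu_{ij}^2=\frac{\lambda_{\min}^+(L)}{\sigma\kappa_i}L_{i,j}$ for virtual edges; $p_{\rm comm}=\min\Big(\frac12,\big(1+\Delta_p\sqrt{\tilde\gamma/\kappa_{\min}}\,S_{\rm comp}\big)^{-1}\Big)$; $p_{ij}=p_{\rm comp}(1+L_{i,j}\sigma_i^{-1})^{1/2}/(nS_{\rm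 comp})$ for virtual edges, with $\sum_jp_{ij}$ the same for all $i$; $p_{k\ell}\ge\Delta_pp_{\rm comm}/E$ for communication edges; $p_{\rm comm}^{\max}\le c_\tau p_{\rm comm}$. **Theorem.** There is a universal constant $C<24$ with the following properties. (0) For every graph, $\tau\ge 0$ and sampling probabilities such that each node has probability $p_{\rm comp}/n$ of a local update, if $p_{\rm comp}\ge p_{\rm comm}^{\max}$ or $\tau>1$, then $\mathbb P\big(\frac1tT(t)\le\frac Cn(p_{\rm comp}+2\tau p^{\max}_{\rm comm})\big)\to1$ as $t\to\infty$. Moreover, for all problems and parameters as above, with $K=\lceil\rho^{-1}\log(1/\varepsilon)\rceil$ (and $K=0$ if $\varepsilon\ge1$): (1) for every $\varepsilon>0$, $\mathbb E\|\theta_K-\Sigma^{-1}A\theta_A^\star\|^2\le C_0\,\varepsilon$, and $(\Sigma^{-1}A\theta_A^\star)^{(i)}=\theta^\star$ at every center node $i$; in particular $\mathbb E\sum_{i=1}^n\|\theta_K^{(i)}-\theta^\star\|^2\le C_0\,\varepsilon$; (2) if moreover $\sigma_i=\sigma$ for all $i$, and $p_{\rm comp}\ge p_{\rm comm}^{\max}$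 or $\tau>1$, then $$T(K)\le2C\left(\frac{m+\sqrt{m\kappa_s}}{\sqrt{2r_\kappa}}+\frac{1+4c_\tau\tau}{\Delta_p}\sqrt{\frac{\kappa_s}{\tilde\gamma}}\right)\log\frac1\varepsilon$$ with probability tending to $1$ as $\rho^{-1}\log(1/\varepsilon)\to\infty$ (the problem and its parameters are fixed and $\varepsilon\to0$). -/

import Mathlib

open Filter Topology

noncomputable section

namespace ADFS

/-- The parameter space. -/
abbrev Param (d : ℕ) : Type := EuclideanSpace ℝ (Fin d)

/-! ### The augmented graph -/

/-- Communication edges `(k, l)` of a graph on `n` nodes, each one listed once, with `k < l`. -/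
abbrev CommEdge {n : ℕ} (G : SimpleGraph (Fin n)) : Type :=
  {e : Fin n × Fin n // e.1 < e.2 ∧ G.Adj e.1 e.2}

instance {n : ℕ} (G : SimpleGraph (Fin n)) : Fintype (CommEdge G) := Fintype.ofFinite _

/-- Nodes of the augmented graph: center nodes `i` and virtual nodes `(i, j)`. -/
abbrev Node (n m : ℕ) : Type := Fin n ⊕ Fin n × Fin m

/-- Edges of the augmented graph: communication edges, and the virtual edges joining the center
node `i` to its virtual node `(i, j)`. -/
abbrev Edge {n : ℕ} (G : SimpleGraph (Fin n)) (m : ℕ) : Type := CommEdge G ⊕ Fin n × Fin m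

section Graph

variable {n m : ℕ} {G : SimpleGraph (Fin n)}

/-- First endpoint of an edge of the augmented graph. -/
def src : Edge G m → Node n m
  | Sum.inl e => Sum.inl e.1.1
  | Sum.inr ij => Sum.inl ij.1

/-- Second endpoint of an edge of the augmented graph. -/
def dst : Edge G m → Node n m
  | Sum.inl e => Sum.inl e.1.2
  | Sum.inr ij => Sum.inr ij

/-- The vector `e^(k) - e^(l)` of an edge `(k, l)`. -/
def edgeVec (e : Edge G m) (h : Node n m) : ℝ :=
  (if h = src e then 1 else 0) - (if h = dst e then 1 else 0)

/-- The matrix `W_kl = (e^(k) - e^(l)) (e^(k) - e^(l))ᵀ`. -/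
def wMat (e : Edge G m) : Matrix (Node n m) (Node n m) ℝ :=
  Matrix.vecMulVec (edgeVec e) (edgeVec e)

/-- The weighted incidence matrix of the augmented graph: `A e_kl = μ_kl (e^(k) - e^(l))`. -/
def incMat (μ : Edge G m → ℝ) : Matrix (Node n m) (Edge G m) ℝ :=
  Matrix.of fun h e => μ e * edgeVec e h

/-- The weighted incidence matrix of the communication graph. -/
def commIncMat (μ : Edge G m → ℝ) : Matrix (Fin n) (CommEdge G) ℝ :=
  Matrix.of fun h e =>
    μ (Sum.inl e) * ((if h = e.1.1 then 1 else 0) - (if h = e.1.2 then 1 else 0))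

/-- The weighted Laplacian `A_comm A_commᵀ` of the communication graph. -/
def commLap (μ : Edge G m → ℝ) : Matrix (Fin n) (Fin n) ℝ :=
  commIncMat μ * (commIncMat μ).transpose

end Graph

/-! ### Linear algebra -/

/-- The smallest positive eigenvalue of a (positive semidefinite) matrix. -/
def lamMinPos {ι : Type} [Fintype ι] [DecidableEq ι] (M : Matrix ι ι ℝ) : ℝ :=
  sInf {x : ℝ | 0 < x ∧ Module.End.HasEigenvalue (Matrix.toLin' M) x}

/-- The largest eigenvalue of a (symmetric) matrix. -/
def lamMax {ι : Type} [Fintype ι] [DecidableEq ι] (M : Matrix ι ι ℝ) : ℝ :=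
  sSup {x : ℝ | Module.End.HasEigenvalue (Matrix.toLin' M) x}

/-- The matrix `A†A`, with `A†` the pseudo-inverse of `A`: the matrix of the orthogonal projector
onto the orthogonal complement of the kernel of `A`
(see `eq_pinvMul` for the agreement with the Penrose equations). -/
def pinvMul {κ ι : Type} [Fintype κ] [Fintype ι] [DecidableEq ι] (A : Matrix κ ι ℝ) :
    Matrix ι ι ℝ :=
  Matrix.of fun a b =>
    ((LinearMap.ker (Matrix.toEuclideanLin A))ᗮ.starProjection (EuclideanSpace.single b 1)) a

/-- The product `M y` of a matrix and a column of vectors. -/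
def rowMul {κ ι : Type} [Fintype ι] {d : ℕ} (M : Matrix κ ι ℝ) (y : ι → Param d) :
    κ → Param d :=
  fun k => ∑ l, M k l • y l

/-- The squared Frobenius norm of a column of vectors. -/
def sqNorm {ι : Type} [Fintype ι] {d : ℕ} (y : ι → Param d) : ℝ := ∑ k, ‖y k‖ ^ 2

theorem eq_pinvMul {κ ι : Type} [Fintype κ] [Fintype ι] [DecidableEq ι]
    (A : Matrix κ ι ℝ) (B : Matrix ι κ ℝ) (h1 : A * B * A = A)
    (h4 : (B * A).transpose = B * A) : B * A = pinvMul A := by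
  ext a b
  have key : ((LinearMap.ker (Matrix.toEuclideanLin A))ᗮ.starProjection
      (EuclideanSpace.single b 1)) =
      Matrix.toEuclideanLin (B * A) (EuclideanSpace.single b 1) := by
    refine (Submodule.eq_starProjection_of_mem_orthogonal
      (K := (LinearMap.ker (Matrix.toEuclideanLin A))ᗮ) ?_ ?_)
    · rw [Submodule.mem_orthogonal]
      intro u hu
      have hu' : A.mulVec u.ofLp = 0 := by
        simpa [Matrix.toLpLin_apply] using hu
      have : (B * A).transpose.mulVec u.ofLp = 0 := by
        rw [h4, ← Matrix.mulVec_mulVec, hu', Matrix.mulVec_zero]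
      simp only [Matrix.toLpLin_apply, EuclideanSpace.inner_eq_star_dotProduct, star_trivial]
      rw [dotProduct_comm, Matrix.dotProduct_mulVec, ← Matrix.mulVec_transpose, this,
        zero_dotProduct]
    · rw [Submodule.orthogonal_orthogonal, LinearMap.mem_ker, map_sub]
      simp only [Matrix.toLpLin_apply, Matrix.mulVec_mulVec, ← Matrix.mul_assoc, h1, sub_self]
  rw [pinvMul, Matrix.of_apply, key]
  simp [Matrix.toLpLin_apply]

/-! ### Convex analysis -/

/-- The Fenchel conjugate. -/
def conj {d : ℕ} (f : Param d → ℝ) (y : Param d) : EReal :=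
  ⨆ x : Param d, ((inner ℝ y x - f x : ℝ) : EReal)

/-- The proximal operator `prox_{η g} (z) = argmin_v ‖v - z‖² / (2 η) + g v`. -/
def prox {d : ℕ} (η : ℝ) (g : Param d → EReal) (z : Param d) : Param d :=
  Classical.epsilon fun v => ∀ w : Param d,
    ((1 / (2 * η) * ‖v - z‖ ^ 2 : ℝ) : EReal) + g v ≤
      ((1 / (2 * η) * ‖w - z‖ ^ 2 : ℝ) : EReal) + g w

/-! ### The distributed finite-sum problem -/

/-- A distributed finite-sum problem: a connected communication network on `n` nodes, and at every
node `i` a regularization parameter `σ i` and `m` convex functions `f i j`, where `f i j` is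
`L i j`-smooth. -/
structure Problem (n m d : ℕ) where
  G : SimpleGraph (Fin n)
  connected : G.Connected
  f : Fin n → Fin m → Param d → ℝ
  L : Fin n → Fin m → ℝ
  σ : Fin n → ℝ
  L_pos : ∀ i j, 0 < L i j
  σ_pos : ∀ i, 0 < σ i
  convex : ∀ i j, ConvexOn ℝ Set.univ (f i j)
  differentiable : ∀ i j, Differentiable ℝ (f i j)
  smooth : ∀ i j x y, ‖gradient (f i j) x - gradient (f i j) y‖ ≤ L i j * ‖x - y‖

section Quantities

variable {n m d : ℕ} (P : Problem n m d) (μ p : Edge P.G m → ℝ)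

/-- The primal function `θ ↦ ∑ᵢ (∑ⱼ f i j θ + σ i / 2 ‖θ‖²)`. -/
def Problem.primal (θ : Param d) : ℝ :=
  ∑ i, (∑ j, P.f i j θ + P.σ i / 2 * ‖θ‖ ^ 2)

/-- The diagonal of `Σ`. -/
def Problem.diag : Node n m → ℝ
  | Sum.inl i => P.σ i
  | Sum.inr ij => P.L ij.1 ij.2

/-- `σ = maxᵢ σ i`. -/
def Problem.sigMax : ℝ := ⨆ i, P.σ i

/-- `κ i = 1 + ∑ⱼ L i j / σ i`. -/
def Problem.kap (i : Fin n) : ℝ := 1 + (P.σ i)⁻¹ * ∑ j, P.L i j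

/-- `κ_s = maxᵢ κ i`. -/
def Problem.kapS : ℝ := ⨆ i, P.kap i

/-- `κ_min = minᵢ κ i`. -/
def Problem.kapMin : ℝ := ⨅ i, P.kap i

/-- `r_κ = minᵢ κ i / κ_s`. -/
def Problem.rKap : ℝ := P.kapMin / P.kapS

/-- `S_comp = n⁻¹ ∑ᵢ ∑ⱼ (1 + L i j / σ i)^(1/2)`. -/
def Problem.sComp : ℝ := (n : ℝ)⁻¹ * ∑ i, ∑ j, √(1 + P.L i j * (P.σ i)⁻¹)

/-- The number of communication edges. -/
def Problem.numComm : ℝ := Fintype.card (CommEdge P.G)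

/-- `σ_A`, the smallest non-zero eigenvalue of `Aᵀ Σ⁻¹ A`. -/
def Problem.sigA : ℝ :=
  lamMinPos ((incMat μ).transpose * Matrix.diagonal (fun k => (P.diag k)⁻¹) * incMat μ)

/-- `R_kl = e_klᵀ A† A e_kl`. -/
def Problem.res (e : Edge P.G m) : ℝ := pinvMul (incMat μ) e e

/-- `γ̃ = min over the communication edges of λ_min⁺(L) n² / (μ_kl² R_kl E²)`. -/
def Problem.gam : ℝ :=
  ⨅ e : CommEdge P.G, lamMinPos (commLap μ) * (n : ℝ) ^ 2 /
    (μ (Sum.inl e) ^ 2 * P.res μ (Sum.inl e) * P.numComm ^ 2)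

/-- The rate `ρ`, given by
`ρ² = min over all edges of σ_A / (Σ_kk⁻¹ + Σ_ll⁻¹) * p_kl² / (μ_kl² R_kl)`. -/
def Problem.rate : ℝ :=
  √(⨅ e : Edge P.G m, P.sigA μ / ((P.diag (src e))⁻¹ + (P.diag (dst e))⁻¹) *
    (p e ^ 2 / (μ e ^ 2 * P.res μ e)))

/-- `q_A (λ) = Trace (λᵀ Aᵀ Σ⁻¹ A λ) / 2`. -/
def Problem.qA (lam : Edge P.G m → Param d) : ℝ :=
  1 / 2 * ∑ k, (P.diag k)⁻¹ * ‖rowMul (incMat μ) lam k‖ ^ 2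

/-- The dual function `F*_A = q_A + ψ`, with
`ψ (λ) = ∑ᵢ ∑ⱼ (f i j)* (-μ_ij λ_ij) - μ_ij² / (2 L i j) ‖λ_ij‖²`. -/
def Problem.dual (lam : Edge P.G m → Param d) : EReal :=
  (P.qA μ lam : EReal) + ∑ i, ∑ j,
    (conj (P.f i j) (-(μ (Sum.inr (i, j)) • lam (Sum.inr (i, j)))) -
      ((μ (Sum.inr (i, j)) ^ 2 / (2 * P.L i j) * ‖lam (Sum.inr (i, j))‖ ^ 2 : ℝ) : EReal))

/-- `C₀ = λ_max(Aᵀ Σ⁻² A) (‖A†A λ*‖² + 2 σ_A⁻¹ (F*_A(0) - F*_A(λ*)))`; it is infinite when the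
dual function is infinite at `0`. -/
def Problem.c0 (lam : Edge P.G m → Param d) : EReal :=
  (lamMax ((incMat μ).transpose * Matrix.diagonal (fun k => (P.diag k)⁻¹ ^ 2) * incMat μ) :
      EReal) *
    ((sqNorm (rowMul (pinvMul (incMat μ)) lam) : EReal) +
      ((2 * (P.sigA μ)⁻¹ : ℝ) : EReal) * (P.dual μ 0 - P.dual μ lam))

/-- The primal variable `Σ⁻¹ A λ` of the augmented problem attached to a dual variable `λ`. -/
def Problem.primalPoint (lam : Edge P.G m → Param d) : Node n m → Param d :=
  fun k => (P.diag k)⁻¹ • rowMul (incMat μ) lam k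

/-! ### The algorithm -/

/-- `f̃*_ij : x ↦ (f i j)* (x) - ‖x‖² / (2 L i j)`, in the node variable `x`. -/
def Problem.fTilde (ij : Fin n × Fin m) (x : Param d) : EReal :=
  conj (P.f ij.1 ij.2) x - ((1 / (2 * P.L ij.1 ij.2) * ‖x‖ ^ 2 : ℝ) : EReal)

/-- The step size `η̃_kl = ρ μ_kl² / (σ_A p_kl)`. -/
def Problem.stepSize (ρ : ℝ) (e : Edge P.G m) : ℝ := ρ * μ e ^ 2 / (P.sigA μ * p e)

/-- The proximal correction made after the gradient step `z` along the sampled edge: none for a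
communication edge, and the update of `(i, j)` and `i` for the virtual edge to `(i, j)`. -/
def Problem.proxStep (ρ : ℝ) (z : Node n m → Param d) : Edge P.G m → Node n m → Param d
  | Sum.inl _ => z
  | Sum.inr ij =>
    let u := prox (P.stepSize μ p ρ (Sum.inr ij)) (P.fTilde ij) (z (Sum.inr ij))
    Function.update (Function.update z (Sum.inr ij) u) (Sum.inl ij.1)
      (z (Sum.inl ij.1) + z (Sum.inr ij) - u)

/-- One iteration: from `(x_t, v_t)` and the sampled edge to `(x_{t+1}, v_{t+1})`. -/
def Problem.step (ρ : ℝ) (s : (Node n m → Param d) × (Node n m → Param d)) (e : Edge P.G m) :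
    (Node n m → Param d) × (Node n m → Param d) :=
  let x := s.1
  let v := s.2
  let y : Node n m → Param d := (1 / (1 + ρ)) • (x + ρ • v)
  let w : Node n m → Param d := (1 - ρ) • v + ρ • y
  let z : Node n m → Param d :=
    w - P.stepSize μ p ρ e • rowMul (wMat e) (fun k => (P.diag k)⁻¹ • y k)
  let v' := P.proxStep μ p ρ z e
  (y + (ρ * P.res μ e / p e) • (v' - w), v')

/-- The state `(x_t, v_t)` after the schedule `s` of `t` sampled edges. -/
def Problem.run (ρ : ℝ) : (t : ℕ) → (Fin t → Edge P.G m) →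
    (Node n m → Param d) × (Node n m → Param d)
  | 0, _ => (0, 0)
  | t + 1, s => P.step μ p ρ (Problem.run ρ t (Fin.init s)) (s (Fin.last t))

/-- The output `θ_t = Σ⁻¹ v_t`. -/
def Problem.output (ρ : ℝ) (t : ℕ) (s : Fin t → Edge P.G m) : Node n m → Param d :=
  fun k => (P.diag k)⁻¹ • (P.run μ p ρ t s).2 k

end Quantities

/-! ### Random schedules and execution time -/

section Schedule

variable {n m : ℕ} {G : SimpleGraph (Fin n)}

/-- Expectation of `g` when the `t` edges of the schedule are drawn independently with law `p`. -/
def expect (p : Edge G m → ℝ) (t : ℕ) (g : (Fin t → Edge G m) → ℝ) : ℝ :=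
  ∑ s : Fin t → Edge G m, (∏ r, p (s r)) * g s

open Classical in
/-- Probability of an event when the `t` edges are drawn independently with law `p`. -/
def prob (p : Edge G m → ℝ) (t : ℕ) (S : (Fin t → Edge G m) → Prop) : ℝ :=
  expect p t fun s => if S s then 1 else 0

/-- The time at which a node has finished its updates when the system goes from local times `T` to
executing one more edge: a communication takes time `τ` and starts once both endpoints are
available; a local update takes time `1`. -/
def timeStep (τ : ℝ) (T : Fin n → ℝ) : Edge G m → Fin n → ℝ
  | Sum.inl e => fun k =>
    if k = e.1.1 ∨ k = e.1.2 then max (T e.1.1) (T e.1.2) + τ else T k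
  | Sum.inr ij => fun k => if k = ij.1 then T k + 1 else T k

/-- The time at which every node has finished its part of a schedule. -/
def nodeTime (τ : ℝ) : (t : ℕ) → (Fin t → Edge G m) → Fin n → ℝ
  | 0, _ => 0
  | t + 1, s => timeStep τ (nodeTime τ t (Fin.init s)) (s (Fin.last t))

/-- The time `T(t)` needed by the system to execute a schedule of size `t`. -/
def execTime (τ : ℝ) (t : ℕ) (s : Fin t → Edge G m) : ℝ := ⨆ i, nodeTime τ t s i

/-- The probability of a communication update. -/
def pComm (p : Edge G m → ℝ) : ℝ := ∑ e : CommEdge G, p (Sum.inl e)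

/-- The probability of a local update. -/
def pComp (p : Edge G m → ℝ) : ℝ := ∑ ij : Fin n × Fin m, p (Sum.inr ij)

/-- `p_comm^max = n max_k ∑_{l ∈ N(k)} p_kl / 2`. -/
def pMax (p : Edge G m → ℝ) : ℝ :=
  n * ⨆ k : Fin n, (∑ e : CommEdge G with e.1.1 = k ∨ e.1.2 = k, p (Sum.inl e)) / 2

end Schedule

/-- `C` is a valid constant in the bound on the average time per iteration: for every network and
all sampling probabilities for which every node performs a local update with probability
`p_comp / n`, if `p_comp ≥ p_comm^max` or `τ > 1`, then
`T(t) / t ≤ C / n * (p_comp + 2 τ p_comm^max)` with probability tending to `1`. -/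
def IsSyncConstant (C : ℝ) : Prop :=
  ∀ (n m : ℕ) (G : SimpleGraph (Fin n)) (τ : ℝ) (p : Edge G m → ℝ),
    0 ≤ τ → (∀ e, 0 ≤ p e) → ∑ e, p e = 1 →
    (∀ i, ∑ j, p (Sum.inr (i, j)) = pComp p / n) →
    (pMax p ≤ pComp p ∨ 1 < τ) →
    Tendsto (fun t : ℕ => prob p t fun s =>
      1 / (t : ℝ) * execTime τ t s ≤ C / n * (pComp p + 2 * τ * pMax p)) atTop (𝓝 1)

end ADFS

end

/-! Three arguments are combined.

Execution time. The potential `∑ k, exp (a T k)` dominates the exponential of `a` times the largest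
local time. A local update multiplies one term by `exp a`; a communication replaces two terms by
twice the larger one times `exp (a τ)`, hence by at most `2 exp (a τ)` times their sum. The expected
potential therefore grows geometrically (`expPot_step_le`), and Markov's inequality bounds `T(t)` as
soon as `a` is suitable; `a = 1` or `a = 1 / τ` gives the constant `5` (`exists_exp_rate`,
`tendsto_prob_execTime`).

Convergence. The node iterates are the images under `A` of an accelerated proximal coordinate
descent on the dual function in edge variables (`step_lift`). Its smooth part `q_A` is
`σ_A`-strongly convex modulo the kernel of `A`; its non-smooth part is convex because each `f i j`
is smooth (`convex_conjEpi`). The potential `‖A†A (v - λ*)‖² + 2 / σ_A * (F(x) - F(λ*))` contracts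
by `1 - ρ` in expectation: `momentum_le` treats the averaging, `coordinate_descent_le` and
`proximal_descent_le` the two kinds of edges, and `lyap_step_le` sums them. On virtual edges `A†A`
is the identity, so the proximal step is separable there. The non-smooth part may be infinite and is
only controlled along averages of past points, so it is replaced by real numbers kept above it:
pairs (point, number) stay in the convex epigraph (`liftInv_step`), which requires `ρ ≤ p_ij`
(`rate_le_inr`). Fenchel duality (`weak_duality`, `dual_minimizer`) makes the gap nonnegative and
identifies the center coordinates of the limit with the primal minimizer.

Cost. A Poincaré inequality on the augmented graph yields `λ_min⁺(L) ≤ 2 σ κ_s σ_A`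
(`lamMinPos_le_sigA`), hence a lower bound on `ρ` according to the kind of edge realizing the
minimum (`le_rate`). In both cases `cost_le_rate_mul` bounds the iteration cost by `4 n ρ` times the
announced quantity. With the factor `5` above and `K ≤ 2 ρ⁻¹ log (1 / ε)` this gives `40 = 2 C` with
`C = 20`. -/

noncomputable section

namespace ADFS

/-! ### Extreme eigenvalues of symmetric matrices -/

section Spectral

variable {ι : Type} [Fintype ι] [DecidableEq ι] {M : Matrix ι ι ℝ}

theorem hasEigenvalue_iff_mulVec {a : ℝ} :
    Module.End.HasEigenvalue (Matrix.toLin' M) a ↔ ∃ u, u ≠ 0 ∧ M.mulVec u = a • u := by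
  constructor
  · intro h
    obtain ⟨u, hu⟩ := h.exists_hasEigenvector
    exact ⟨u, hu.2, by simpa using hu.apply_eq_smul⟩
  · rintro ⟨u, h0, hu⟩
    exact Module.End.hasEigenvalue_of_hasEigenvector (x := u)
      ⟨Module.End.mem_eigenspace_iff.2 (by simpa using hu), h0⟩

theorem hasEigenvalue_eigenvalues (hM : M.IsHermitian) (i : ι) :
    Module.End.HasEigenvalue (Matrix.toLin' M) (hM.eigenvalues i) := by
  refine hasEigenvalue_iff_mulVec.2 ⟨(hM.eigenvectorBasis i).ofLp, ?_, ?_⟩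
  · intro h
    have := hM.eigenvectorBasis.orthonormal.ne_zero i
    exact this (by ext j; exact congrFun h j)
  · exact hM.mulVec_eigenvectorBasis i

theorem finite_eigenvalues (M : Matrix ι ι ℝ) :
    {x : ℝ | Module.End.HasEigenvalue (Matrix.toLin' M) x}.Finite := by
  have := Module.End.finite_hasEigenvalue (Matrix.toLin' M)
  exact this

theorem dotProduct_self_eq_sum (hM : M.IsHermitian) (x : ι → ℝ) :
    x ⬝ᵥ x = ∑ i, ((hM.eigenvectorBasis i).ofLp ⬝ᵥ x) ^ 2 := by
  have h := hM.eigenvectorBasis.sum_sq_inner_right (WithLp.toLp 2 x)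
  rw [EuclideanSpace.real_norm_sq_eq] at h
  simp only [EuclideanSpace.inner_eq_star_dotProduct, star_trivial] at h
  simp only [dotProduct, ← sq] at h ⊢
  rw [← h]
  simp [mul_comm]

theorem dotProduct_mulVec_eq_sum (hM : M.IsHermitian) (x : ι → ℝ) :
    x ⬝ᵥ M.mulVec x =
      ∑ i, hM.eigenvalues i * ((hM.eigenvectorBasis i).ofLp ⬝ᵥ x) ^ 2 := by
  have h := hM.eigenvectorBasis.sum_inner_mul_inner (WithLp.toLp 2 x) (WithLp.toLp 2 (M.mulVec x))
  simp only [EuclideanSpace.inner_eq_star_dotProduct, star_trivial] at h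
  rw [dotProduct_comm, ← h]
  refine Finset.sum_congr rfl fun i _ => ?_
  have hs : Matrix.vecMul (hM.eigenvectorBasis i).ofLp M =
      hM.eigenvalues i • (hM.eigenvectorBasis i).ofLp := by
    rw [← Matrix.mulVec_transpose, show M.transpose = M by simpa using hM.eq]
    exact hM.mulVec_eigenvectorBasis i
  rw [dotProduct_comm (M.mulVec x), Matrix.dotProduct_mulVec, hs, smul_dotProduct, smul_eq_mul]
  ring

theorem dotProduct_mulVec_le_lamMax (hM : M.IsHermitian) (x : ι → ℝ) :
    x ⬝ᵥ M.mulVec x ≤ lamMax M * (x ⬝ᵥ x) := by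
  rw [dotProduct_mulVec_eq_sum hM, dotProduct_self_eq_sum hM, Finset.mul_sum]
  refine Finset.sum_le_sum fun i _ => mul_le_mul_of_nonneg_right ?_ (sq_nonneg _)
  exact le_csSup (finite_eigenvalues M).bddAbove (hasEigenvalue_eigenvalues hM i)

theorem lamMinPos_le {a : ℝ} (ha : 0 < a)
    (h : Module.End.HasEigenvalue (Matrix.toLin' M) a) : lamMinPos M ≤ a :=
  csInf_le ⟨0, fun _ hx => hx.1.le⟩ ⟨ha, h⟩

/-- In an eigenbasis, the coordinates of `x` along the kernel vanish and every other eigenvalue is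
at least `lamMinPos M`. -/
theorem lamMinPos_mul_le (hM : M.PosSemidef) (x : ι → ℝ)
    (hx : ∀ u, M.mulVec u = 0 → u ⬝ᵥ x = 0) :
    lamMinPos M * (x ⬝ᵥ x) ≤ x ⬝ᵥ M.mulVec x := by
  have hH := hM.1
  rw [dotProduct_mulVec_eq_sum hH, dotProduct_self_eq_sum hH, Finset.mul_sum]
  refine Finset.sum_le_sum fun i _ => ?_
  rcases (hM.eigenvalues_nonneg i).eq_or_lt with h0 | h0
  · have : (hH.eigenvectorBasis i).ofLp ⬝ᵥ x = 0 := by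
      refine hx _ ?_
      rw [hH.mulVec_eigenvectorBasis i, ← h0, zero_smul]
    simp [this]
  · exact mul_le_mul_of_nonneg_right (lamMinPos_le h0 (hasEigenvalue_eigenvalues hH i))
      (sq_nonneg _)

/-- The positive eigenvalues form a finite set, nonempty because a symmetric matrix with zero
spectrum vanishes, so the infimum is attained. -/
theorem lamMinPos_spec (hM : M.PosSemidef) (h0 : M ≠ 0) :
    0 < lamMinPos M ∧ Module.End.HasEigenvalue (Matrix.toLin' M) (lamMinPos M) := by
  have hne : {x : ℝ | 0 < x ∧ Module.End.HasEigenvalue (Matrix.toLin' M) x}.Nonempty := by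
    by_contra hcon
    refine h0 (hM.1.eigenvalues_eq_zero_iff.1 (funext fun i => ?_))
    rcases (hM.eigenvalues_nonneg i).eq_or_lt with hi | hi
    · exact hi.symm
    · exact absurd ⟨_, hi, hasEigenvalue_eigenvalues hM.1 i⟩ hcon
  exact hne.csInf_mem ((finite_eigenvalues M).subset fun _ h => h.2)

theorem lamMax_pos (hM : M.PosSemidef) (h0 : M ≠ 0) : 0 < lamMax M := by
  obtain ⟨h1, h2⟩ := lamMinPos_spec hM h0
  exact h1.trans_le (le_csSup (finite_eigenvalues M).bddAbove h2)

end Spectral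

/-! ### Columns of vectors -/

section Columns

variable {κ ι : Type} [Fintype ι] {d : ℕ}

/-- The Frobenius inner product of two columns of vectors. -/
def colInner (y z : ι → Param d) : ℝ := ∑ k, inner ℝ (y k) (z k)

theorem colInner_self (y : ι → Param d) : colInner y y = sqNorm y := by
  simp [colInner, sqNorm]

theorem sqNorm_nonneg (y : ι → Param d) : 0 ≤ sqNorm y :=
  Finset.sum_nonneg fun _ _ => by positivity

theorem colInner_comm (y z : ι → Param d) : colInner y z = colInner z y := by
  simp only [colInner, real_inner_comm]

theorem colInner_add_left (x y z : ι → Param d) :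
    colInner (x + y) z = colInner x z + colInner y z := by
  simp [colInner, inner_add_left, Finset.sum_add_distrib]

theorem colInner_add_right (x y z : ι → Param d) :
    colInner x (y + z) = colInner x y + colInner x z := by
  simp [colInner, inner_add_right, Finset.sum_add_distrib]

theorem colInner_smul_right (a : ℝ) (y z : ι → Param d) :
    colInner y (a • z) = a * colInner y z := by
  simp [colInner, real_inner_smul_right, Finset.mul_sum]

theorem rowMul_add (M : Matrix κ ι ℝ) (y z : ι → Param d) :
    rowMul M (y + z) = rowMul M y + rowMul M z := by
  ext1 k
  simp [rowMul, Finset.sum_add_distrib]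

theorem rowMul_smul (M : Matrix κ ι ℝ) (a : ℝ) (y : ι → Param d) :
    rowMul M (a • y) = a • rowMul M y := by
  ext1 k
  simp [rowMul, Finset.smul_sum, smul_smul, mul_comm]

theorem rowMul_sub (M : Matrix κ ι ℝ) (y z : ι → Param d) :
    rowMul M (y - z) = rowMul M y - rowMul M z := by
  ext1 k
  simp [rowMul, smul_sub]

theorem rowMul_zero (M : Matrix κ ι ℝ) : rowMul M (0 : ι → Param d) = 0 := by
  ext1 k
  simp [rowMul]

theorem rowMul_rowMul {ι' : Type} [Fintype ι'] (M : Matrix κ ι ℝ) (N : Matrix ι ι' ℝ)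
    (y : ι' → Param d) : rowMul M (rowMul N y) = rowMul (M * N) y := by
  ext1 k
  simp only [rowMul, Finset.smul_sum, Matrix.mul_apply, Finset.sum_smul, smul_smul]
  rw [Finset.sum_comm]

theorem rowMul_single [DecidableEq ι] (M : Matrix κ ι ℝ) (e : ι) (δ : Param d) (k : κ) :
    rowMul M (Pi.single e δ) k = M k e • δ := by
  rw [rowMul, Finset.sum_eq_single e]
  · simp
  · intro b _ hb
    simp [Pi.single_eq_of_ne hb]
  · simp

theorem colInner_single [DecidableEq ι] (e : ι) (δ : Param d) (y : ι → Param d) :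
    colInner (Pi.single e δ) y = inner ℝ δ (y e) := by
  rw [colInner, Finset.sum_eq_single e]
  · simp
  · intro b _ hb
    simp [Pi.single_eq_of_ne hb]
  · simp

theorem colInner_rowMul [Fintype κ] (M : Matrix κ ι ℝ) (y : ι → Param d) (z : κ → Param d) :
    colInner (rowMul M y) z = colInner y (rowMul M.transpose z) := by
  simp only [colInner, rowMul, sum_inner, inner_sum, real_inner_smul_left, real_inner_smul_right,
    Matrix.transpose_apply]
  rw [Finset.sum_comm]

theorem colInner_eq_sum (y z : ι → Param d) :
    colInner y z = ∑ c, (fun k => y k c) ⬝ᵥ (fun k => z k c) := by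
  simp only [colInner, dotProduct, PiLp.inner_apply]
  rw [Finset.sum_comm]
  simp [mul_comm]

theorem rowMul_apply_coord (M : Matrix κ ι ℝ) (y : ι → Param d) (c : Fin d) :
    (fun k => rowMul M y k c) = M.mulVec (fun l => y l c) := by
  ext k
  simp [rowMul, Matrix.mulVec, dotProduct]

theorem colInner_rowMul_le_lamMax [DecidableEq ι] {M : Matrix ι ι ℝ} (hM : M.IsHermitian)
    (y : ι → Param d) : colInner y (rowMul M y) ≤ lamMax M * sqNorm y := by
  rw [← colInner_self, colInner_eq_sum, colInner_eq_sum, Finset.mul_sum]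
  refine Finset.sum_le_sum fun c _ => ?_
  rw [rowMul_apply_coord]
  exact dotProduct_mulVec_le_lamMax hM _

theorem lamMinPos_mul_sqNorm_le [DecidableEq ι] {M : Matrix ι ι ℝ} (hM : M.PosSemidef)
    (y : ι → Param d) (hy : ∀ u c, M.mulVec u = 0 → u ⬝ᵥ (fun l => y l c) = 0) :
    lamMinPos M * sqNorm y ≤ colInner y (rowMul M y) := by
  rw [← colInner_self, colInner_eq_sum, colInner_eq_sum, Finset.mul_sum]
  refine Finset.sum_le_sum fun c _ => ?_
  rw [rowMul_apply_coord]
  exact lamMinPos_mul_le hM _ fun u hu => hy u c hu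

end Columns

/-! ### The projector `A†A` -/

section Pinv

theorem mulVec_eq_zero_iff_mem_ker {κ ι : Type} [Fintype ι] [DecidableEq ι]
    (A : Matrix κ ι ℝ) (u : ι → ℝ) :
    A.mulVec u = 0 ↔ WithLp.toLp 2 u ∈ LinearMap.ker (Matrix.toEuclideanLin A) := by
  simp [Matrix.toLpLin_apply]

variable {κ ι : Type} [Fintype κ] [Fintype ι] [DecidableEq ι] (A : Matrix κ ι ℝ)

theorem pinvMul_mulVec (x : ι → ℝ) :
    (pinvMul A).mulVec x =
      ((LinearMap.ker (Matrix.toEuclideanLin A))ᗮ.starProjection (WithLp.toLp 2 x)).ofLp := by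
  have hx : WithLp.toLp 2 x = ∑ b, x b • EuclideanSpace.single b (1 : ℝ) := by
    ext j
    simp [Finset.sum_apply, Pi.single_apply]
  ext a
  rw [hx, map_sum]
  simp [Matrix.mulVec, dotProduct, pinvMul, mul_comm, Pi.single_apply]

theorem mul_pinvMul : A * pinvMul A = A := by
  refine Matrix.ext_of_mulVec_single fun i => ?_
  rw [← Matrix.mulVec_mulVec, ← sub_eq_zero, ← Matrix.mulVec_sub, mulVec_eq_zero_iff_mem_ker,
    pinvMul_mulVec]
  have := Submodule.sub_starProjection_mem_orthogonal
    (K := (LinearMap.ker (Matrix.toEuclideanLin A))ᗮ) (WithLp.toLp 2 (Pi.single i 1))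
  rw [Submodule.orthogonal_orthogonal] at this
  rw [← Submodule.neg_mem_iff]
  convert this using 1
  ext j
  simp

theorem pinvMul_transpose : (pinvMul A).transpose = pinvMul A := by
  ext a b
  have h := Submodule.inner_starProjection_left_eq_right
    (LinearMap.ker (Matrix.toEuclideanLin A))ᗮ (EuclideanSpace.single a (1 : ℝ))
      (EuclideanSpace.single b 1)
  rw [real_inner_comm] at h
  simpa [EuclideanSpace.inner_single_left, pinvMul] using h

theorem pinvMul_mul_pinvMul : pinvMul A * pinvMul A = pinvMul A := by
  refine Matrix.ext_of_mulVec_single fun i => ?_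
  rw [← Matrix.mulVec_mulVec, pinvMul_mulVec, pinvMul_mulVec]
  congr 1
  exact Submodule.starProjection_eq_self_iff.2 (Submodule.starProjection_apply_mem _ _)

theorem dotProduct_pinvMul_mulVec {u : ι → ℝ} (hu : A.mulVec u = 0) (x : ι → ℝ) :
    u ⬝ᵥ (pinvMul A).mulVec x = 0 := by
  have h1 := Submodule.starProjection_apply_mem (LinearMap.ker (Matrix.toEuclideanLin A))ᗮ
    (WithLp.toLp 2 x)
  rw [Submodule.mem_orthogonal] at h1
  have h2 := h1 _ ((mulVec_eq_zero_iff_mem_ker A u).1 hu)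
  rw [EuclideanSpace.inner_eq_star_dotProduct, star_trivial, dotProduct_comm] at h2
  rw [pinvMul_mulVec]
  exact h2

theorem pinvMul_apply_self_eq (e : ι) :
    pinvMul A e e = ∑ b, pinvMul A b e ^ 2 := by
  conv_lhs => rw [← pinvMul_mul_pinvMul A, Matrix.mul_apply]
  refine Finset.sum_congr rfl fun b _ => ?_
  conv_lhs => rw [← pinvMul_transpose A, Matrix.transpose_apply, pinvMul_transpose]
  ring

/-- A diagonal entry of an orthogonal projector is the squared norm of its column; a zero column
would force the column of `A = A A†A` to vanish. -/
theorem pinvMul_apply_self_pos {e : ι} (he : ∃ k, A k e ≠ 0) : 0 < pinvMul A e e := by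
  refine lt_of_le_of_ne ?_ fun h => ?_
  · rw [pinvMul_apply_self_eq]
    positivity
  · rw [pinvMul_apply_self_eq, eq_comm, Finset.sum_eq_zero_iff_of_nonneg
      (fun _ _ => sq_nonneg _)] at h
    obtain ⟨k, hk⟩ := he
    apply hk
    conv_lhs => rw [← mul_pinvMul A, Matrix.mul_apply]
    refine Finset.sum_eq_zero fun b hb => ?_
    rw [pow_eq_zero_iff two_ne_zero |>.1 (h b hb), mul_zero]

/-- The basis vector at `e` is orthogonal to the kernel, hence fixed by the projector. Applied to
virtual edges, this gives `R_ij = 1` and the separability of the proximal part. -/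
theorem pinvMul_apply_of_ker {e : ι} (he : ∀ u, A.mulVec u = 0 → u e = 0) (b : ι) :
    pinvMul A b e = if b = e then 1 else 0 := by
  have h : (pinvMul A).mulVec (Pi.single e 1) = Pi.single e 1 := by
    rw [pinvMul_mulVec, Submodule.starProjection_eq_self_iff.2]
    rw [Submodule.mem_orthogonal]
    intro u hu
    have := he u.ofLp ((mulVec_eq_zero_iff_mem_ker A _).2 hu)
    simp [EuclideanSpace.inner_eq_star_dotProduct, this]
  have := congrFun h b
  simpa [Pi.single_apply] using this

end Pinv

/-! ### Smooth convex functions -/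

section Smooth

variable {d : ℕ} {f : Param d → ℝ} {L : ℝ}

theorem hasDerivAt_line (hd : Differentiable ℝ f) (x h : Param d) (t : ℝ) :
    HasDerivAt (fun t : ℝ => f (x + t • h)) (inner ℝ (gradient f (x + t • h)) h) t := by
  have h1 := (hd (x + t • h)).hasGradientAt.hasFDerivAt
  have h2 : HasDerivAt (fun t : ℝ => x + t • h) h t := by
    simpa using ((hasDerivAt_id t).smul_const h).const_add x
  have h3 := h1.comp_hasDerivAt t h2
  rw [InnerProductSpace.toDual_apply_apply] at h3
  exact h3

theorem add_inner_gradient_le (hc : ConvexOn ℝ Set.univ f) (hd : Differentiable ℝ f)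
    (x y : Param d) : f x + inner ℝ (gradient f x) (y - x) ≤ f y := by
  have h1 := hasDerivAt_line hd x (y - x) 0
  have h2 : ConvexOn ℝ Set.univ (fun t : ℝ => f (x + t • (y - x))) := by
    refine ⟨convex_univ, fun s _ t _ a b ha hb hab => ?_⟩
    have h3 := hc.2 (Set.mem_univ (x + s • (y - x))) (Set.mem_univ (x + t • (y - x))) ha hb hab
    refine le_of_eq_of_le (congrArg f ?_) h3
    calc x + (a • s + b • t) • (y - x) = (a + b) • x + (a • s + b • t) • (y - x) := by
          rw [hab, one_smul]
      _ = a • (x + s • (y - x)) + b • (x + t • (y - x)) := by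
          simp only [smul_eq_mul]
          module
  have h3 := h2.le_slope_of_hasDerivAt (Set.mem_univ 0) (Set.mem_univ 1) one_pos h1
  rw [slope_def_field] at h3
  simp only [zero_smul, one_smul, add_zero, sub_zero, div_one, add_sub_cancel] at h3
  linarith

/-- The descent lemma: the gap between the two sides along the segment, `φ t` up to a constant, is
monotone because its derivative is nonnegative by the Lipschitz bound. -/
theorem le_add_inner_gradient (hd : Differentiable ℝ f)
    (hs : ∀ x y, ‖gradient f x - gradient f y‖ ≤ L * ‖x - y‖) (x h : Param d) :
    f (x + h) ≤ f x + inner ℝ (gradient f x) h + L / 2 * ‖h‖ ^ 2 := by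
  let φ : ℝ → ℝ := fun t => t * inner ℝ (gradient f x) h + L / 2 * t ^ 2 * ‖h‖ ^ 2 - f (x + t • h)
  have hφ : ∀ t, HasDerivAt φ (inner ℝ (gradient f x) h + L * t * ‖h‖ ^ 2 -
      inner ℝ (gradient f (x + t • h)) h) t := by
    intro t
    refine HasDerivAt.sub (HasDerivAt.add ?_ ?_) (hasDerivAt_line hd x h t)
    · simpa using (hasDerivAt_id t).mul_const (inner ℝ (gradient f x) h)
    · have := (((hasDerivAt_id t).pow 2).const_mul (L / 2)).mul_const (‖h‖ ^ 2)
      refine this.congr_deriv ?_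
      simp only [id, Nat.cast_ofNat, Nat.add_one_sub_one, pow_one]
      ring
  have hmono : MonotoneOn φ (Set.Icc 0 1) := by
    refine monotoneOn_of_deriv_nonneg (convex_Icc 0 1)
      (fun t _ => (hφ t).continuousAt.continuousWithinAt)
      (fun t _ => (hφ t).differentiableAt.differentiableWithinAt) fun t ht => ?_
    rw [interior_Icc] at ht
    rw [(hφ t).deriv]
    have h1 := hs (x + t • h) x
    have h2 : inner ℝ (gradient f (x + t • h) - gradient f x) h ≤
        ‖gradient f (x + t • h) - gradient f x‖ * ‖h‖ := real_inner_le_norm _ _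
    rw [add_sub_cancel_left, norm_smul, Real.norm_of_nonneg ht.1.le] at h1
    rw [inner_sub_left] at h2
    nlinarith [mul_le_mul_of_nonneg_right h1 (norm_nonneg h)]
  have := hmono (Set.left_mem_Icc.2 zero_le_one) (Set.right_mem_Icc.2 zero_le_one) zero_le_one
  simp only [φ, zero_smul, one_smul, add_zero] at this
  linarith

/-- The epigraph of `x ↦ f* x - ‖x‖² / (2 L)`. -/
def conjEpi (f : Param d → ℝ) (L : ℝ) : Set (Param d × ℝ) :=
  {q | ∀ x, inner ℝ q.1 x - f x - 1 / (2 * L) * ‖q.1‖ ^ 2 ≤ q.2}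

/-- For an `L`-smooth `f`, the function `f* - ‖·‖² / (2 L)` is a supremum of affine functions. -/
theorem mem_conjEpi_iff (hL : 0 < L) (hd : Differentiable ℝ f)
    (hs : ∀ x y, ‖gradient f x - gradient f y‖ ≤ L * ‖x - y‖) (q : Param d × ℝ) :
    q ∈ conjEpi f L ↔ ∀ x, inner ℝ q.1 (x - L⁻¹ • gradient f x) - f x +
      1 / (2 * L) * ‖gradient f x‖ ^ 2 ≤ q.2 := by
  constructor
  · intro h x
    -- The test point maximizes `⟨q.1, ·⟩` minus the quadratic upper bound of `f` at `x`.
    have h1 := h (x + L⁻¹ • (q.1 - gradient f x))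
    have h2 := le_add_inner_gradient hd hs x (L⁻¹ • (q.1 - gradient f x))
    have e1 : ‖q.1 - gradient f x‖ ^ 2 =
        ‖q.1‖ ^ 2 - 2 * inner ℝ q.1 (gradient f x) + ‖gradient f x‖ ^ 2 :=
      norm_sub_sq_real _ _
    rw [norm_smul, mul_pow, e1, norm_inv, Real.norm_of_nonneg hL.le, real_inner_smul_right,
      inner_sub_right, real_inner_self_eq_norm_sq, real_inner_comm] at h2
    rw [inner_add_right, real_inner_smul_right, inner_sub_right, real_inner_self_eq_norm_sq] at h1
    rw [inner_sub_right, real_inner_smul_right]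
    refine le_trans ?_ h1
    have e2 : L / 2 * (L⁻¹ ^ 2 * (‖q.1‖ ^ 2 - 2 * inner ℝ q.1 (gradient f x) +
        ‖gradient f x‖ ^ 2)) = L⁻¹ / 2 * (‖q.1‖ ^ 2 - 2 * inner ℝ q.1 (gradient f x) +
        ‖gradient f x‖ ^ 2) := by field_simp
    have e3 : 1 / (2 * L) = L⁻¹ / 2 := by field_simp
    rw [e2] at h2
    rw [e3]
    linarith
  · intro h x
    have h1 := h x
    have e1 : ‖q.1 - gradient f x‖ ^ 2 =
        ‖q.1‖ ^ 2 - 2 * inner ℝ q.1 (gradient f x) + ‖gradient f x‖ ^ 2 :=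
      norm_sub_sq_real _ _
    -- This square is exactly the difference between the affine expression at `x` and the one
    -- defining `conjEpi`.
    have e2 : 0 ≤ L⁻¹ / 2 * ‖q.1 - gradient f x‖ ^ 2 := by positivity
    rw [inner_sub_right, real_inner_smul_right] at h1
    have e3 : 1 / (2 * L) = L⁻¹ / 2 := by field_simp
    rw [e1] at e2
    rw [e3] at h1 ⊢
    linarith

/-- By `mem_conjEpi_iff` the set is an intersection of half-spaces; this is the `1 / L`-strong
convexity of the conjugate. -/
theorem convex_conjEpi (hL : 0 < L) (hd : Differentiable ℝ f)
    (hs : ∀ x y, ‖gradient f x - gradient f y‖ ≤ L * ‖x - y‖) : Convex ℝ (conjEpi f L) := by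
  intro q hq q' hq' a b ha hb hab
  rw [mem_conjEpi_iff hL hd hs] at hq hq' ⊢
  intro x
  have h1 := mul_le_mul_of_nonneg_left (hq x) ha
  have h2 := mul_le_mul_of_nonneg_left (hq' x) hb
  simp only [Prod.fst_add, Prod.smul_fst, Prod.snd_add, Prod.smul_snd, smul_eq_mul,
    inner_add_left, real_inner_smul_left]
  have : a * f x + b * f x = f x := by rw [← add_mul, hab, one_mul]
  have h3 : a * (1 / (2 * L) * ‖gradient f x‖ ^ 2) + b * (1 / (2 * L) * ‖gradient f x‖ ^ 2) =
    1 / (2 * L) * ‖gradient f x‖ ^ 2 := by rw [← add_mul, hab, one_mul]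
  linarith

theorem isClosed_conjEpi (f : Param d → ℝ) (L : ℝ) : IsClosed (conjEpi f L) := by
  simp only [conjEpi, Set.ofPred_forall]
  refine isClosed_iInter fun x => isClosed_le ?_ continuous_snd
  fun_prop

/-- The tangent inequality at `x` is the equality case of Fenchel–Young. It shows that the epigraph
is nonempty and supplies the dual optimum in `exists_dual_le`. -/
theorem gradient_mem_conjEpi (hc : ConvexOn ℝ Set.univ f) (hd : Differentiable ℝ f)
    (x : Param d) : (gradient f x, inner ℝ (gradient f x) x - f x -
      1 / (2 * L) * ‖gradient f x‖ ^ 2) ∈ conjEpi f L := by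
  intro x'
  have := add_inner_gradient_le hc hd x x'
  rw [inner_sub_right] at this
  simp only
  linarith

/-- An affine minorant makes the proximal objective coercive on the closed epigraph. Minimizing over
pairs avoids infinite values and semicontinuity. -/
theorem exists_min_conjEpi (hL : 0 < L) (hc : ConvexOn ℝ Set.univ f) (hd : Differentiable ℝ f)
    (hs : ∀ x y, ‖gradient f x - gradient f y‖ ≤ L * ‖x - y‖) {a : ℝ} (ha : 0 < a)
    (z : Param d) :
    ∃ q ∈ conjEpi f L, ∀ q' ∈ conjEpi f L,
      a * ‖q.1 - z‖ ^ 2 + q.2 ≤ a * ‖q'.1 - z‖ ^ 2 + q'.2 := by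
  obtain ⟨q0, hq0⟩ : (conjEpi f L).Nonempty := ⟨_, gradient_mem_conjEpi hc hd 0⟩
  set F : Param d × ℝ → ℝ := fun q => a * ‖q.1 - z‖ ^ 2 + q.2 with hF
  have hcont : Continuous F := by fun_prop
  set b : Param d := L⁻¹ • gradient f 0 with hb
  set c : ℝ := 1 / (2 * L) * ‖gradient f 0‖ ^ 2 - f 0 with hcdef
  have hlow : ∀ q ∈ conjEpi f L, c - inner ℝ q.1 b ≤ q.2 := by
    intro q hq
    have := (mem_conjEpi_iff hL hd hs q).1 hq 0
    rw [zero_sub, inner_neg_right] at this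
    linarith
  set K : Set (Param d × ℝ) := conjEpi f L ∩ {q | F q ≤ F q0} with hK
  have hKc : IsClosed K := (isClosed_conjEpi f L).inter (isClosed_le hcont continuous_const)
  have hKb : Bornology.IsBounded K := by
    obtain ⟨R, hR⟩ : ∃ R : ℝ, ∀ q ∈ K, ‖q.1 - z‖ ≤ R := by
      set D := F q0 - c + inner ℝ z b with hD
      -- On the sublevel set `r = ‖q.1 - z‖` satisfies `a r² ≤ |D| + r ‖b‖`, and `r > 1` would give
      -- `a r ≤ |D| + ‖b‖`; the `+ 1` covers both cases.
      refine ⟨(‖b‖ + |D|) / a + 1, fun q hq => ?_⟩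
      have h1 := hlow q hq.1
      have h2 : a * ‖q.1 - z‖ ^ 2 + q.2 ≤ F q0 := hq.2
      have h3 : inner ℝ (q.1 - z) b ≤ ‖q.1 - z‖ * ‖b‖ := real_inner_le_norm _ _
      rw [inner_sub_left] at h3
      have h4 : a * ‖q.1 - z‖ ^ 2 ≤ |D| + ‖q.1 - z‖ * ‖b‖ := by
        have := le_abs_self D
        linarith
      by_contra! hcon
      have h5 : ‖b‖ + |D| < a * (‖q.1 - z‖ - 1) := by
        have : (‖b‖ + |D|) / a < ‖q.1 - z‖ - 1 := by linarith
        rwa [div_lt_iff₀' ha] at this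
      have h6 : 1 < ‖q.1 - z‖ := by
        have : 0 ≤ (‖b‖ + |D|) / a := by positivity
        linarith
      nlinarith [abs_nonneg D, norm_nonneg b, mul_lt_mul_of_pos_left h5 (zero_lt_one.trans h6),
        mul_le_mul_of_nonneg_right h6.le (abs_nonneg D)]
    refine isBounded_iff_forall_norm_le.2 ⟨max (R + ‖z‖) (|F q0| + |c| + (R + ‖z‖) * ‖b‖),
      fun q hq => ?_⟩
    have h0 : ‖q.1‖ ≤ R + ‖z‖ := by
      have := norm_le_norm_add_norm_sub' q.1 z
      linarith [hR q hq]
    have h1 := hlow q hq.1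
    have h2 : a * ‖q.1 - z‖ ^ 2 + q.2 ≤ F q0 := hq.2
    have h3 : inner ℝ q.1 b ≤ ‖q.1‖ * ‖b‖ := real_inner_le_norm _ _
    have h4 := mul_le_mul_of_nonneg_right h0 (norm_nonneg b)
    rw [Prod.norm_def]
    refine max_le_max h0 (abs_le.2 ⟨?_, ?_⟩)
    · have := neg_abs_le c
      have := abs_nonneg (F q0)
      linarith
    · have := le_abs_self (F q0)
      have := abs_nonneg c
      have : 0 ≤ a * ‖q.1 - z‖ ^ 2 := by positivity
      have : 0 ≤ (R + ‖z‖) * ‖b‖ := (mul_nonneg (norm_nonneg _) (norm_nonneg _)).trans h4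
      linarith
  obtain ⟨q, hq, hmin⟩ := (Metric.isCompact_of_isClosed_isBounded hKc hKb).exists_isMinOn
    ⟨q0, hq0, le_refl (F q0)⟩ hcont.continuousOn
  refine ⟨q, hq.1, fun q' hq' => ?_⟩
  by_cases hle : F q' ≤ F q0
  · exact hmin ⟨hq', hle⟩
  · exact (hq.2 : F q ≤ F q0).trans (not_le.1 hle).le

theorem conj_le_coe_iff (f : Param d → ℝ) (y : Param d) (r : ℝ) :
    conj f y ≤ (r : EReal) ↔ ∀ x, inner ℝ y x - f x ≤ r := by
  simp only [conj, iSup_le_iff, EReal.coe_le_coe_iff]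

theorem coe_le_conj (f : Param d → ℝ) (y x : Param d) :
    ((inner ℝ y x - f x : ℝ) : EReal) ≤ conj f y :=
  le_iSup (fun x : Param d => ((inner ℝ y x - f x : ℝ) : EReal)) x

theorem conj_ne_bot (f : Param d → ℝ) (y : Param d) : conj f y ≠ ⊥ := by
  intro h
  have := coe_le_conj f y 0
  rw [h, le_bot_iff] at this
  exact EReal.coe_ne_bot _ this

theorem conj_eq_top_or_coe (f : Param d → ℝ) (y : Param d) :
    conj f y = ⊤ ∨ ∃ r : ℝ, conj f y = (r : EReal) := by
  induction h : conj f y with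
  | bot => exact absurd h (conj_ne_bot f y)
  | coe r => exact Or.inr ⟨r, rfl⟩
  | top => exact Or.inl rfl

theorem mem_conjEpi_of_conj_eq {y : Param d} {r : ℝ} (h : conj f y = (r : EReal)) :
    (y, r - 1 / (2 * L) * ‖y‖ ^ 2) ∈ conjEpi f L := by
  intro x
  have := (conj_le_coe_iff f y r).1 h.le x
  simp only
  linarith

theorem conj_le_of_mem_conjEpi {y : Param d} {r : ℝ} (h : (y, r) ∈ conjEpi f L) :
    conj f y ≤ ((r + 1 / (2 * L) * ‖y‖ ^ 2 : ℝ) : EReal) := by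
  refine (conj_le_coe_iff f y _).2 fun x => ?_
  have := h x
  simp only at this
  linarith

/-- Comparing the minimizer with the point at parameter `t` of the segment towards `q` gives `0 ≤ A
+ t B`; small `t` leaves `0 ≤ A`. -/
theorem add_inner_le_of_isMin {S : Set (Param d × ℝ)} (hconv : Convex ℝ S) {η r : ℝ}
    {v z : Param d} (hr : (v, r) ∈ S)
    (hq2 : ∀ q ∈ S, 1 / (2 * η) * ‖v - z‖ ^ 2 + r ≤ 1 / (2 * η) * ‖q.1 - z‖ ^ 2 + q.2)
    {q : Param d × ℝ} (hq : q ∈ S) (hη : 0 < η) :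
    r + inner ℝ (η⁻¹ • (z - v)) (q.1 - v) ≤ q.2 := by
  set B := 1 / (2 * η) * ‖q.1 - v‖ ^ 2 with hB
  set A := q.2 - r - inner ℝ (η⁻¹ • (z - v)) (q.1 - v) with hA
  have hkey : ∀ t : ℝ, 0 < t → t ≤ 1 → 0 ≤ A + t * B := by
    intro t ht ht1
    have h1 := hq2 _ (hconv hr hq (sub_nonneg.2 ht1) ht.le (by ring))
    have e1 : ((1 - t) • (v, r) + t • q).1 - z = (v - z) + t • (q.1 - v) := by
      change (1 - t) • v + t • q.1 - z = _
      module
    have e2 : ((1 - t) • (v, r) + t • q).2 = r + t * (q.2 - r) := by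
      change (1 - t) * r + t * q.2 = _
      ring
    rw [e1, e2, norm_add_sq_real, real_inner_smul_right, norm_smul, mul_pow,
      Real.norm_of_nonneg ht.le] at h1
    have e3 : inner ℝ (η⁻¹ • (z - v)) (q.1 - v) = - (η⁻¹ * inner ℝ (v - z) (q.1 - v)) := by
      rw [real_inner_smul_left, ← neg_sub v z, inner_neg_left, mul_neg]
    have e4 : 1 / (2 * η) * (‖v - z‖ ^ 2 + 2 * (t * inner ℝ (v - z) (q.1 - v)) +
        t ^ 2 * ‖q.1 - v‖ ^ 2) = 1 / (2 * η) * ‖v - z‖ ^ 2 +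
        t * (η⁻¹ * inner ℝ (v - z) (q.1 - v)) + t * (t * B) := by
      rw [hB]
      field_simp
    rw [e4] at h1
    have h2 : 0 ≤ t * (A + t * B) := by
      rw [hA, e3]
      nlinarith
    exact nonneg_of_mul_nonneg_right h2 ht
  have hA0 : 0 ≤ A := by
    by_contra! hneg
    have hB0 : 0 ≤ B := by positivity
    have h1 := hkey (min 1 (-A / (2 * (B + 1)))) (lt_min one_pos
      (div_pos (by linarith) (by linarith))) (min_le_left _ _)
    have h2 : min 1 (-A / (2 * (B + 1))) * B ≤ -A / (2 * (B + 1)) * (B + 1) :=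
      mul_le_mul (min_le_right _ _) (by linarith) hB0
        (div_nonneg (by linarith) (by linarith))
    have h3 : -A / (2 * (B + 1)) * (B + 1) = -A / 2 := by field_simp
    linarith
  linarith

/-- The proximal operator of `η (f* - ‖·‖² / (2 L))` satisfies the first order optimality
condition. -/
theorem prox_spec (hL : 0 < L) (hc : ConvexOn ℝ Set.univ f) (hd : Differentiable ℝ f)
    (hs : ∀ x y, ‖gradient f x - gradient f y‖ ≤ L * ‖x - y‖) {η : ℝ} (hη : 0 < η)
    (z : Param d) {g : Param d → EReal}
    (hg : g = fun x => conj f x - ((1 / (2 * L) * ‖x‖ ^ 2 : ℝ) : EReal)) :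
    ∃ r : ℝ, g (prox η g z) = r ∧ (prox η g z, r) ∈ conjEpi f L ∧
      ∀ q ∈ conjEpi f L, r + inner ℝ (η⁻¹ • (z - prox η g z)) (q.1 - prox η g z) ≤ q.2 := by
  have ha : 0 < 1 / (2 * η) := by positivity
  obtain ⟨q0, hq0, hmin⟩ := exists_min_conjEpi hL hc hd hs ha z
  have hgle : ∀ q ∈ conjEpi f L, g q.1 ≤ (q.2 : EReal) := by
    intro q hq
    have := conj_le_of_mem_conjEpi (y := q.1) (r := q.2) hq
    rw [hg]
    refine EReal.sub_le_of_le_add ?_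
    rw [← EReal.coe_add]
    exact this
  have hgcase : ∀ w, g w = ⊤ ∨ ∃ r : ℝ, g w = r ∧ (w, r) ∈ conjEpi f L := by
    intro w
    rcases conj_eq_top_or_coe f w with h | ⟨r, h⟩
    · left
      rw [hg]
      simp only [h]
      exact EReal.top_sub_coe _
    · right
      refine ⟨_, ?_, mem_conjEpi_of_conj_eq h⟩
      rw [hg]
      simp only [h]
      rw [EReal.coe_sub]
  have hex : ∃ v, ∀ w : Param d,
      ((1 / (2 * η) * ‖v - z‖ ^ 2 : ℝ) : EReal) + g v ≤
        ((1 / (2 * η) * ‖w - z‖ ^ 2 : ℝ) : EReal) + g w := by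
    refine ⟨q0.1, fun w => ?_⟩
    rcases hgcase w with h | ⟨r, h, hr⟩
    · rw [h, EReal.coe_add_top]
      exact le_top
    · rw [h]
      refine (add_le_add le_rfl (hgle q0 hq0)).trans ?_
      have h5 := hmin (w, r) hr
      rw [← EReal.coe_add, ← EReal.coe_add, EReal.coe_le_coe_iff]
      exact h5
  -- `prox` is defined by a choice, so it is a minimizer only once existence is known; no uniqueness
  -- is needed.
  have hv := Classical.epsilon_spec hex
  change ∀ w : Param d, ((1 / (2 * η) * ‖prox η g z - z‖ ^ 2 : ℝ) : EReal) + g (prox η g z) ≤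
        ((1 / (2 * η) * ‖w - z‖ ^ 2 : ℝ) : EReal) + g w at hv
  generalize prox η g z = v at hv ⊢
  rcases hgcase v with h | ⟨r, h, hr⟩
  · have := (hv q0.1).trans (add_le_add le_rfl (hgle q0 hq0))
    rw [h, EReal.coe_add_top, ← EReal.coe_add, top_le_iff] at this
    exact absurd this (EReal.coe_ne_top _)
  · refine ⟨r, h, hr, fun q hq => ?_⟩
    have hq2 : ∀ q ∈ conjEpi f L,
        1 / (2 * η) * ‖v - z‖ ^ 2 + r ≤ 1 / (2 * η) * ‖q.1 - z‖ ^ 2 + q.2 := by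
      intro q hq
      have := (hv q.1).trans (add_le_add le_rfl (hgle q hq))
      rw [h, ← EReal.coe_add, ← EReal.coe_add] at this
      exact EReal.coe_le_coe_iff.1 this
    exact add_inner_le_of_isMin (convex_conjEpi hL hd hs) hr hq2 hq hη

end Smooth

/-! ### Random schedules -/

section Schedule

variable {n m : ℕ} {G : SimpleGraph (Fin n)} {p : Edge G m → ℝ}

theorem expect_succ (p : Edge G m → ℝ) (t : ℕ) (g : (Fin (t + 1) → Edge G m) → ℝ) :
    expect p (t + 1) g = expect p t fun s => ∑ e, p e * g (Fin.snoc s e) := by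
  unfold expect
  rw [← (Fin.snocEquiv fun _ : Fin (t + 1) => Edge G m).sum_comp, Fintype.sum_prod_type_right]
  refine Finset.sum_congr rfl fun s _ => ?_
  rw [Finset.mul_sum]
  refine Finset.sum_congr rfl fun e _ => ?_
  rw [Fin.prod_univ_castSucc]
  simp [Fin.snocEquiv, mul_assoc]

theorem expect_mono (hp : ∀ e, 0 ≤ p e) {t : ℕ} {g h : (Fin t → Edge G m) → ℝ}
    (hgh : ∀ s, g s ≤ h s) : expect p t g ≤ expect p t h :=
  Finset.sum_le_sum fun s _ =>
    mul_le_mul_of_nonneg_left (hgh s) (Finset.prod_nonneg fun _ _ => hp _)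

theorem expect_const_mul (p : Edge G m → ℝ) (t : ℕ) (a : ℝ) (g : (Fin t → Edge G m) → ℝ) :
    expect p t (fun s => a * g s) = a * expect p t g := by
  simp only [expect, Finset.mul_sum]
  exact Finset.sum_congr rfl fun _ _ => by ring

theorem expect_one (hp1 : ∑ e, p e = 1) (t : ℕ) : expect p t (fun _ => 1) = 1 := by
  induction t with
  | zero => simp [expect]
  | succ t ih => simpa [expect_succ, hp1] using ih

/-- Geometric decay of a potential along a random schedule. -/
theorem expect_run_le {S : Type} (hp : ∀ e, 0 ≤ p e) (step : S → Edge G m → S)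
    (run : (t : ℕ) → (Fin t → Edge G m) → S) (s₀ : S) (h₀ : ∀ s, run 0 s = s₀)
    (hrun : ∀ t s, run (t + 1) s = step (run t (Fin.init s)) (s (Fin.last t)))
    (Inv : S → Prop) (hInv₀ : Inv s₀) (hInv : ∀ x e, Inv x → Inv (step x e))
    (Φ : S → ℝ) {r : ℝ} (hr : 0 ≤ r)
    (hΦ : ∀ x, Inv x → ∑ e, p e * Φ (step x e) ≤ r * Φ x) (t : ℕ) :
    expect p t (fun s => Φ (run t s)) ≤ r ^ t * Φ s₀ := by
  have hall : ∀ t s, Inv (run t s) := by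
    intro t
    induction t with
    | zero => intro s; rw [h₀]; exact hInv₀
    | succ t ih => intro s; rw [hrun]; exact hInv _ _ (ih _)
  induction t with
  | zero => simp [expect, h₀]
  | succ t ih =>
    rw [expect_succ]
    calc expect p t (fun s => ∑ e, p e * Φ (run (t + 1) (Fin.snoc s e)))
        ≤ expect p t (fun s => r * Φ (run t s)) := by
          refine expect_mono hp fun s => ?_
          refine le_of_eq_of_le (Finset.sum_congr rfl fun e _ => ?_) (hΦ _ (hall t s))
          rw [hrun, Fin.init_snoc, Fin.snoc_last]
      _ = r * expect p t (fun s => Φ (run t s)) := expect_const_mul _ _ _ _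
      _ ≤ r * (r ^ t * Φ s₀) := mul_le_mul_of_nonneg_left ih hr
      _ = r ^ (t + 1) * Φ s₀ := by ring

theorem prob_le_one (hp : ∀ e, 0 ≤ p e) (hp1 : ∑ e, p e = 1) (t : ℕ)
    (S : (Fin t → Edge G m) → Prop) : prob p t S ≤ 1 := by
  classical
  rw [← expect_one hp1 t]
  exact expect_mono hp fun s => by split_ifs <;> norm_num

theorem prob_mono (hp : ∀ e, 0 ≤ p e) {t : ℕ} {S S' : (Fin t → Edge G m) → Prop}
    (h : ∀ s, S s → S' s) : prob p t S ≤ prob p t S' := by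
  classical
  refine expect_mono hp fun s => ?_
  by_cases hs : S s
  · simp [hs, h s hs]
  · simp only [hs, if_false]
    split_ifs <;> norm_num

/-- Markov's inequality, for the complement. -/
theorem one_sub_le_prob (hp : ∀ e, 0 ≤ p e) (hp1 : ∑ e, p e = 1) {t : ℕ}
    {S : (Fin t → Edge G m) → Prop} {g : (Fin t → Edge G m) → ℝ} (hg : ∀ s, 0 ≤ g s)
    (hS : ∀ s, ¬ S s → 1 ≤ g s) : 1 - expect p t g ≤ prob p t S := by
  classical
  have h1 : expect p t (fun _ => 1) ≤ expect p t (fun s => (if S s then 1 else 0) + g s) := by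
    refine expect_mono hp fun s => ?_
    by_cases h : S s
    · simpa [h] using hg s
    · simpa [h] using hS s h
  have h2 : expect p t (fun s => (if S s then 1 else 0) + g s) = prob p t S + expect p t g := by
    simp only [prob, expect, mul_add, Finset.sum_add_distrib]
  rw [expect_one hp1] at h1
  linarith

/-! ### Execution time -/

/-- The exponential potential of the local times. -/
def expPot (a : ℝ) (T : Fin n → ℝ) : ℝ := ∑ k, Real.exp (a * T k)

theorem expPot_comp (a τ : ℝ) (T : Fin n → ℝ) (i : Fin n) (j : Fin m) :
    expPot a (timeStep τ T (Sum.inr (i, j) : Edge G m)) =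
      expPot a T + (Real.exp a - 1) * Real.exp (a * T i) := by
  rw [← sub_eq_iff_eq_add', expPot, expPot, ← Finset.sum_sub_distrib, Finset.sum_eq_single i]
  · simp only [timeStep, if_true, mul_add, mul_one, Real.exp_add]
    ring
  · intro k _ hk
    simp [timeStep, hk]
  · simp

/-- Both endpoints receive the same new time, and the exponential of a maximum is at most the sum of
the exponentials; hence the factor `2`. -/
theorem expPot_comm (a τ : ℝ) (T : Fin n → ℝ) (e : CommEdge G) :
    expPot a (timeStep τ T (Sum.inl e : Edge G m)) ≤
      expPot a T + (2 * Real.exp (a * τ) - 1) *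
        (Real.exp (a * T e.1.1) + Real.exp (a * T e.1.2)) := by
  have hne : e.1.1 ≠ e.1.2 := e.2.1.ne
  rw [← sub_le_iff_le_add', expPot, expPot, ← Finset.sum_sub_distrib,
    Finset.sum_eq_add e.1.1 e.1.2 hne]
  · have hmax : Real.exp (a * max (T e.1.1) (T e.1.2)) ≤
        Real.exp (a * T e.1.1) + Real.exp (a * T e.1.2) := by
      rcases max_choice (T e.1.1) (T e.1.2) with h | h <;> rw [h]
      · linarith [Real.exp_pos (a * T e.1.2)]
      · linarith [Real.exp_pos (a * T e.1.1)]
    have h2 := mul_le_mul_of_nonneg_right hmax (Real.exp_pos (a * τ)).le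
    simp only [timeStep, true_or, or_true, if_true, mul_add, Real.exp_add]
    linarith
  · intro k _ hk
    simp [timeStep, hk.1, hk.2]
  · simp
  · simp

theorem sum_comm_le_pMax (p : Edge G m → ℝ) (hn : 0 < n) (k : Fin n) :
    ∑ e : CommEdge G with e.1.1 = k ∨ e.1.2 = k, p (Sum.inl e) ≤ 2 * pMax p / n := by
  have h := le_ciSup (f := fun k : Fin n =>
    (∑ e : CommEdge G with e.1.1 = k ∨ e.1.2 = k, p (Sum.inl e)) / 2)
    (Set.finite_range _).bddAbove k
  have hn' : (0 : ℝ) < n := by exact_mod_cast hn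
  rw [pMax, le_div_iff₀ hn']
  linarith [mul_le_mul_of_nonneg_left h hn'.le]

theorem pMax_nonneg (hp : ∀ e, 0 ≤ p e) : 0 ≤ pMax p := by
  refine mul_nonneg (Nat.cast_nonneg _) (Real.iSup_nonneg fun k => ?_)
  exact div_nonneg (Finset.sum_nonneg fun _ _ => hp _) zero_le_two

/-- Double counting: after exchanging the sums, each node carries the total probability of its
communication edges. -/
theorem sum_comm_mul_le (p : Edge G m → ℝ) (hn : 0 < n) {w : Fin n → ℝ} (hw : ∀ k, 0 ≤ w k) :
    ∑ e : CommEdge G, p (Sum.inl e) * (w e.1.1 + w e.1.2) ≤ 2 * pMax p / n * ∑ k, w k := by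
  have h1 : ∀ e : CommEdge G, p (Sum.inl e) * (w e.1.1 + w e.1.2) =
      ∑ k, if e.1.1 = k ∨ e.1.2 = k then p (Sum.inl e) * w k else 0 := by
    intro e
    have hne : e.1.1 ≠ e.1.2 := e.2.1.ne
    rw [Finset.sum_eq_add e.1.1 e.1.2 hne]
    · simp [mul_add]
    · intro k _ hk
      simp [hk.1.symm, hk.2.symm]
    · simp
    · simp
  rw [Finset.sum_congr rfl fun e _ => h1 e, Finset.sum_comm, Finset.mul_sum]
  refine Finset.sum_le_sum fun k _ => ?_
  rw [← Finset.sum_filter, ← Finset.sum_mul]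
  exact mul_le_mul_of_nonneg_right (sum_comm_le_pMax p hn k) (hw k)

theorem expPot_step_le (hp : ∀ e, 0 ≤ p e) (hp1 : ∑ e, p e = 1) (hn : 0 < n)
    (hloc : ∀ i, ∑ j, p (Sum.inr (i, j)) = pComp p / n) {a τ : ℝ} (ha : 0 ≤ a) (hτ : 0 ≤ τ)
    (T : Fin n → ℝ) :
    ∑ e, p e * expPot a (timeStep τ T e) ≤
      (1 + (pComp p * (Real.exp a - 1) + 2 * pMax p * (2 * Real.exp (a * τ) - 1)) / n) *
        expPot a T := by
  have hexp : 0 ≤ 2 * Real.exp (a * τ) - 1 := by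
    have := Real.one_le_exp (mul_nonneg ha hτ)
    linarith
  have h1 : ∑ e : CommEdge G, p (Sum.inl e) * expPot a (timeStep τ T (Sum.inl e : Edge G m)) ≤
      pComm p * expPot a T + (2 * Real.exp (a * τ) - 1) * (2 * pMax p / n * expPot a T) := by
    calc _ ≤ ∑ e : CommEdge G, (p (Sum.inl e) * expPot a T + (2 * Real.exp (a * τ) - 1) *
            (p (Sum.inl e) * (Real.exp (a * T e.1.1) + Real.exp (a * T e.1.2)))) := by
          refine Finset.sum_le_sum fun e _ => ?_
          have := mul_le_mul_of_nonneg_left (expPot_comm (m := m) a τ T e)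
            (hp (Sum.inl e))
          linarith
      _ = pComm p * expPot a T + (2 * Real.exp (a * τ) - 1) * ∑ e : CommEdge G,
            p (Sum.inl e) * (Real.exp (a * T e.1.1) + Real.exp (a * T e.1.2)) := by
          rw [Finset.sum_add_distrib, ← Finset.sum_mul, ← Finset.mul_sum, pComm]
      _ ≤ _ := by
          gcongr
          exact sum_comm_mul_le p hn (w := fun k => Real.exp (a * T k))
            fun k => (Real.exp_pos _).le
  have h2 : ∑ ij : Fin n × Fin m,
      p (Sum.inr ij) * expPot a (timeStep τ T (Sum.inr ij : Edge G m)) =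
      pComp p * expPot a T + (Real.exp a - 1) * (pComp p / n * expPot a T) := by
    have e1 : ∀ ij : Fin n × Fin m,
        p (Sum.inr ij) * expPot a (timeStep τ T (Sum.inr ij : Edge G m)) =
        p (Sum.inr ij) * expPot a T +
          (Real.exp a - 1) * (p (Sum.inr ij) * Real.exp (a * T ij.1)) := by
      rintro ⟨i, j⟩
      rw [expPot_comp]
      ring
    rw [Finset.sum_congr rfl fun ij _ => e1 ij, Finset.sum_add_distrib, ← Finset.sum_mul,
      ← Finset.mul_sum, pComp]
    congr 2
    rw [Fintype.sum_prod_type]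
    simp only [← Finset.sum_mul, hloc]
    rw [← Finset.mul_sum, expPot, pComp]
  have h3 : pComm p + pComp p = 1 := by
    rw [← hp1, Fintype.sum_sum_type, pComm, pComp]
  rw [Fintype.sum_sum_type, h2]
  calc _ ≤ _ := add_le_add_left h1 _
    _ = (pComm p + pComp p) * expPot a T + (pComp p * (Real.exp a - 1) +
          2 * pMax p * (2 * Real.exp (a * τ) - 1)) / n * expPot a T := by ring
    _ = _ := by rw [h3]; ring

theorem expect_expPot_le (hp : ∀ e, 0 ≤ p e) (hp1 : ∑ e, p e = 1) (hn : 0 < n)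
    (hloc : ∀ i, ∑ j, p (Sum.inr (i, j)) = pComp p / n) {a τ : ℝ} (ha : 0 ≤ a) (hτ : 0 ≤ τ)
    (t : ℕ) :
    expect p t (fun s => expPot a (nodeTime τ t s)) ≤
      n * Real.exp ((pComp p * (Real.exp a - 1) +
        2 * pMax p * (2 * Real.exp (a * τ) - 1)) / n * t) := by
  have hpc : 0 ≤ pComp p := Finset.sum_nonneg fun _ _ => hp _
  have hc : 0 ≤ (pComp p * (Real.exp a - 1) +
      2 * pMax p * (2 * Real.exp (a * τ) - 1)) / n := by
    have h1 := Real.one_le_exp (mul_nonneg ha hτ)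
    have h2 := Real.one_le_exp ha
    refine div_nonneg (add_nonneg (mul_nonneg hpc (by linarith))
      (mul_nonneg (mul_nonneg zero_le_two (pMax_nonneg hp)) (by linarith))) (Nat.cast_nonneg _)
  set c := (pComp p * (Real.exp a - 1) + 2 * pMax p * (2 * Real.exp (a * τ) - 1)) / n
  have h := expect_run_le hp (timeStep τ) (nodeTime τ) 0 (fun _ => rfl) (fun _ _ => rfl)
    (fun _ => True) trivial (fun _ _ _ => trivial) (expPot a) (r := 1 + c) (by linarith)
    (fun T _ => expPot_step_le hp hp1 hn hloc ha hτ T) t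
  refine h.trans ?_
  have e1 : expPot a (0 : Fin n → ℝ) = n := by simp [expPot]
  -- It remains to compare `(1 + c) ^ t` with `exp c ^ t`.
  rw [e1, mul_comm, mul_comm c, Real.exp_nat_mul]
  refine mul_le_mul_of_nonneg_left (pow_le_pow_left₀ (by linarith) ?_ t) (Nat.cast_nonneg _)
  linarith [Real.add_one_le_exp c]

/-- Chernoff's method: on the complementary event one term of the potential already exceeds `exp (a
x)`. -/
theorem one_sub_le_prob_execTime (hp : ∀ e, 0 ≤ p e) (hp1 : ∑ e, p e = 1) (hn : 0 < n)
    (hloc : ∀ i, ∑ j, p (Sum.inr (i, j)) = pComp p / n) {a τ : ℝ} (ha : 0 < a) (hτ : 0 ≤ τ)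
    (t : ℕ) (x : ℝ) :
    1 - n * Real.exp ((pComp p * (Real.exp a - 1) +
        2 * pMax p * (2 * Real.exp (a * τ) - 1)) / n * t - a * x) ≤
      prob p t fun s => execTime τ t s ≤ x := by
  have : Nonempty (Fin n) := ⟨⟨0, hn⟩⟩
  refine le_trans ?_ (one_sub_le_prob hp hp1
    (g := fun s => Real.exp (-(a * x)) * expPot a (nodeTime τ t s)) (fun s => ?_) fun s hs => ?_)
  · rw [expect_const_mul]
    have h := mul_le_mul_of_nonneg_left (expect_expPot_le hp hp1 hn hloc ha.le hτ t)
      (Real.exp_pos (-(a * x))).le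
    rw [sub_eq_add_neg (_ * (t : ℝ)), Real.exp_add]
    linarith
  · exact mul_nonneg (Real.exp_pos _).le (Finset.sum_nonneg fun _ _ => (Real.exp_pos _).le)
  · rw [not_le, execTime] at hs
    obtain ⟨k, hk⟩ := exists_lt_of_lt_ciSup hs
    have h1 : Real.exp (a * x) ≤ expPot a (nodeTime τ t s) :=
      (Real.exp_le_exp.2 (mul_le_mul_of_nonneg_left hk.le ha.le)).trans
        (Finset.single_le_sum (f := fun k => Real.exp (a * nodeTime τ t s k))
          (fun _ _ => (Real.exp_pos _).le) (Finset.mem_univ k))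
    calc (1 : ℝ) = Real.exp (-(a * x)) * Real.exp (a * x) := by rw [← Real.exp_add]; simp
      _ ≤ _ := mul_le_mul_of_nonneg_left h1 (Real.exp_pos _).le

theorem exp_mul_sub_one_le {a b : ℝ} (hb0 : 0 ≤ b) (hb1 : b ≤ 1) :
    Real.exp (a * b) - 1 ≤ b * (Real.exp a - 1) := by
  have h := convexOn_exp.2 (Set.mem_univ (0 : ℝ)) (Set.mem_univ a) (sub_nonneg.2 hb1) hb0
    (by ring)
  simp only [smul_eq_mul, mul_zero, zero_add, Real.exp_zero, mul_one] at h
  rw [mul_comm a b]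
  linarith

/-- A rate at which the exponential moments of the local times are controlled. -/
theorem exists_exp_rate (hp : ∀ e, 0 ≤ p e) (hp1 : ∑ e, p e = 1) {τ : ℝ} (hτ : 0 ≤ τ)
    (h : pMax p ≤ pComp p ∨ 1 < τ) (hn : 0 < n) :
    ∃ a : ℝ, 0 < a ∧ 0 < pComp p + 2 * τ * pMax p ∧
      pComp p * (Real.exp a - 1) + 2 * pMax p * (2 * Real.exp (a * τ) - 1) <
        a * (5 * (pComp p + 2 * τ * pMax p)) := by
  have hpc : 0 ≤ pComp p := Finset.sum_nonneg fun _ _ => hp _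
  have hpm := pMax_nonneg hp
  have h3 : pComm p + pComp p = 1 := by
    rw [← hp1, Fintype.sum_sum_type, pComm, pComp]
  -- Without communications all the mass is on local updates; this excludes the degenerate cases
  -- where a strict inequality could fail.
  have hcm : pMax p = 0 → pComm p = 0 := by
    intro h0
    refine Finset.sum_eq_zero fun e _ => le_antisymm ?_ (hp _)
    have := sum_comm_le_pMax p hn e.1.1
    rw [h0, mul_zero, zero_div] at this
    refine le_trans ?_ this
    exact Finset.single_le_sum (f := fun e : CommEdge G => p (Sum.inl e)) (fun _ _ => hp _)
      (by simp)
  have he := Real.exp_one_lt_d9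
  rcases lt_or_ge 1 τ with h1 | h1
  · have hτ0 : 0 < τ := by linarith
    have hpos : 0 < pComp p + 2 * τ * pMax p := by
      rcases hpm.eq_or_lt with h0 | h0
      · rw [← h0]
        linarith [hcm h0.symm]
      · positivity
    -- For long communications time is measured in units of `τ`: then `exp (a τ) = e` and `2 (2 e -
    -- 1) < 10`, while convexity gives `exp τ⁻¹ - 1 ≤ 2 τ⁻¹`.
    refine ⟨τ⁻¹, inv_pos.2 hτ0, hpos, ?_⟩
    have h4 := exp_mul_sub_one_le (a := 1) (inv_nonneg.2 hτ) (inv_le_one_of_one_le₀ h1.le)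
    rw [one_mul] at h4
    rw [inv_mul_cancel₀ hτ0.ne']
    have h5 : pComp p * (Real.exp τ⁻¹ - 1) ≤ 2 * (τ⁻¹ * pComp p) := by
      have h6 : τ⁻¹ * (Real.exp 1 - 1) ≤ τ⁻¹ * 2 :=
        mul_le_mul_of_nonneg_left (by linarith) (inv_nonneg.2 hτ)
      have := mul_le_mul_of_nonneg_left (h4.trans h6) hpc
      linarith
    have h7 : τ⁻¹ * (5 * (pComp p + 2 * τ * pMax p)) = 5 * (τ⁻¹ * pComp p) + 10 * pMax p := by
      field_simp
      ring
    have h8 : 0 ≤ τ⁻¹ * pComp p := mul_nonneg (inv_nonneg.2 hτ) hpc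
    rw [h7]
    rcases hpm.eq_or_lt with h0 | h0
    · have : 0 < τ⁻¹ * pComp p := mul_pos (inv_pos.2 hτ0) (by linarith [hcm h0.symm])
      rw [← h0]
      linarith
    · nlinarith
  · have hle : pMax p ≤ pComp p := h.resolve_right (not_lt.2 h1)
    have hpc' : 0 < pComp p := by
      refine lt_of_le_of_ne hpc fun h0 => ?_
      have := hcm (le_antisymm (by linarith) hpm)
      linarith
    -- The communication term is at most `2 pMax + 8 τ pMax`. Its part independent of `τ` is
    -- absorbed by `pMax ≤ pComp`, and `e + 1 < 5`.
    refine ⟨1, one_pos, by positivity, ?_⟩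
    have h4 := exp_mul_sub_one_le (a := 1) hτ h1
    have h5 : Real.exp (1 * τ) ≤ 1 + 2 * τ := by nlinarith
    have h6 := mul_le_mul_of_nonneg_left h5 hpm
    nlinarith [mul_nonneg hpm hτ]

theorem tendsto_prob_execTime (hp : ∀ e, 0 ≤ p e) (hp1 : ∑ e, p e = 1) (hn : 0 < n)
    (hloc : ∀ i, ∑ j, p (Sum.inr (i, j)) = pComp p / n) {τ : ℝ} (hτ : 0 ≤ τ)
    (h : pMax p ≤ pComp p ∨ 1 < τ) :
    Tendsto (fun t : ℕ => prob p t fun s =>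
      execTime τ t s ≤ 5 / n * (pComp p + 2 * τ * pMax p) * t) atTop (𝓝 1) := by
  obtain ⟨a, ha, -, hlt⟩ := exists_exp_rate hp hp1 hτ h hn
  have hn' : (0 : ℝ) < n := by exact_mod_cast hn
  set c := pComp p * (Real.exp a - 1) + 2 * pMax p * (2 * Real.exp (a * τ) - 1)
  set b := a * (5 * (pComp p + 2 * τ * pMax p))
  refine tendsto_of_tendsto_of_tendsto_of_le_of_le (g := fun t : ℕ =>
    1 - n * Real.exp ((c - b) / n * t)) ?_ tendsto_const_nhds (fun t => ?_)
    fun t => prob_le_one hp hp1 t _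
  · have h1 : Tendsto (fun t : ℕ => (c - b) / n * (t : ℝ)) atTop atBot :=
      tendsto_natCast_atTop_atTop.const_mul_atTop_of_neg (div_neg_of_neg_of_pos (by linarith) hn')
    have h2 := ((Real.tendsto_exp_atBot.comp h1).const_mul (n : ℝ)).const_sub 1
    simpa using h2
  · refine le_of_eq_of_le ?_ (one_sub_le_prob_execTime hp hp1 hn hloc ha hτ t _)
    simp only [b, c]
    field_simp

theorem isSyncConstant_of_le {C : ℝ} (hC : 5 ≤ C) : IsSyncConstant C := by
  intro n m G τ p hτ hp hp1 hloc h
  have hn : 0 < n := by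
    rcases Nat.eq_zero_or_pos n with rfl | h0
    · have : IsEmpty (Edge G m) := by
        refine ⟨fun e => ?_⟩
        rcases e with e | e
        · exact e.1.1.elim0
        · exact e.1.elim0
      simp at hp1
    · exact h0
  have hn' : (0 : ℝ) < n := by exact_mod_cast hn
  obtain ⟨a, ha, hpos, -⟩ := exists_exp_rate hp hp1 hτ h hn
  refine tendsto_of_tendsto_of_tendsto_of_le_of_le' (tendsto_prob_execTime hp hp1 hn hloc hτ h)
    tendsto_const_nhds ?_ (Eventually.of_forall fun t => prob_le_one hp hp1 t _)
  filter_upwards [eventually_gt_atTop 0] with t ht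
  have ht' : (0 : ℝ) < t := by exact_mod_cast ht
  refine prob_mono hp fun s hs => ?_
  rw [one_div, inv_mul_le_iff₀ ht', mul_comm]
  refine hs.trans ?_
  gcongr

end Schedule

/-- For a symmetric matrix the range is the orthogonal complement of the kernel; the preimage
inverts the eigenvalues in an eigenbasis. -/
theorem exists_mulVec_eq {ι : Type} [Fintype ι] [DecidableEq ι] {M : Matrix ι ι ℝ}
    (hM : M.IsHermitian) (x : ι → ℝ) (hx : ∀ u, M.mulVec u = 0 → u ⬝ᵥ x = 0) :
    ∃ w, M.mulVec w = x := by
  refine ⟨∑ i, ((hM.eigenvalues i)⁻¹ * ((hM.eigenvectorBasis i).ofLp ⬝ᵥ x)) •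
    (hM.eigenvectorBasis i).ofLp, ?_⟩
  rw [Matrix.mulVec_sum]
  have h1 : ∀ i, M.mulVec (((hM.eigenvalues i)⁻¹ * ((hM.eigenvectorBasis i).ofLp ⬝ᵥ x)) •
      (hM.eigenvectorBasis i).ofLp) =
      ((hM.eigenvectorBasis i).ofLp ⬝ᵥ x) • (hM.eigenvectorBasis i).ofLp := by
    intro i
    rw [Matrix.mulVec_smul, hM.mulVec_eigenvectorBasis i, smul_smul]
    -- The convention `0⁻¹ = 0` is harmless, since the corresponding coordinate of `x` vanishes.
    by_cases h0 : hM.eigenvalues i = 0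
    · rw [hx _ (by rw [hM.mulVec_eigenvectorBasis i, h0, zero_smul])]
      simp
    · congr 1
      field_simp
  rw [Finset.sum_congr rfl fun i _ => h1 i]
  have h2 := hM.eigenvectorBasis.sum_repr' (WithLp.toLp 2 x)
  ext j
  have h3 := congrArg (fun v => v.ofLp j) h2
  simpa [EuclideanSpace.inner_eq_star_dotProduct, dotProduct_comm] using h3

/-! ### The incidence matrix -/

section Incidence

variable {n m : ℕ} {G : SimpleGraph (Fin n)}

theorem src_ne_dst (e : Edge G m) : src e ≠ dst e := by
  rcases e with e | ij
  · simpa [src, dst] using e.2.1.ne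
  · simp [src, dst]

theorem sum_edgeVec_mul (e : Edge G m) (x : Node n m → ℝ) :
    ∑ h, edgeVec e h * x h = x (src e) - x (dst e) := by
  simp [edgeVec, sub_mul, Finset.sum_sub_distrib]

theorem sum_edgeVec_smul {E : Type} [AddCommGroup E] [Module ℝ E] (e : Edge G m)
    (x : Node n m → E) : ∑ h, edgeVec e h • x h = x (src e) - x (dst e) := by
  simp [edgeVec, sub_smul, Finset.sum_sub_distrib]

theorem incMat_transpose_mulVec (μ : Edge G m → ℝ) (x : Node n m → ℝ) (e : Edge G m) :
    (incMat μ).transpose.mulVec x e = μ e * (x (src e) - x (dst e)) := by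
  rw [← sum_edgeVec_mul, Finset.mul_sum]
  simp [Matrix.mulVec, dotProduct, incMat, mul_assoc]

theorem rowMul_incMat_transpose {d : ℕ} (μ : Edge G m → ℝ) (x : Node n m → Param d)
    (e : Edge G m) :
    rowMul (incMat μ).transpose x e = μ e • (x (src e) - x (dst e)) := by
  rw [← sum_edgeVec_smul, Finset.smul_sum]
  simp [rowMul, incMat, smul_smul]

theorem incMat_inr (μ : Edge G m → ℝ) (ij : Fin n × Fin m) (e : Edge G m) :
    incMat μ (Sum.inr ij) e = if e = Sum.inr ij then - μ e else 0 := by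
  rcases e with e | kl
  · simp [incMat, edgeVec, src, dst]
  · by_cases h : kl = ij
    · simp [incMat, edgeVec, src, dst, h]
    · simp [incMat, edgeVec, src, dst, h, Ne.symm h]

theorem incMat_mulVec_inr (μ : Edge G m → ℝ) (u : Edge G m → ℝ) (ij : Fin n × Fin m) :
    (incMat μ).mulVec u (Sum.inr ij) = -(μ (Sum.inr ij) * u (Sum.inr ij)) := by
  simp only [Matrix.mulVec, dotProduct, incMat_inr, ite_mul, zero_mul]
  simp

theorem rowMul_incMat_inr {d : ℕ} (μ : Edge G m → ℝ) (u : Edge G m → Param d)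
    (ij : Fin n × Fin m) :
    rowMul (incMat μ) u (Sum.inr ij) = -(μ (Sum.inr ij) • u (Sum.inr ij)) := by
  simp only [rowMul, incMat_inr, ite_smul, zero_smul]
  simp

theorem sum_incMat (μ : Edge G m → ℝ) (e : Edge G m) : ∑ k, incMat μ k e = 0 := by
  have := sum_edgeVec_mul e (fun _ => (1 : ℝ))
  simp only [mul_one, sub_self] at this
  simp [incMat, ← Finset.mul_sum, this]

theorem sum_rowMul_incMat {d : ℕ} (μ : Edge G m → ℝ) (u : Edge G m → Param d) :
    ∑ k, rowMul (incMat μ) u k = 0 := by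
  simp only [rowMul]
  rw [Finset.sum_comm]
  simp only [← Finset.sum_smul, sum_incMat, zero_smul, Finset.sum_const_zero]

theorem sum_incMat_mulVec (μ : Edge G m → ℝ) (u : Edge G m → ℝ) :
    ∑ k, (incMat μ).mulVec u k = 0 := by
  simp only [Matrix.mulVec, dotProduct]
  rw [Finset.sum_comm]
  simp only [← Finset.sum_mul, sum_incMat, zero_mul, Finset.sum_const_zero]

theorem incMat_src_ne_zero {μ : Edge G m → ℝ} (hμ : ∀ e, 0 < μ e) (e : Edge G m) :
    incMat μ (src e) e ≠ 0 := by
  simp [incMat, edgeVec, src_ne_dst, (hμ e).ne']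

theorem eq_of_adj_eq (hG : G.Connected) {u : Fin n → ℝ}
    (h : ∀ e : CommEdge G, u e.1.1 = u e.1.2) (i k : Fin n) : u i = u k := by
  obtain ⟨w⟩ := hG.preconnected i k
  induction w with
  | nil => rfl
  | cons hadj _ ih =>
    rename_i a b c _
    refine Eq.trans ?_ ih
    rcases lt_or_gt_of_ne hadj.ne with hlt | hlt
    · exact h ⟨(a, b), hlt, hadj⟩
    · exact (h ⟨(b, a), hlt, hadj.symm⟩).symm

/-- Values agree along edges; the center nodes are connected and each virtual node hangs from its
center. -/
theorem eq_of_incMat_transpose_mulVec_eq_zero (hG : G.Connected) {μ : Edge G m → ℝ}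
    (hμ : ∀ e, 0 < μ e) {u : Node n m → ℝ} (h : (incMat μ).transpose.mulVec u = 0)
    (k l : Node n m) : u k = u l := by
  have he : ∀ e : Edge G m, u (src e) = u (dst e) := by
    intro e
    have := congrFun h e
    rw [incMat_transpose_mulVec, Pi.zero_apply, mul_eq_zero] at this
    exact sub_eq_zero.1 (this.resolve_left (hμ e).ne')
  have hc : ∀ i k : Fin n, u (Sum.inl i) = u (Sum.inl k) :=
    eq_of_adj_eq hG (u := fun i => u (Sum.inl i)) fun e => he (Sum.inl e)
  have hroot : ∀ k : Node n m, ∃ i : Fin n, u k = u (Sum.inl i) := by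
    rintro (i | ij)
    · exact ⟨i, rfl⟩
    · exact ⟨ij.1, (he (Sum.inr ij)).symm⟩
  obtain ⟨i, hi⟩ := hroot k
  obtain ⟨i', hi'⟩ := hroot l
  rw [hi, hi', hc i i']

/-- The columns in the range of the incidence matrix are those of sum zero. -/
theorem exists_rowMul_incMat_eq {d : ℕ} (hG : G.Connected) {μ : Edge G m → ℝ}
    (hμ : ∀ e, 0 < μ e) (x : Node n m → Param d) (hx : ∑ k, x k = 0) :
    ∃ lam : Edge G m → Param d, rowMul (incMat μ) lam = x := by
  have hM : (incMat μ * (incMat μ).transpose).PosSemidef := by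
    simpa using Matrix.posSemidef_self_mul_conjTranspose (incMat μ)
  have hex : ∀ c : Fin d, ∃ w : Node n m → ℝ,
      (incMat μ * (incMat μ).transpose).mulVec w = fun k => x k c := by
    intro c
    refine exists_mulVec_eq hM.1 _ fun u hu => ?_
    have h1 : (incMat μ).transpose.mulVec u = 0 := by
      rw [← dotProduct_self_eq_zero, Matrix.mulVec_transpose, ← Matrix.dotProduct_mulVec,
        ← Matrix.mulVec_transpose, Matrix.mulVec_mulVec, hu, dotProduct_zero]
    have h2 := eq_of_incMat_transpose_mulVec_eq_zero hG hμ h1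
    have h3 : ∑ k, x k c = 0 := by
      have := congrArg (fun v : Param d => v c) hx
      simpa using this
    have hne : Nonempty (Fin n) := hG.nonempty
    obtain ⟨i⟩ := hne
    simp only [dotProduct, h2 _ (Sum.inl i)]
    rw [← Finset.mul_sum, h3, mul_zero]
  choose w hw using hex
  refine ⟨fun e => WithLp.toLp 2 fun c => (incMat μ).transpose.mulVec (w c) e, ?_⟩
  ext k c
  have h1 := congrFun (rowMul_apply_coord (incMat μ)
    (fun e => WithLp.toLp 2 fun c => (incMat μ).transpose.mulVec (w c) e : Edge G m → Param d) c) k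
  have h2 := congrFun (hw c) k
  rw [← Matrix.mulVec_mulVec] at h2
  exact h1.trans h2

theorem commIncMat_transpose_mulVec (μ : Edge G m → ℝ) (x : Fin n → ℝ) (e : CommEdge G) :
    (commIncMat μ).transpose.mulVec x e = μ (Sum.inl e) * (x e.1.1 - x e.1.2) := by
  simp only [Matrix.mulVec, dotProduct, commIncMat, Matrix.transpose_apply, Matrix.of_apply,
    mul_assoc, ← Finset.mul_sum]
  congr 1
  simp [sub_mul, Finset.sum_sub_distrib]

theorem posSemidef_commLap (μ : Edge G m → ℝ) : (commLap μ).PosSemidef := by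
  simpa [commLap] using Matrix.posSemidef_self_mul_conjTranspose (commIncMat μ)

theorem dotProduct_commLap_mulVec (μ : Edge G m → ℝ) (x : Fin n → ℝ) :
    x ⬝ᵥ (commLap μ).mulVec x = ∑ e : CommEdge G, μ (Sum.inl e) ^ 2 * (x e.1.1 - x e.1.2) ^ 2 := by
  rw [commLap, ← Matrix.mulVec_mulVec, Matrix.dotProduct_mulVec, ← Matrix.mulVec_transpose]
  simp only [dotProduct, commIncMat_transpose_mulVec]
  exact Finset.sum_congr rfl fun _ _ => by ring

/-- By connectedness the kernel of the Laplacian consists of constants, to which a vector of sum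
zero is orthogonal. -/
theorem lamMinPos_commLap_mul_le (hG : G.Connected) {μ : Edge G m → ℝ} (hμ : ∀ e, 0 < μ e)
    (x : Fin n → ℝ) (hx : ∑ i, x i = 0) :
    lamMinPos (commLap μ) * ∑ i, x i ^ 2 ≤
      ∑ e : CommEdge G, μ (Sum.inl e) ^ 2 * (x e.1.1 - x e.1.2) ^ 2 := by
  have h := lamMinPos_mul_le (posSemidef_commLap μ) x fun u hu => ?_
  · rw [dotProduct_commLap_mulVec] at h
    simpa [dotProduct, ← sq] using h
  · have h1 := dotProduct_commLap_mulVec μ u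
    rw [hu, dotProduct_zero, eq_comm, Finset.sum_eq_zero_iff_of_nonneg
      (fun _ _ => by positivity)] at h1
    have h2 := eq_of_adj_eq hG (u := u) fun e => by
      have := h1 e (Finset.mem_univ _)
      rw [mul_eq_zero, pow_eq_zero_iff two_ne_zero, pow_eq_zero_iff two_ne_zero] at this
      exact sub_eq_zero.1 (this.resolve_left (hμ _).ne')
    obtain ⟨i⟩ := hG.nonempty
    simp only [dotProduct, h2 _ i]
    rw [← Finset.mul_sum, hx, mul_zero]

theorem nonempty_commEdge (hG : G.Connected) (hn : 2 ≤ n) : Nonempty (CommEdge G) := by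
  have : Nontrivial (Fin n) := Fin.nontrivial_iff_two_le.2 hn
  obtain ⟨k, hk⟩ := hG.preconnected.exists_adj_of_nontrivial ⟨0, by omega⟩
  rcases lt_or_gt_of_ne hk.ne with hlt | hlt
  · exact ⟨⟨(_, k), hlt, hk⟩⟩
  · exact ⟨⟨(k, _), hlt, hk.symm⟩⟩

theorem lamMinPos_commLap_pos (hG : G.Connected) (hn : 2 ≤ n) {μ : Edge G m → ℝ}
    (hμ : ∀ e, 0 < μ e) : 0 < lamMinPos (commLap μ) := by
  refine (lamMinPos_spec (posSemidef_commLap μ) fun h0 => ?_).1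
  obtain ⟨e⟩ := nonempty_commEdge hG hn
  have h := dotProduct_commLap_mulVec μ (Pi.single e.1.1 1)
  rw [h0, Matrix.zero_mulVec, dotProduct_zero, eq_comm, Finset.sum_eq_zero_iff_of_nonneg
      (fun _ _ => by positivity)] at h
  have h1 := h e (Finset.mem_univ _)
  simp [e.2.1.ne', (hμ (Sum.inl e)).ne'] at h1

end Incidence

/-! ### The strong convexity constant and the rate -/

section Rate

variable {n m d : ℕ} (P : Problem n m d) {μ p : Edge P.G m → ℝ}

theorem Problem.diag_pos (k : Node n m) : 0 < P.diag k := by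
  rcases k with i | ij
  · exact P.σ_pos i
  · exact P.L_pos _ _

/-- The Hessian `Aᵀ Σ⁻¹ A` of `q_A`. -/
abbrev Problem.hess (μ : Edge P.G m → ℝ) : Matrix (Edge P.G m) (Edge P.G m) ℝ :=
  (incMat μ).transpose * Matrix.diagonal (fun k => (P.diag k)⁻¹) * incMat μ

theorem posSemidef_transpose_diagonal_mul {κ ι : Type} [Fintype κ] [DecidableEq κ] [Fintype ι]
    (A : Matrix κ ι ℝ) {w : κ → ℝ} (hw : ∀ k, 0 ≤ w k) :
    (A.transpose * Matrix.diagonal w * A).PosSemidef := by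
  simpa using (Matrix.PosSemidef.diagonal (d := w) hw).conjTranspose_mul_mul_same A

theorem dotProduct_transpose_diagonal_mul {κ ι : Type} [Fintype κ] [DecidableEq κ] [Fintype ι]
    (A : Matrix κ ι ℝ) (w : κ → ℝ) (u : ι → ℝ) :
    u ⬝ᵥ (A.transpose * Matrix.diagonal w * A).mulVec u = ∑ k, w k * (A.mulVec u k) ^ 2 := by
  rw [Matrix.mul_assoc, ← Matrix.mulVec_mulVec, Matrix.dotProduct_mulVec, Matrix.vecMul_transpose,
    ← Matrix.mulVec_mulVec, dotProduct]
  simp only [Matrix.mulVec_diagonal]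
  exact Finset.sum_congr rfl fun _ _ => by ring

theorem colInner_transpose_diagonal_mul {κ ι : Type} [Fintype κ] [DecidableEq κ] [Fintype ι]
    (A : Matrix κ ι ℝ) (w : κ → ℝ) (y : ι → Param d) :
    colInner y (rowMul (A.transpose * Matrix.diagonal w * A) y) =
      ∑ k, w k * ‖rowMul A y k‖ ^ 2 := by
  rw [Matrix.mul_assoc, ← rowMul_rowMul, ← colInner_rowMul, ← rowMul_rowMul, colInner]
  refine Finset.sum_congr rfl fun k _ => ?_
  have : rowMul (Matrix.diagonal w) (rowMul A y) k = w k • rowMul A y k := by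
    rw [rowMul, Finset.sum_eq_single k]
    · simp
    · intro b _ hb
      simp [Matrix.diagonal_apply_ne' _ hb]
    · simp
  rw [this, real_inner_smul_right, real_inner_self_eq_norm_sq]

theorem transpose_diagonal_mul_mulVec_eq_zero {κ ι : Type} [Fintype κ] [DecidableEq κ] [Fintype ι]
    {A : Matrix κ ι ℝ} {w : κ → ℝ} (hw : ∀ k, 0 < w k) {u : ι → ℝ}
    (h : (A.transpose * Matrix.diagonal w * A).mulVec u = 0) : A.mulVec u = 0 := by
  have h1 := dotProduct_transpose_diagonal_mul A w u
  rw [h, dotProduct_zero, eq_comm, Finset.sum_eq_zero_iff_of_nonneg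
    (fun k _ => mul_nonneg (hw k).le (sq_nonneg _))] at h1
  ext k
  have := h1 k (Finset.mem_univ k)
  rw [mul_eq_zero, pow_eq_zero_iff two_ne_zero] at this
  exact this.resolve_left (hw k).ne'

theorem transpose_diagonal_mul_ne_zero (hμ : ∀ e, 0 < μ e) {w : Node n m → ℝ}
    (hw : ∀ k, 0 < w k) (e : Edge P.G m) :
    (incMat μ).transpose * Matrix.diagonal w * incMat μ ≠ 0 := by
  intro h0
  have h := transpose_diagonal_mul_mulVec_eq_zero (A := incMat μ) hw
    (u := Pi.single e 1) (by rw [h0, Matrix.zero_mulVec])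
  have := congrFun h (src e)
  rw [Matrix.mulVec_single_one] at this
  exact incMat_src_ne_zero hμ e this

theorem Problem.sigA_spec (hμ : ∀ e, 0 < μ e) (e : Edge P.G m) :
    0 < P.sigA μ ∧ Module.End.HasEigenvalue (Matrix.toLin' (P.hess μ)) (P.sigA μ) :=
  lamMinPos_spec (posSemidef_transpose_diagonal_mul _ fun k => (inv_pos.2 (P.diag_pos k)).le)
    (transpose_diagonal_mul_ne_zero P hμ (fun k => inv_pos.2 (P.diag_pos k)) e)

/-- Strong convexity of `q_A` on the orthogonal complement of the kernel of `A`. -/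
theorem Problem.sigA_mul_le (μ : Edge P.G m → ℝ) (y : Edge P.G m → Param d) :
    P.sigA μ * sqNorm (rowMul (pinvMul (incMat μ)) y) ≤ 2 * P.qA μ y := by
  have h := lamMinPos_mul_sqNorm_le (posSemidef_transpose_diagonal_mul (incMat μ)
    fun k => (inv_pos.2 (P.diag_pos k)).le) (rowMul (pinvMul (incMat μ)) y) fun u c hu => ?_
  · rw [colInner_transpose_diagonal_mul, rowMul_rowMul, mul_pinvMul] at h
    refine h.trans (le_of_eq ?_)
    rw [Problem.qA]
    ring
  · rw [rowMul_apply_coord]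
    exact dotProduct_pinvMul_mulVec _
      (transpose_diagonal_mul_mulVec_eq_zero (fun k => inv_pos.2 (P.diag_pos k)) hu) _

/-- The second derivative of `q_A` along an edge. -/
def Problem.edgeHess (μ : Edge P.G m → ℝ) (e : Edge P.G m) : ℝ :=
  μ e ^ 2 * ((P.diag (src e))⁻¹ + (P.diag (dst e))⁻¹)

theorem Problem.edgeHess_pos (hμ : ∀ e, 0 < μ e) (e : Edge P.G m) : 0 < P.edgeHess μ e :=
  mul_pos (pow_pos (hμ e) 2)
    (add_pos (inv_pos.2 (P.diag_pos _)) (inv_pos.2 (P.diag_pos _)))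

theorem incMat_sq_sum {G : SimpleGraph (Fin n)} (μ : Edge G m → ℝ) (w : Node n m → ℝ)
    (e : Edge G m) :
    ∑ k, w k * incMat μ k e ^ 2 = μ e ^ 2 * (w (src e) + w (dst e)) := by
  have hne := src_ne_dst e
  rw [Fintype.sum_eq_add (src e) (dst e) hne]
  · simp only [incMat, edgeVec, Matrix.of_apply, if_true, if_neg hne, if_neg hne.symm]
    ring
  · intro k hk
    simp [incMat, edgeVec, hk.1, hk.2]

theorem incMat_ker_inr (hμ : ∀ e, 0 < μ e) (ij : Fin n × Fin m) (u : Edge P.G m → ℝ)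
    (hu : (incMat μ).mulVec u = 0) : u (Sum.inr ij) = 0 := by
  have := congrFun hu (Sum.inr ij)
  rw [incMat_mulVec_inr, Pi.zero_apply, neg_eq_zero, mul_eq_zero] at this
  exact this.resolve_left (hμ _).ne'

theorem Problem.res_inr (hμ : ∀ e, 0 < μ e) (ij : Fin n × Fin m) : P.res μ (Sum.inr ij) = 1 := by
  rw [Problem.res, pinvMul_apply_of_ker _ (incMat_ker_inr P hμ ij), if_pos rfl]

theorem Problem.res_pos (hμ : ∀ e, 0 < μ e) (e : Edge P.G m) : 0 < P.res μ e :=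
  pinvMul_apply_self_pos _ ⟨_, incMat_src_ne_zero hμ e⟩

/-- The basis vector of a virtual edge is orthogonal to the kernel of `A`, so its Rayleigh quotient
is at least the smallest positive eigenvalue. -/
theorem Problem.sigA_le_edgeHess (hμ : ∀ e, 0 < μ e) (ij : Fin n × Fin m) :
    P.sigA μ ≤ P.edgeHess μ (Sum.inr ij) := by
  have h := lamMinPos_mul_le (posSemidef_transpose_diagonal_mul (incMat μ)
    fun k => (inv_pos.2 (P.diag_pos k)).le) (Pi.single (Sum.inr ij) 1) fun u hu => ?_
  · rw [dotProduct_transpose_diagonal_mul] at h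
    simp only [Matrix.mulVec_single_one, Matrix.col_apply, incMat_sq_sum, single_dotProduct,
      Pi.single_eq_same, mul_one] at h
    exact h
  · simp [incMat_ker_inr P hμ ij u
      (transpose_diagonal_mul_mulVec_eq_zero (fun k => inv_pos.2 (P.diag_pos k)) hu)]

theorem Problem.rate_sq_le (hμ : ∀ e, 0 < μ e) (e : Edge P.G m) :
    P.rate μ p ^ 2 * (P.edgeHess μ e * P.res μ e) ≤ P.sigA μ * p e ^ 2 := by
  have hM := P.edgeHess_pos hμ e
  have hR := P.res_pos hμ e
  have hnn : ∀ e : Edge P.G m, 0 ≤ P.sigA μ / ((P.diag (src e))⁻¹ + (P.diag (dst e))⁻¹) *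
      (p e ^ 2 / (μ e ^ 2 * P.res μ e)) := fun e =>
    mul_nonneg (div_nonneg (P.sigA_spec hμ e).1.le
      (add_pos (inv_pos.2 (P.diag_pos _)) (inv_pos.2 (P.diag_pos _))).le)
      (div_nonneg (sq_nonneg _) (mul_nonneg (sq_nonneg _) (P.res_pos hμ e).le))
  rw [Problem.rate, Real.sq_sqrt (Real.iInf_nonneg hnn)]
  have h := ciInf_le (Set.finite_range (fun e : Edge P.G m =>
    P.sigA μ / ((P.diag (src e))⁻¹ + (P.diag (dst e))⁻¹) *
      (p e ^ 2 / (μ e ^ 2 * P.res μ e)))).bddBelow e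
  rw [← le_div_iff₀ (mul_pos hM hR)]
  refine h.trans (le_of_eq ?_)
  rw [div_mul_div_comm, Problem.edgeHess]
  congr 1
  ring

theorem Problem.rate_eq (hμ : ∀ e, 0 < μ e) [Nonempty (Edge P.G m)] :
    ∃ e, P.rate μ p ^ 2 * (P.edgeHess μ e * P.res μ e) = P.sigA μ * p e ^ 2 := by
  obtain ⟨e, he⟩ := exists_eq_ciInf_of_finite (f := fun e : Edge P.G m =>
    P.sigA μ / ((P.diag (src e))⁻¹ + (P.diag (dst e))⁻¹) *
      (p e ^ 2 / (μ e ^ 2 * P.res μ e)))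
  refine ⟨e, ?_⟩
  have hM := P.edgeHess_pos hμ e
  have hR := P.res_pos hμ e
  have hs := (P.sigA_spec hμ e).1
  have hd := add_pos (inv_pos.2 (P.diag_pos (src e))) (inv_pos.2 (P.diag_pos (dst e)))
  rw [Problem.rate, ← he, Real.sq_sqrt (mul_nonneg (div_nonneg hs.le hd.le)
    (div_nonneg (sq_nonneg _) (mul_nonneg (sq_nonneg _) hR.le))), Problem.edgeHess]
  have := (hμ e).ne'
  generalize (P.diag (src e))⁻¹ + (P.diag (dst e))⁻¹ = D at hd
  field_simp

theorem Problem.rate_pos (hμ : ∀ e, 0 < μ e) (hp : ∀ e, 0 < p e) [Nonempty (Edge P.G m)] :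
    0 < P.rate μ p := by
  obtain ⟨e, he⟩ := P.rate_eq (p := p) hμ
  refine lt_of_le_of_ne (Real.sqrt_nonneg _) fun h => ?_
  rw [← h, zero_pow two_ne_zero, zero_mul] at he
  exact (mul_pos (P.sigA_spec hμ e).1 (pow_pos (hp e) 2)).ne he

/-- This makes `ρ / p_ij` a legitimate averaging weight, the condition for `x` to stay a convex
combination in `liftInv_step`. -/
theorem Problem.rate_le_inr (hμ : ∀ e, 0 < μ e) (hp : ∀ e, 0 < p e) (ij : Fin n × Fin m) :
    P.rate μ p ≤ p (Sum.inr ij) := by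
  refine (abs_le_of_sq_le_sq' ?_ (hp _).le).2
  have h1 := P.rate_sq_le (p := p) hμ (Sum.inr ij)
  rw [P.res_inr hμ, mul_one] at h1
  have h2 := mul_le_mul_of_nonneg_left (P.sigA_le_edgeHess hμ ij) (sq_nonneg (P.rate μ p))
  have h3 := (P.sigA_spec hμ (Sum.inr ij)).1
  refine le_of_mul_le_mul_left ?_ h3
  linarith

theorem Problem.le_sigMax (i : Fin n) : P.σ i ≤ P.sigMax :=
  le_ciSup (Set.finite_range P.σ).bddAbove i

theorem Problem.le_kapS (i : Fin n) : P.kap i ≤ P.kapS :=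
  le_ciSup (Set.finite_range P.kap).bddAbove i

theorem Problem.kapMin_le (i : Fin n) : P.kapMin ≤ P.kap i :=
  ciInf_le (Set.finite_range P.kap).bddBelow i

theorem Problem.one_le_kap (i : Fin n) : 1 ≤ P.kap i := by
  rw [Problem.kap, le_add_iff_nonneg_right]
  exact mul_nonneg (inv_nonneg.2 (P.σ_pos i).le) (Finset.sum_nonneg fun j _ => (P.L_pos i j).le)

/-- Poincaré inequality on the augmented graph. -/
theorem Problem.exists_center (hn : 0 < n) (hμ : ∀ e, 0 < μ e)
    (hL : 0 ≤ lamMinPos (commLap μ))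
    (hμv : ∀ i j, μ (Sum.inr (i, j)) ^ 2 =
      lamMinPos (commLap μ) / (P.sigMax * P.kap i) * P.L i j) (x : Node n m → ℝ) :
    ∃ c, lamMinPos (commLap μ) * ∑ k, P.diag k * (x k - c) ^ 2 ≤
      2 * (P.sigMax * P.kapS) * ∑ e : Edge P.G m, μ e ^ 2 * (x (src e) - x (dst e)) ^ 2 := by
  have hn' : (n : ℝ) ≠ 0 := by exact_mod_cast hn.ne'
  set lam := lamMinPos (commLap μ)
  -- Centering at the mean of the center nodes allows the use of the Laplacian's spectral gap;
  -- virtual nodes are then compared with their centers, at the price of the factor `2`.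
  set c := (∑ i, x (Sum.inl i)) / n with hc
  refine ⟨c, ?_⟩
  have hσ : ∀ i, 0 < P.sigMax := fun i => (P.σ_pos i).trans_le (P.le_sigMax i)
  have hκ : ∀ i, 0 < P.kap i := fun i => zero_lt_one.trans_le (P.one_le_kap i)
  have h1 := lamMinPos_commLap_mul_le P.connected hμ (fun i => x (Sum.inl i) - c) (by
    rw [Finset.sum_sub_distrib, hc]
    simp
    field_simp
    simp)
  simp only [sub_sub_sub_cancel_right] at h1
  rw [Fintype.sum_sum_type, Fintype.sum_prod_type, Fintype.sum_sum_type, Fintype.sum_prod_type,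
    mul_add, mul_add]
  have h2 : lam * ∑ i, (P.diag (Sum.inl i) * (x (Sum.inl i) - c) ^ 2 +
      ∑ j, P.diag (Sum.inr (i, j)) * (x (Sum.inr (i, j)) - c) ^ 2) ≤
      2 * (P.sigMax * P.kapS) * (lam * ∑ i, (x (Sum.inl i) - c) ^ 2) +
      2 * (P.sigMax * P.kapS) * ∑ i, ∑ j,
        μ (Sum.inr (i, j)) ^ 2 * (x (Sum.inl i) - x (Sum.inr (i, j))) ^ 2 := by
    simp only [Finset.mul_sum]
    rw [← Finset.sum_add_distrib]
    refine Finset.sum_le_sum fun i _ => ?_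
    have hSi := hσ i
    have hk := P.le_kapS i
    have hs := P.le_sigMax i
    set y := x (Sum.inl i) - c with hy
    have h3 : ∀ j, P.diag (Sum.inr (i, j)) * (x (Sum.inr (i, j)) - c) ^ 2 ≤
        2 * P.L i j * y ^ 2 + 2 * P.L i j * (x (Sum.inl i) - x (Sum.inr (i, j))) ^ 2 := by
      intro j
      have := P.L_pos i j
      change P.L i j * _ ≤ _
      have h4 : (x (Sum.inr (i, j)) - c) ^ 2 ≤
          2 * y ^ 2 + 2 * (x (Sum.inl i) - x (Sum.inr (i, j))) ^ 2 := by
        nlinarith [sq_nonneg (y + (x (Sum.inl i) - x (Sum.inr (i, j))))]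
      nlinarith
    have h4 : P.σ i + 2 * ∑ j, P.L i j ≤ 2 * (P.sigMax * P.kapS) := by
      have e1 : P.σ i + ∑ j, P.L i j = P.σ i * P.kap i := by
        rw [Problem.kap, mul_add, ← mul_assoc, mul_inv_cancel₀ (P.σ_pos i).ne']
        ring
      have e2 : P.σ i * P.kap i ≤ P.sigMax * P.kapS :=
        mul_le_mul hs hk (hκ i).le hSi.le
      have := P.σ_pos i
      linarith
    have h5 : ∀ j, lam * (2 * P.L i j * (x (Sum.inl i) - x (Sum.inr (i, j))) ^ 2) ≤
        2 * (P.sigMax * P.kapS) *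
          (μ (Sum.inr (i, j)) ^ 2 * (x (Sum.inl i) - x (Sum.inr (i, j))) ^ 2) := by
      intro j
      -- The weights of the virtual edges are chosen for this identity.
      have e1 : lam * P.L i j = P.sigMax * P.kap i * μ (Sum.inr (i, j)) ^ 2 := by
        rw [hμv]
        have := (hκ i).ne'
        field_simp
      have e2 : lam * P.L i j ≤ P.sigMax * P.kapS * μ (Sum.inr (i, j)) ^ 2 := by
        rw [e1]
        gcongr
      nlinarith [mul_le_mul_of_nonneg_right e2 (sq_nonneg (x (Sum.inl i) - x (Sum.inr (i, j))))]
    calc lam * (P.diag (Sum.inl i) * y ^ 2 +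
          ∑ j, P.diag (Sum.inr (i, j)) * (x (Sum.inr (i, j)) - c) ^ 2)
        ≤ lam * (P.σ i * y ^ 2 + ∑ j, (2 * P.L i j * y ^ 2 +
            2 * P.L i j * (x (Sum.inl i) - x (Sum.inr (i, j))) ^ 2)) := by
          gcongr with j _
          · exact le_rfl
          · exact h3 j
      _ = (P.σ i + 2 * ∑ j, P.L i j) * (lam * y ^ 2) +
          ∑ j, lam * (2 * P.L i j * (x (Sum.inl i) - x (Sum.inr (i, j))) ^ 2) := by
          rw [Finset.sum_add_distrib, ← Finset.sum_mul, ← Finset.mul_sum, ← Finset.mul_sum]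
          ring
      _ ≤ 2 * (P.sigMax * P.kapS) * (lam * y ^ 2) + ∑ j, 2 * (P.sigMax * P.kapS) *
          (μ (Sum.inr (i, j)) ^ 2 * (x (Sum.inl i) - x (Sum.inr (i, j))) ^ 2) := by
          refine add_le_add (mul_le_mul_of_nonneg_right h4 (by positivity))
            (Finset.sum_le_sum fun j _ => h5 j)
  rw [Finset.sum_add_distrib, mul_add] at h2
  refine h2.trans (add_le_add (mul_le_mul_of_nonneg_left h1 ?_) le_rfl)
  have hk := P.le_kapS ⟨0, hn⟩
  have h6 := hσ ⟨0, hn⟩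
  have h7 := hκ ⟨0, hn⟩
  exact mul_nonneg zero_le_two (mul_nonneg h6.le (h7.le.trans hk))

/-- Take an eigenvector `u` for `s = σ_A` and put `x = Σ⁻¹ A u`, so that `Aᵀ x = s u`. The Poincaré
inequality for `x` compares `s ‖u‖²` with `s² ‖u‖²`; its centering constant only helps, because the
`Σ`-weighted sum of `x` is zero. -/
theorem Problem.lamMinPos_le_sigA (hn : 0 < n) (hμ : ∀ e, 0 < μ e) (e₀ : Edge P.G m)
    (hL : 0 ≤ lamMinPos (commLap μ))
    (hμv : ∀ i j, μ (Sum.inr (i, j)) ^ 2 =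
      lamMinPos (commLap μ) / (P.sigMax * P.kap i) * P.L i j) :
    lamMinPos (commLap μ) ≤ 2 * (P.sigMax * P.kapS) * P.sigA μ := by
  obtain ⟨hs, heig⟩ := P.sigA_spec hμ e₀
  obtain ⟨u, hu0, hu⟩ := hasEigenvalue_iff_mulVec.1 heig
  set s := P.sigA μ
  set v := (incMat μ).mulVec u with hv
  set x : Node n m → ℝ := fun k => (P.diag k)⁻¹ * v k with hx
  obtain ⟨c, hc⟩ := P.exists_center hn hμ hL hμv x
  have hu2 : 0 < u ⬝ᵥ u := by
    refine lt_of_le_of_ne (Finset.sum_nonneg fun i _ => mul_self_nonneg _) fun h => ?_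
    exact hu0 (dotProduct_self_eq_zero.1 h.symm)
  have hAx : (incMat μ).transpose.mulVec x = s • u := by
    rw [← hu, Problem.hess, Matrix.mul_assoc, ← Matrix.mulVec_mulVec, ← Matrix.mulVec_mulVec]
    congr 1
    ext k
    rw [Matrix.mulVec_diagonal]
  have h1 : ∑ e : Edge P.G m, μ e ^ 2 * (x (src e) - x (dst e)) ^ 2 = s ^ 2 * (u ⬝ᵥ u) := by
    rw [dotProduct, Finset.mul_sum]
    refine Finset.sum_congr rfl fun e _ => ?_
    rw [← mul_pow, ← incMat_transpose_mulVec, hAx, Pi.smul_apply, smul_eq_mul]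
    ring
  have h2 : ∑ k, P.diag k * x k ^ 2 = s * (u ⬝ᵥ u) := by
    rw [← smul_eq_mul s, ← dotProduct_smul, ← hu, dotProduct_transpose_diagonal_mul]
    refine Finset.sum_congr rfl fun k _ => ?_
    have := (P.diag_pos k).ne'
    simp only [hx, hv]
    field_simp
  have h3 : ∑ k, P.diag k * x k = 0 := by
    rw [← sum_incMat_mulVec μ u]
    refine Finset.sum_congr rfl fun k _ => ?_
    have := (P.diag_pos k).ne'
    simp only [hx, hv]
    field_simp
  have h4 : s * (u ⬝ᵥ u) ≤ ∑ k, P.diag k * (x k - c) ^ 2 := by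
    have e1 : ∑ k, P.diag k * (x k - c) ^ 2 = ∑ k, P.diag k * x k ^ 2 -
        2 * c * ∑ k, P.diag k * x k + ∑ k, P.diag k * c ^ 2 := by
      rw [Finset.mul_sum, ← Finset.sum_sub_distrib, ← Finset.sum_add_distrib]
      exact Finset.sum_congr rfl fun _ _ => by ring
    rw [e1, h2, h3, mul_zero, sub_zero, le_add_iff_nonneg_right]
    exact Finset.sum_nonneg fun k _ => mul_nonneg (P.diag_pos k).le (sq_nonneg _)
  rw [h1] at hc
  have h5 := (mul_le_mul_of_nonneg_left h4 hL).trans hc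
  refine le_of_mul_le_mul_right ?_ (mul_pos hs hu2)
  linarith

end Rate

/-! ### The primal problem -/

section Primal

variable {n m d : ℕ} (P : Problem n m d)

/-- The gradient of the primal function. -/
def Problem.primalGrad (θ : Param d) : Param d :=
  ∑ i, (∑ j, gradient (P.f i j) θ + P.σ i • θ)

theorem Problem.hasDerivAt_primal (θ h : Param d) :
    HasDerivAt (fun t : ℝ => P.primal (θ + t • h)) (inner ℝ (P.primalGrad θ) h) 0 := by
  have h1 : ∀ i j, HasDerivAt (fun t : ℝ => P.f i j (θ + t • h))
      (inner ℝ (gradient (P.f i j) θ) h) 0 := by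
    intro i j
    simpa using hasDerivAt_line (P.differentiable i j) θ h 0
  have h2 : HasDerivAt (fun t : ℝ => ‖θ + t • h‖ ^ 2) (2 * inner ℝ θ h) 0 := by
    have h3 : HasDerivAt (fun t : ℝ => θ + t • h) h 0 := by
      simpa using ((hasDerivAt_id (0 : ℝ)).smul_const h).const_add θ
    simpa using h3.norm_sq
  have h4 : ∀ i, HasDerivAt (fun t : ℝ => ∑ j, P.f i j (θ + t • h) +
      P.σ i / 2 * ‖θ + t • h‖ ^ 2)
      (∑ j, inner ℝ (gradient (P.f i j) θ) h + P.σ i / 2 * (2 * inner ℝ θ h)) 0 := fun i =>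
    (HasDerivAt.fun_sum fun j _ => h1 i j).add (h2.const_mul _)
  refine (HasDerivAt.fun_sum fun i (_ : i ∈ Finset.univ) => h4 i).congr_deriv ?_
  rw [Problem.primalGrad, sum_inner]
  refine Finset.sum_congr rfl fun i _ => ?_
  rw [inner_add_left, sum_inner, real_inner_smul_left]
  ring

theorem Problem.primal_add_le (θ θ' : Param d) :
    P.primal θ + inner ℝ (P.primalGrad θ) (θ' - θ) + (∑ i, P.σ i) / 2 * ‖θ' - θ‖ ^ 2 ≤
      P.primal θ' := by
  simp only [Problem.primal, Problem.primalGrad]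
  rw [sum_inner, Finset.sum_div, Finset.sum_mul, ← Finset.sum_add_distrib,
    ← Finset.sum_add_distrib]
  refine Finset.sum_le_sum fun i _ => ?_
  have h1 : ∑ j, P.f i j θ + ∑ j, inner ℝ (gradient (P.f i j) θ) (θ' - θ) ≤
      ∑ j, P.f i j θ' := by
    rw [← Finset.sum_add_distrib]
    exact Finset.sum_le_sum fun j _ =>
      add_inner_gradient_le (P.convex i j) (P.differentiable i j) θ θ'
  have h2 : ‖θ'‖ ^ 2 = ‖θ‖ ^ 2 + 2 * inner ℝ θ (θ' - θ) + ‖θ' - θ‖ ^ 2 := by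
    rw [← norm_add_sq_real, add_sub_cancel]
  rw [inner_add_left, sum_inner, real_inner_smul_left, h2]
  linarith

theorem Problem.primalGrad_eq_zero {θ : Param d} (h : ∀ θ', P.primal θ ≤ P.primal θ') :
    P.primalGrad θ = 0 := by
  have h1 : IsLocalMin (fun t : ℝ => P.primal (θ + t • P.primalGrad θ)) 0 :=
    Eventually.of_forall fun t => by simpa using h _
  exact inner_self_eq_zero.1 (h1.hasDerivAt_eq_zero (P.hasDerivAt_primal θ _))

/-- The quadratic lower bound `primal_add_le` gives coercivity at the origin, and uniqueness when
used at a minimizer. -/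
theorem Problem.existsUnique_primal (hn : 0 < n) :
    ∃! θ : Param d, ∀ θ', P.primal θ ≤ P.primal θ' := by
  have hS : 0 < ∑ i, P.σ i :=
    Finset.sum_pos (fun i _ => P.σ_pos i) ⟨⟨0, hn⟩, Finset.mem_univ _⟩
  have hcont : Continuous P.primal := by
    have : ∀ i j, Continuous (P.f i j) := fun i j => (P.differentiable i j).continuous
    unfold Problem.primal
    fun_prop
  have hlim : Tendsto P.primal (cocompact (Param d)) atTop := by
    set g := ‖P.primalGrad 0‖
    set S := ∑ i, P.σ i
    have h1 : Tendsto (fun r : ℝ => P.primal 0 + r * (S / 2 * r - g)) atTop atTop := by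
      refine tendsto_atTop_add_const_left _ _ (tendsto_id.atTop_mul_atTop₀ ?_)
      exact tendsto_atTop_add_const_right _ _
        (tendsto_id.const_mul_atTop (by positivity))
    refine tendsto_atTop_mono (fun θ => ?_) (h1.comp (tendsto_norm_cocompact_atTop (E := Param d)))
    have h2 := P.primal_add_le 0 θ
    have h3 := abs_real_inner_le_norm (P.primalGrad 0) θ
    have h4 := neg_abs_le (inner ℝ (P.primalGrad 0) θ)
    rw [sub_zero] at h2
    simp only [Function.comp]
    nlinarith
  obtain ⟨θ, hθ⟩ := hcont.exists_forall_le hlim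
  refine ⟨θ, hθ, fun θ' hθ' => ?_⟩
  have h1 := P.primal_add_le θ θ'
  rw [P.primalGrad_eq_zero hθ, inner_zero_left, add_zero] at h1
  have h2 := hθ' θ
  have h3 : ‖θ' - θ‖ ^ 2 = 0 := by
    refine le_antisymm ?_ (sq_nonneg _)
    by_contra! hcon
    have := mul_pos (half_pos hS) hcon
    linarith
  rwa [pow_eq_zero_iff two_ne_zero, norm_eq_zero, sub_eq_zero] at h3

end Primal

/-! ### The dual problem -/

theorem EReal_sum_ne_bot {ι : Type} (s : Finset ι) {g : ι → EReal} (h : ∀ i ∈ s, g i ≠ ⊥) :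
    ∑ i ∈ s, g i ≠ ⊥ := by
  classical
  induction s using Finset.induction_on with
  | empty => simp
  | insert a s ha ih =>
    rw [Finset.sum_insert ha]
    exact EReal.add_ne_bot_iff.2 ⟨h _ (Finset.mem_insert_self _ _),
      ih fun i hi => h i (Finset.mem_insert_of_mem hi)⟩

theorem EReal_sum_eq_top {ι : Type} [Fintype ι] {g : ι → EReal} (h : ∀ i, g i ≠ ⊥)
    {i : ι} (hi : g i = ⊤) : ∑ i, g i = ⊤ := by
  classical
  rw [← Finset.add_sum_erase _ _ (Finset.mem_univ i), hi]
  exact EReal.top_add_of_ne_bot (EReal_sum_ne_bot _ fun i _ => h i)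

theorem EReal_coe_sum {ι : Type} [Fintype ι] (g : ι → ℝ) :
    ∑ i, (g i : EReal) = ((∑ i, g i : ℝ) : EReal) := by
  classical
  induction (Finset.univ : Finset ι) using Finset.induction_on with
  | empty => simp
  | insert a s ha ih => rw [Finset.sum_insert ha, Finset.sum_insert ha, ih, EReal.coe_add]

section Dual

variable {n m d : ℕ} (P : Problem n m d) {μ : Edge P.G m → ℝ}

theorem Problem.dual_eq_top_or_coe (μ : Edge P.G m → ℝ) (lam : Edge P.G m → Param d) :
    P.dual μ lam = ⊤ ∨ ∃ r : Fin n × Fin m → ℝ,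
      (∀ ij, (rowMul (incMat μ) lam (Sum.inr ij), r ij) ∈
        conjEpi (P.f ij.1 ij.2) (P.L ij.1 ij.2)) ∧
      P.dual μ lam = ((P.qA μ lam + ∑ ij, r ij : ℝ) : EReal) := by
  have hnorm : ∀ ij : Fin n × Fin m,
      1 / (2 * P.L ij.1 ij.2) * ‖rowMul (incMat μ) lam (Sum.inr ij)‖ ^ 2 =
      μ (Sum.inr ij) ^ 2 / (2 * P.L ij.1 ij.2) * ‖lam (Sum.inr ij)‖ ^ 2 := by
    intro ij
    rw [rowMul_incMat_inr, norm_neg, norm_smul, mul_pow, Real.norm_eq_abs, sq_abs]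
    ring
  set g : Fin n × Fin m → EReal := fun ij =>
    conj (P.f ij.1 ij.2) (rowMul (incMat μ) lam (Sum.inr ij)) -
      ((1 / (2 * P.L ij.1 ij.2) * ‖rowMul (incMat μ) lam (Sum.inr ij)‖ ^ 2 : ℝ) : EReal) with hg
  have hdual : P.dual μ lam = (P.qA μ lam : EReal) + ∑ ij, g ij := by
    rw [Problem.dual, Fintype.sum_prod_type]
    simp only [hg, hnorm]
    simp only [rowMul_incMat_inr]
  by_cases htop : ∃ ij, conj (P.f ij.1 ij.2) (rowMul (incMat μ) lam (Sum.inr ij)) = ⊤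
  · left
    obtain ⟨ij, hij⟩ := htop
    have h1 : g ij = ⊤ := by
      simp only [hg, hij]
      exact EReal.top_sub_coe _
    have h2 : ∀ ij, g ij ≠ ⊥ := by
      intro ij
      simp only [hg, sub_eq_add_neg]
      rw [← EReal.coe_neg]
      exact EReal.add_ne_bot_iff.2 ⟨conj_ne_bot _ _, EReal.coe_ne_bot _⟩
    rw [hdual, EReal_sum_eq_top h2 h1, EReal.coe_add_top]
  · right
    push Not at htop
    have hex : ∀ ij : Fin n × Fin m, ∃ r : ℝ,
        conj (P.f ij.1 ij.2) (rowMul (incMat μ) lam (Sum.inr ij)) = r := fun ij =>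
      (conj_eq_top_or_coe _ _).resolve_left (htop ij)
    choose r hr using hex
    refine ⟨_, fun ij => mem_conjEpi_of_conj_eq (hr ij), ?_⟩
    rw [hdual, EReal.coe_add, ← EReal_coe_sum]
    simp only [hg, hr, EReal.coe_sub]

theorem Problem.dual_le_of_mem (lam : Edge P.G m → Param d) {r : Fin n × Fin m → ℝ}
    (hr : ∀ ij, (rowMul (incMat μ) lam (Sum.inr ij), r ij) ∈
      conjEpi (P.f ij.1 ij.2) (P.L ij.1 ij.2)) :
    P.dual μ lam ≤ ((P.qA μ lam + ∑ ij, r ij : ℝ) : EReal) := by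
  rw [Problem.dual, EReal.coe_add, ← EReal_coe_sum, Fintype.sum_prod_type]
  refine add_le_add le_rfl (Finset.sum_le_sum fun i _ => Finset.sum_le_sum fun j _ => ?_)
  refine EReal.sub_le_of_le_add ?_
  rw [← EReal.coe_add]
  have h1 := conj_le_of_mem_conjEpi (hr (i, j))
  rw [rowMul_incMat_inr, norm_neg, norm_smul, mul_pow, Real.norm_eq_abs, sq_abs] at h1
  refine h1.trans (EReal.coe_le_coe_iff.2 (le_of_eq ?_))
  ring

/-- Weak duality, with the duality gap of the center nodes. -/
theorem Problem.weak_duality (lam : Edge P.G m → Param d) (θ : Param d) :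
    P.qA μ lam + ∑ ij : Fin n × Fin m, (inner ℝ (rowMul (incMat μ) lam (Sum.inr ij)) θ -
      P.f ij.1 ij.2 θ -
      1 / (2 * P.L ij.1 ij.2) * ‖rowMul (incMat μ) lam (Sum.inr ij)‖ ^ 2) =
    -P.primal θ + ∑ i, (P.σ i)⁻¹ / 2 *
      ‖rowMul (incMat μ) lam (Sum.inl i) - P.σ i • θ‖ ^ 2 := by
  -- The only input about `A`: the coordinates of `A λ` sum to zero, so the pairings with a common
  -- `θ` cancel. The rest is completion of squares.
  have h0 : ∑ k, inner ℝ (rowMul (incMat μ) lam k) θ = 0 := by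
    rw [← sum_inner, sum_rowMul_incMat, inner_zero_left]
  set x := rowMul (incMat μ) lam with hx
  rw [Fintype.sum_sum_type] at h0
  have h1 : ∀ i, (P.σ i)⁻¹ / 2 * ‖x (Sum.inl i) - P.σ i • θ‖ ^ 2 =
      1 / 2 * ((P.σ i)⁻¹ * ‖x (Sum.inl i)‖ ^ 2) - inner ℝ (x (Sum.inl i)) θ +
        P.σ i / 2 * ‖θ‖ ^ 2 := by
    intro i
    have := (P.σ_pos i).ne'
    rw [norm_sub_sq_real, real_inner_smul_right, norm_smul, mul_pow, Real.norm_eq_abs, sq_abs]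
    field_simp
  have h2 : P.primal θ = ∑ ij : Fin n × Fin m, P.f ij.1 ij.2 θ +
      ∑ i, P.σ i / 2 * ‖θ‖ ^ 2 := by
    rw [Problem.primal, Finset.sum_add_distrib, Fintype.sum_prod_type]
  have h3 : P.qA μ lam = ∑ i, 1 / 2 * ((P.σ i)⁻¹ * ‖x (Sum.inl i)‖ ^ 2) +
      ∑ ij : Fin n × Fin m, 1 / (2 * P.L ij.1 ij.2) * ‖x (Sum.inr ij)‖ ^ 2 := by
    rw [Problem.qA, Fintype.sum_sum_type, mul_add, Finset.mul_sum, Finset.mul_sum]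
    congr 1
    refine Finset.sum_congr rfl fun ij _ => ?_
    have := (P.L_pos ij.1 ij.2).ne'
    simp only [Problem.diag]
    field_simp
    rfl
  simp only [h1, Finset.sum_add_distrib, Finset.sum_sub_distrib]
  rw [h2, h3]
  linarith

theorem Problem.neg_primal_le (lam : Edge P.G m → Param d) (θ : Param d)
    {r : Fin n × Fin m → ℝ}
    (hr : ∀ ij, (rowMul (incMat μ) lam (Sum.inr ij), r ij) ∈
      conjEpi (P.f ij.1 ij.2) (P.L ij.1 ij.2)) :
    -P.primal θ + ∑ i, (P.σ i)⁻¹ / 2 * ‖rowMul (incMat μ) lam (Sum.inl i) - P.σ i • θ‖ ^ 2 ≤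
      P.qA μ lam + ∑ ij, r ij := by
  rw [← P.weak_duality]
  exact add_le_add le_rfl (Finset.sum_le_sum fun ij _ => hr ij θ)

theorem Problem.neg_primal_le' (lam : Edge P.G m → Param d) (θ : Param d)
    {r : Fin n × Fin m → ℝ}
    (hr : ∀ ij, (rowMul (incMat μ) lam (Sum.inr ij), r ij) ∈
      conjEpi (P.f ij.1 ij.2) (P.L ij.1 ij.2)) :
    -P.primal θ ≤ P.qA μ lam + ∑ ij, r ij := by
  refine le_trans ?_ (P.neg_primal_le lam θ hr)
  rw [le_add_iff_nonneg_right]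
  exact Finset.sum_nonneg fun i _ =>
    mul_nonneg (half_pos (inv_pos.2 (P.σ_pos i))).le (sq_nonneg _)

/-- Stationarity says that the column with entries `σ i • θ` and `∇ f i j θ` has sum zero, hence
equals `A λ`; for this `λ` every inequality of weak duality is an equality. -/
theorem Problem.exists_dual_le (hμ : ∀ e, 0 < μ e) {θ : Param d}
    (hθ : ∀ θ', P.primal θ ≤ P.primal θ') :
    ∃ lam : Edge P.G m → Param d, P.dual μ lam ≤ ((-P.primal θ : ℝ) : EReal) := by
  have h0 := P.primalGrad_eq_zero hθ
  obtain ⟨lam, hlam⟩ := exists_rowMul_incMat_eq P.connected hμ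
    (Sum.elim (fun i => P.σ i • θ) (fun ij => gradient (P.f ij.1 ij.2) θ)) (by
      rw [Fintype.sum_sum_type, Fintype.sum_prod_type, ← h0, Problem.primalGrad,
        Finset.sum_add_distrib, add_comm]
      rfl)
  refine ⟨lam, ?_⟩
  have hmem : ∀ ij : Fin n × Fin m, (rowMul (incMat μ) lam (Sum.inr ij), inner ℝ
      (rowMul (incMat μ) lam (Sum.inr ij)) θ - P.f ij.1 ij.2 θ -
      1 / (2 * P.L ij.1 ij.2) * ‖rowMul (incMat μ) lam (Sum.inr ij)‖ ^ 2) ∈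
      conjEpi (P.f ij.1 ij.2) (P.L ij.1 ij.2) := by
    intro ij
    rw [hlam]
    exact gradient_mem_conjEpi (P.convex _ _) (P.differentiable _ _) θ
  refine (P.dual_le_of_mem lam hmem).trans (EReal.coe_le_coe_iff.2 ?_)
  rw [P.weak_duality, hlam]
  simp

theorem Problem.neg_primal_le_dual (lam : Edge P.G m → Param d) (θ : Param d) :
    ((-P.primal θ : ℝ) : EReal) ≤ P.dual μ lam := by
  rcases P.dual_eq_top_or_coe μ lam with h | ⟨r, hr, h⟩
  · rw [h]
    exact le_top
  · rw [h]
    exact EReal.coe_le_coe_iff.2 (P.neg_primal_le' lam θ hr)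

/-- Strong duality, and the optimality conditions at the center nodes. -/
theorem Problem.dual_minimizer (hμ : ∀ e, 0 < μ e) {θ : Param d}
    (hθ : ∀ θ', P.primal θ ≤ P.primal θ') {lams : Edge P.G m → Param d}
    (hlams : ∀ lam, P.dual μ lams ≤ P.dual μ lam) :
    (∀ i, P.primalPoint μ lams (Sum.inl i) = θ) ∧
      P.dual μ lams = ((-P.primal θ : ℝ) : EReal) ∧
      ∃ r : Fin n × Fin m → ℝ,
        (∀ ij, (rowMul (incMat μ) lams (Sum.inr ij), r ij) ∈
          conjEpi (P.f ij.1 ij.2) (P.L ij.1 ij.2)) ∧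
        P.qA μ lams + ∑ ij, r ij = -P.primal θ := by
  obtain ⟨lam, hlam⟩ := P.exists_dual_le hμ hθ
  have hle := (hlams lam).trans hlam
  have heq : P.dual μ lams = ((-P.primal θ : ℝ) : EReal) :=
    le_antisymm hle (P.neg_primal_le_dual lams θ)
  rcases P.dual_eq_top_or_coe μ lams with h | ⟨r, hr, h⟩
  · rw [h, eq_comm] at heq
    exact absurd heq (EReal.coe_ne_top _)
  · have hval : P.qA μ lams + ∑ ij, r ij = -P.primal θ := by
      rw [h] at heq
      exact EReal.coe_eq_coe_iff.1 heq
    refine ⟨fun i => ?_, heq, r, hr, hval⟩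
    -- With a vanishing duality gap, the squares at the center nodes must all be zero.
    have h1 := P.neg_primal_le lams θ hr
    have hnn : ∀ i ∈ Finset.univ, 0 ≤ (P.σ i)⁻¹ / 2 *
        ‖rowMul (incMat μ) lams (Sum.inl i) - P.σ i • θ‖ ^ 2 := fun i _ =>
      mul_nonneg (half_pos (inv_pos.2 (P.σ_pos i))).le (sq_nonneg _)
    have h2 : ∑ i, (P.σ i)⁻¹ / 2 *
        ‖rowMul (incMat μ) lams (Sum.inl i) - P.σ i • θ‖ ^ 2 = 0 :=
      le_antisymm (by linarith) (Finset.sum_nonneg hnn)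
    have h3 := (Finset.sum_eq_zero_iff_of_nonneg hnn).1 h2 i (Finset.mem_univ i)
    rw [mul_eq_zero, pow_eq_zero_iff two_ne_zero, norm_eq_zero, sub_eq_zero] at h3
    rw [Problem.primalPoint, h3.resolve_left (half_pos (inv_pos.2 (P.σ_pos i))).ne',
      Problem.diag, smul_smul, inv_mul_cancel₀ (P.σ_pos i).ne', one_smul]

end Dual

/-! ### Coupled averages -/

section Mix

variable {E : Type} [AddCommGroup E] [Module ℝ E]

/-- The query point `y = (x + ρ v) / (1 + ρ)`. -/
def mixY (ρ : ℝ) (x v : E) : E := (1 / (1 + ρ)) • (x + ρ • v)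

/-- The point `(1 - ρ) v + ρ y`. -/
def mixW (ρ : ℝ) (x v : E) : E := (1 - ρ) • v + ρ • mixY ρ x v

theorem map_mixY {F : Type} [AddCommGroup F] [Module ℝ F] (f : E →ₗ[ℝ] F) (ρ : ℝ) (x v : E) :
    f (mixY ρ x v) = mixY ρ (f x) (f v) := by
  simp [mixY]

theorem map_mixW {F : Type} [AddCommGroup F] [Module ℝ F] (f : E →ₗ[ℝ] F) (ρ : ℝ) (x v : E) :
    f (mixW ρ x v) = mixW ρ (f x) (f v) := by
  simp [mixW, map_mixY]

theorem eq_smul_mixY_sub {ρ : ℝ} (hρ : 0 < ρ) (x v : E) :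
    x = (1 + ρ) • mixY ρ x v - ρ • v := by
  rw [mixY, smul_smul, mul_one_div_cancel (by linarith), one_smul, add_sub_cancel_right]

/-- `v` lies in `S` and `x` is an average of `v`, with weight `c`, and of a point of `S`. -/
def IsMix (S : Set E) (c : ℝ) (x v : E) : Prop :=
  v ∈ S ∧ ∃ u ∈ S, x = c • v + (1 - c) • u

variable {S : Set E} {c ρ : ℝ} {x v : E}

theorem IsMix.mem (hS : Convex ℝ S) (hc0 : 0 ≤ c) (hc1 : c ≤ 1) (h : IsMix S c x v) : x ∈ S := by
  obtain ⟨hv, u, hu, rfl⟩ := h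
  exact hS hv hu hc0 (sub_nonneg.2 hc1) (by ring)

/-- The averaging preserves the relation with the same weight `c`; this covers the virtual nodes
that are not sampled. -/
theorem IsMix.mix (hS : Convex ℝ S) (hρ0 : 0 < ρ) (hρ1 : ρ ≤ 1) (hc0 : 0 ≤ c) (hc1 : c ≤ 1)
    (h : IsMix S c x v) : IsMix S c (mixY ρ x v) (mixW ρ x v) := by
  have hx := h.mem hS hc0 hc1
  obtain ⟨hv, u, hu, hxu⟩ := h
  have h1 : 0 < 1 + ρ := by linarith
  have h2 : 0 < 1 + ρ * c := by positivity
  have hw : mixW ρ x v = (1 / (1 + ρ)) • v + (ρ / (1 + ρ)) • x := by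
    rw [mixW, mixY]
    match_scalars <;> field_simp
    ring
  have hwS : mixW ρ x v ∈ S := by
    rw [hw]
    exact hS hv hx (by positivity) (by positivity) (by field_simp)
  -- The new auxiliary point solves `y = c w + (1 - c) u'` after eliminating `v` in favor of `w` and
  -- `u`.
  refine ⟨hwS, (ρ * (1 + c) / (1 + ρ * c)) • mixW ρ x v + ((1 - ρ) / (1 + ρ * c)) • u,
    hS hwS hu (by positivity) (div_nonneg (by linarith) h2.le) (by field_simp; ring), ?_⟩
  rw [hw, mixY, hxu]
  match_scalars <;> field_simp <;> ring

/-- On a sampled virtual edge the algorithm moves `x` by `c = ρ / p_ij` times the change of `v`, so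
only the `v` part of the average is replaced. -/
theorem IsMix.replace {v' : E} (hv' : v' ∈ S) (h : IsMix S c x v) :
    IsMix S c (x + c • (v' - v)) v' := by
  obtain ⟨-, u, hu, rfl⟩ := h
  exact ⟨hv', u, hu, by module⟩

end Mix

/-! ### One-edge descent inequalities -/

section InnerIneq

variable {H : Type} [NormedAddCommGroup H] [InnerProductSpace ℝ H]

/-- After substituting `δ`, the terms in `‖g‖²` collect into a nonnegative multiple of `ρ² M R - σ
p²`, which the definition of the rate makes nonpositive. -/
theorem coordinate_descent_le {p ρ σ M R : ℝ} (hp : 0 < p) (hσ : 0 < σ) (hR : 0 < R)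
    (hρ : ρ ^ 2 * (M * R) ≤ σ * p ^ 2) {g u δ : H} (hδ : δ = -((ρ / (σ * p)) • g)) :
    p * (2 * inner ℝ δ u + R * ‖δ‖ ^ 2 + 2 / σ * ((ρ * R / p) * inner ℝ g δ +
      (ρ * R / p) ^ 2 / 2 * (M * ‖δ‖ ^ 2))) ≤ -(2 * ρ / σ) * inner ℝ g u := by
  have h1 : inner ℝ δ u = -(ρ / (σ * p)) * inner ℝ g u := by
    rw [hδ, inner_neg_left, real_inner_smul_left]
    ring
  have h2 : inner ℝ g δ = -(ρ / (σ * p)) * ‖g‖ ^ 2 := by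
    rw [hδ, inner_neg_right, real_inner_smul_right, real_inner_self_eq_norm_sq]
    ring
  have h3 : ‖δ‖ ^ 2 = (ρ / (σ * p)) ^ 2 * ‖g‖ ^ 2 := by
    rw [hδ, norm_neg, norm_smul, mul_pow, Real.norm_eq_abs, sq_abs]
  rw [h1, h2, h3]
  have h4 : p * (2 * (-(ρ / (σ * p)) * inner ℝ g u) + R * ((ρ / (σ * p)) ^ 2 * ‖g‖ ^ 2) +
      2 / σ * ((ρ * R / p) * (-(ρ / (σ * p)) * ‖g‖ ^ 2) +
      (ρ * R / p) ^ 2 / 2 * (M * ((ρ / (σ * p)) ^ 2 * ‖g‖ ^ 2)))) =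
      -(2 * ρ / σ) * inner ℝ g u +
      (ρ ^ 2 * (M * R) - σ * p ^ 2) * (ρ ^ 2 * R / (σ ^ 3 * p ^ 3) * ‖g‖ ^ 2) := by
    field_simp
    ring
  rw [h4, add_le_iff_nonpos_right]
  exact mul_nonpos_of_nonpos_of_nonneg (by linarith) (by positivity)

/-- Here `R = 1` and `s` plays the role of a subgradient of the non-smooth part at the new point.
Eliminating `g` leaves a multiple of `ρ² M - σ p²` and the subgradient inequality. -/
theorem proximal_descent_le {p ρ σ M Ψ : ℝ} (hp : 0 < p) (hρ0 : 0 < ρ) (hσ : 0 < σ)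
    (hρ : ρ ^ 2 * M ≤ σ * p ^ 2) {g s u δ : H} (hδ : δ = -((ρ / (σ * p)) • (g + s)))
    (hs : Ψ ≤ inner ℝ s (u + δ)) :
    p * (2 * inner ℝ δ u + ‖δ‖ ^ 2 + 2 / σ * ((ρ / p) * inner ℝ g δ +
      (ρ / p) ^ 2 / 2 * (M * ‖δ‖ ^ 2))) ≤ -(2 * ρ / σ) * (inner ℝ g u + Ψ) := by
  have h1 : g = -((σ * p / ρ) • δ) - s := by
    rw [hδ, smul_neg, neg_neg, smul_smul]
    have : σ * p / ρ * (ρ / (σ * p)) = 1 := by field_simp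
    rw [this, one_smul, add_sub_cancel_right]
  have h2 : inner ℝ g u = -(σ * p / ρ) * inner ℝ δ u - inner ℝ s u := by
    rw [h1, inner_sub_left, inner_neg_left, real_inner_smul_left]
    ring
  have h3 : inner ℝ g δ = -(σ * p / ρ) * ‖δ‖ ^ 2 - inner ℝ s δ := by
    rw [h1, inner_sub_left, inner_neg_left, real_inner_smul_left, real_inner_self_eq_norm_sq]
    ring
  rw [inner_add_right] at hs
  rw [h2, h3]
  have h4 : p * (2 * inner ℝ δ u + ‖δ‖ ^ 2 + 2 / σ * ((ρ / p) *
      (-(σ * p / ρ) * ‖δ‖ ^ 2 - inner ℝ s δ) + (ρ / p) ^ 2 / 2 * (M * ‖δ‖ ^ 2))) =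
      2 * p * inner ℝ δ u - 2 * ρ / σ * inner ℝ s δ +
      (ρ ^ 2 * M - σ * p ^ 2) * (‖δ‖ ^ 2 / (σ * p)) := by
    field_simp
    ring
  have h5 : -(2 * ρ / σ) * (-(σ * p / ρ) * inner ℝ δ u - inner ℝ s u + Ψ) =
      2 * p * inner ℝ δ u + 2 * ρ / σ * inner ℝ s u - 2 * ρ / σ * Ψ := by
    field_simp
    ring
  rw [h4, h5]
  have h6 : (ρ ^ 2 * M - σ * p ^ 2) * (‖δ‖ ^ 2 / (σ * p)) ≤ 0 :=
    mul_nonpos_of_nonpos_of_nonneg (by linarith) (by positivity)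
  have h7 := mul_le_mul_of_nonneg_left hs (by positivity : 0 ≤ 2 * ρ / σ)
  rw [mul_add] at h7
  linarith

end InnerIneq

/-! ### The quadratic part of the dual function -/

section Quadratic

variable {n m d : ℕ} (P : Problem n m d) (μ : Edge P.G m → ℝ)

/-- The gradient of `q_A`. -/
def Problem.edgeGrad (y : Edge P.G m → Param d) (e : Edge P.G m) : Param d :=
  μ e • ((P.diag (src e))⁻¹ • rowMul (incMat μ) y (src e) -
    (P.diag (dst e))⁻¹ • rowMul (incMat μ) y (dst e))

/-- The bilinear form of `q_A`. -/
def Problem.hessInner (y h : Edge P.G m → Param d) : ℝ :=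
  ∑ k, (P.diag k)⁻¹ * inner ℝ (rowMul (incMat μ) y k) (rowMul (incMat μ) h k)

theorem Problem.colInner_edgeGrad (y h : Edge P.G m → Param d) :
    colInner (P.edgeGrad μ y) h = P.hessInner μ y h := by
  have h1 : P.edgeGrad μ y = rowMul (incMat μ).transpose
      (fun k => (P.diag k)⁻¹ • rowMul (incMat μ) y k) := by
    ext1 e
    rw [rowMul_incMat_transpose, Problem.edgeGrad]
  rw [h1, colInner_comm, ← colInner_rowMul, colInner_comm, colInner, Problem.hessInner]
  simp only [real_inner_smul_left]

theorem Problem.hessInner_add_right (y h h' : Edge P.G m → Param d) :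
    P.hessInner μ y (h + h') = P.hessInner μ y h + P.hessInner μ y h' := by
  simp only [← P.colInner_edgeGrad, colInner_add_right]

theorem Problem.hessInner_smul_right (a : ℝ) (y h : Edge P.G m → Param d) :
    P.hessInner μ y (a • h) = a * P.hessInner μ y h := by
  simp only [← P.colInner_edgeGrad, colInner_smul_right]

theorem Problem.hessInner_sub_right (y h h' : Edge P.G m → Param d) :
    P.hessInner μ y (h - h') = P.hessInner μ y h - P.hessInner μ y h' := by
  rw [sub_eq_add_neg, ← neg_one_smul ℝ, P.hessInner_add_right, P.hessInner_smul_right]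
  ring

theorem Problem.hessInner_self (y : Edge P.G m → Param d) :
    P.hessInner μ y y = 2 * P.qA μ y := by
  simp only [Problem.hessInner, Problem.qA, real_inner_self_eq_norm_sq]
  ring

theorem Problem.hessInner_comm (y h : Edge P.G m → Param d) :
    P.hessInner μ y h = P.hessInner μ h y := by
  simp only [Problem.hessInner, real_inner_comm]

theorem Problem.hessInner_pinvMul (y h : Edge P.G m → Param d) :
    P.hessInner μ y (rowMul (pinvMul (incMat μ)) h) = P.hessInner μ y h := by
  simp only [Problem.hessInner, rowMul_rowMul, mul_pinvMul]

theorem Problem.qA_add (y h : Edge P.G m → Param d) :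
    P.qA μ (y + h) = P.qA μ y + P.hessInner μ y h + P.qA μ h := by
  have h1 := P.hessInner_self μ (y + h)
  rw [P.hessInner_add_right, P.hessInner_comm μ (y + h), P.hessInner_comm μ (y + h),
    P.hessInner_add_right, P.hessInner_add_right, P.hessInner_self, P.hessInner_self,
    P.hessInner_comm μ h y] at h1
  linarith

theorem Problem.qA_nonneg (y : Edge P.G m → Param d) : 0 ≤ P.qA μ y :=
  mul_nonneg (by norm_num) (Finset.sum_nonneg fun k _ =>
    mul_nonneg (inv_pos.2 (P.diag_pos k)).le (sq_nonneg _))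

theorem Problem.qA_single (e : Edge P.G m) (δ : Param d) :
    P.qA μ (Pi.single e δ) = 1 / 2 * (P.edgeHess μ e * ‖δ‖ ^ 2) := by
  rw [Problem.qA, Problem.edgeHess, ← incMat_sq_sum μ (fun k => (P.diag k)⁻¹) e, Finset.sum_mul]
  congr 1
  refine Finset.sum_congr rfl fun k _ => ?_
  rw [rowMul_single, norm_smul, mul_pow, Real.norm_eq_abs, sq_abs]
  ring

theorem Problem.qA_add_single (y : Edge P.G m → Param d) (e : Edge P.G m) (c : ℝ) (δ : Param d) :
    P.qA μ (y + c • (Pi.single e δ : Edge P.G m → Param d)) = P.qA μ y + (c * inner ℝ (P.edgeGrad μ y e) δ +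
      c ^ 2 / 2 * (P.edgeHess μ e * ‖δ‖ ^ 2)) := by
  have h1 : c • (Pi.single e δ : Edge P.G m → Param d) = Pi.single e (c • δ) := by
    rw [Pi.single_smul]
  rw [P.qA_add, P.hessInner_smul_right, ← P.colInner_edgeGrad, colInner_comm, colInner_single,
    real_inner_comm, h1, P.qA_single, norm_smul, mul_pow, Real.norm_eq_abs, sq_abs]
  ring

theorem Problem.sqNorm_pinvMul_add_single (z : Edge P.G m → Param d) (e : Edge P.G m)
    (δ : Param d) :
    sqNorm (rowMul (pinvMul (incMat μ)) (z + Pi.single e δ)) =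
      sqNorm (rowMul (pinvMul (incMat μ)) z) +
        (2 * inner ℝ δ (rowMul (pinvMul (incMat μ)) z e) + P.res μ e * ‖δ‖ ^ 2) := by
  have hadj : ∀ y y' : Edge P.G m → Param d,
      colInner (rowMul (pinvMul (incMat μ)) y) (rowMul (pinvMul (incMat μ)) y') =
      colInner y (rowMul (pinvMul (incMat μ)) y') := by
    intro y y'
    rw [colInner_rowMul, pinvMul_transpose, rowMul_rowMul, pinvMul_mul_pinvMul]
  simp only [← colInner_self, rowMul_add, colInner_add_left, colInner_add_right]
  rw [colInner_comm (rowMul _ z) (rowMul _ (Pi.single e δ)), hadj (Pi.single e δ),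
    hadj (Pi.single e δ), colInner_single, colInner_single, rowMul_single,
    real_inner_smul_right, real_inner_self_eq_norm_sq]
  change _ = _ + (_ + pinvMul (incMat μ) e e * _)
  ring

theorem sqNorm_mix_le {ι : Type} [Fintype ι] {ρ : ℝ} (h0 : 0 ≤ ρ) (h1 : ρ ≤ 1)
    (a b : ι → Param d) :
    sqNorm ((1 - ρ) • a + ρ • b) ≤ (1 - ρ) * sqNorm a + ρ * sqNorm b := by
  simp only [sqNorm, Finset.mul_sum]
  rw [← Finset.sum_add_distrib]
  refine Finset.sum_le_sum fun k _ => ?_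
  have hc : ConvexOn ℝ Set.univ fun x : Param d => ‖x‖ ^ 2 :=
    (convexOn_norm convex_univ).pow (fun _ _ => norm_nonneg _) 2
  exact hc.2 (Set.mem_univ (a k)) (Set.mem_univ (b k)) (sub_nonneg.2 h1) h0 (by ring)

/-- Convexity of the squared norm splits `w - lam` into `v - lam` and `y - lam`; strong convexity of
`q_A` pays for the second part, and the tangent of `q_A` at `y` bounds `q_A x` from below. With `x =
(1 + ρ) y - ρ v` the rest is linear. -/
theorem Problem.momentum_le {μ : Edge P.G m → ℝ} (hσ : 0 < P.sigA μ) {ρ : ℝ} (hρ0 : 0 < ρ)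
    (hρ1 : ρ ≤ 1) (x v lam : Edge P.G m → Param d) :
    sqNorm (rowMul (pinvMul (incMat μ)) (mixW ρ x v - lam)) +
      2 / P.sigA μ * (P.qA μ (mixY ρ x v) -
        ρ * P.hessInner μ (mixY ρ x v) (mixW ρ x v - lam) - ρ * P.qA μ lam) ≤
      (1 - ρ) * (sqNorm (rowMul (pinvMul (incMat μ)) (v - lam)) +
        2 / P.sigA μ * P.qA μ x) := by
  set y := mixY ρ x v with hy
  have hw : mixW ρ x v = (1 - ρ) • v + ρ • y := rfl
  have hx : x = (1 + ρ) • y - ρ • v := eq_smul_mixY_sub hρ0 x v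
  have h1 : sqNorm (rowMul (pinvMul (incMat μ)) (mixW ρ x v - lam)) ≤
      (1 - ρ) * sqNorm (rowMul (pinvMul (incMat μ)) (v - lam)) +
      ρ * sqNorm (rowMul (pinvMul (incMat μ)) (y - lam)) := by
    have e1 : mixW ρ x v - lam = (1 - ρ) • (v - lam) + ρ • (y - lam) := by
      rw [hw]
      module
    rw [e1, rowMul_add, rowMul_smul, rowMul_smul]
    exact sqNorm_mix_le hρ0.le hρ1 _ _
  have h2 := P.sigA_mul_le μ (y - lam)
  have h3 : P.qA μ (y - lam) = P.qA μ y - P.hessInner μ y lam + P.qA μ lam := by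
    have := P.qA_add μ y ((-1 : ℝ) • lam)
    rw [P.hessInner_smul_right] at this
    have e1 : P.qA μ ((-1 : ℝ) • lam) = P.qA μ lam := by
      simp only [Problem.qA, rowMul_smul, Pi.smul_apply, norm_smul, norm_neg, norm_one, one_mul]
    rw [e1] at this
    rw [sub_eq_add_neg, ← neg_one_smul ℝ, this]
    ring
  have h4 : P.hessInner μ y x - P.qA μ y ≤ P.qA μ x := by
    have := P.qA_add μ y (x - y)
    rw [add_sub_cancel, P.hessInner_sub_right, P.hessInner_self] at this
    linarith [P.qA_nonneg μ (x - y)]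
  have h5 : P.hessInner μ y x = (1 + ρ) * (2 * P.qA μ y) - ρ * P.hessInner μ y v := by
    conv_lhs => rw [hx]
    rw [P.hessInner_sub_right, P.hessInner_smul_right, P.hessInner_smul_right, P.hessInner_self]
  have h6 : P.hessInner μ y (mixW ρ x v - lam) =
      (1 - ρ) * P.hessInner μ y v + ρ * (2 * P.qA μ y) - P.hessInner μ y lam := by
    rw [P.hessInner_sub_right, hw, P.hessInner_add_right, P.hessInner_smul_right,
      P.hessInner_smul_right, P.hessInner_self]
  rw [h5] at h4
  rw [h3] at h2
  rw [h6]
  set N := sqNorm (rowMul (pinvMul (incMat μ)) (y - lam))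
  have h7 : N ≤ 2 / P.sigA μ * (P.qA μ y - P.hessInner μ y lam + P.qA μ lam) := by
    rw [div_mul_eq_mul_div, le_div_iff₀ hσ]
    linarith
  have h8 := mul_le_mul_of_nonneg_left h7 hρ0.le
  have h9 := mul_le_mul_of_nonneg_left h4
    (mul_nonneg (sub_nonneg.2 hρ1) (div_pos two_pos hσ).le)
  linarith

end Quadratic

/-! ### The algorithm in edge variables -/

section Lift

variable {n m d : ℕ} (P : Problem n m d) (μ p : Edge P.G m → ℝ) (ρ : ℝ)

/-- The state of the algorithm in edge variables, with upper bounds of the values of the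
non-smooth part of the dual function at `x` and `v`. -/
abbrev LiftState (P : Problem n m d) : Type :=
  ((Edge P.G m → Param d) × (Edge P.G m → Param d)) ×
    ((Fin n × Fin m → ℝ) × (Fin n × Fin m → ℝ))

/-- The new value of the node variable `(i, j)`. -/
def Problem.proxPoint (x v : Edge P.G m → Param d) (ij : Fin n × Fin m) : Param d :=
  prox (P.stepSize μ p ρ (Sum.inr ij)) (P.fTilde ij)
    (rowMul (incMat μ) (mixW ρ x v) (Sum.inr ij) +
      (ρ * μ (Sum.inr ij) / (P.sigA μ * p (Sum.inr ij))) •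
        P.edgeGrad μ (mixY ρ x v) (Sum.inr ij))

/-- The change of the edge variable along the sampled edge. -/
def Problem.edgeStep (x v : Edge P.G m → Param d) : Edge P.G m → Param d
  | Sum.inl e => -((ρ / (P.sigA μ * p (Sum.inl e))) • P.edgeGrad μ (mixY ρ x v) (Sum.inl e))
  | Sum.inr ij => (μ (Sum.inr ij))⁻¹ •
      (rowMul (incMat μ) (mixW ρ x v) (Sum.inr ij) - P.proxPoint μ p ρ x v ij)

/-- The change of the upper bounds. -/
def Problem.boundStep (x v : Edge P.G m → Param d) (X V : Fin n × Fin m → ℝ) :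
    Edge P.G m → Fin n × Fin m → ℝ
  | Sum.inl _ => 0
  | Sum.inr ij => Pi.single ij
      ((P.fTilde ij (P.proxPoint μ p ρ x v ij)).toReal - mixW ρ X V ij)

/-- One iteration in edge variables. -/
def Problem.liftStep (s : LiftState P) (e : Edge P.G m) : LiftState P :=
  let h : Edge P.G m → Param d := Pi.single e (P.edgeStep μ p ρ s.1.1 s.1.2 e)
  ((mixY ρ s.1.1 s.1.2 + (ρ * P.res μ e / p e) • h, mixW ρ s.1.1 s.1.2 + h),
   (mixY ρ s.2.1 s.2.2 + (ρ / p e) • P.boundStep μ p ρ s.1.1 s.1.2 s.2.1 s.2.2 e,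
    mixW ρ s.2.1 s.2.2 + P.boundStep μ p ρ s.1.1 s.1.2 s.2.1 s.2.2 e))

/-- The algorithm in edge variables. -/
def Problem.liftRun (r : Fin n × Fin m → ℝ) : (t : ℕ) → (Fin t → Edge P.G m) → LiftState P
  | 0, _ => ((0, 0), (r, r))
  | t + 1, s => P.liftStep μ p ρ (Problem.liftRun r t (Fin.init s)) (s (Fin.last t))

/-- Multiplication by a matrix, as a linear map. -/
def rowMulLin {κ ι : Type} [Fintype ι] (M : Matrix κ ι ℝ) :
    (ι → Param d) →ₗ[ℝ] (κ → Param d) where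
  toFun := rowMul M
  map_add' := rowMul_add M
  map_smul' := rowMul_smul M

theorem rowMul_mixY {κ ι : Type} [Fintype ι] (M : Matrix κ ι ℝ) (x v : ι → Param d) :
    rowMul M (mixY ρ x v) = mixY ρ (rowMul M x) (rowMul M v) :=
  map_mixY (rowMulLin M) ρ x v

theorem rowMul_mixW {κ ι : Type} [Fintype ι] (M : Matrix κ ι ℝ) (x v : ι → Param d) :
    rowMul M (mixW ρ x v) = mixW ρ (rowMul M x) (rowMul M v) :=
  map_mixW (rowMulLin M) ρ x v

theorem rowMul_wMat {G : SimpleGraph (Fin n)} (e : Edge G m) (x : Node n m → Param d)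
    (k : Node n m) : rowMul (wMat e) x k = edgeVec e k • (x (src e) - x (dst e)) := by
  rw [← sum_edgeVec_smul, Finset.smul_sum]
  simp only [rowMul, wMat, Matrix.vecMulVec_apply, smul_smul]

theorem stepSize_smul_rowMul_wMat (x v : Edge P.G m → Param d) (e : Edge P.G m)
    (k : Node n m) :
    (P.stepSize μ p ρ e • rowMul (wMat e)
      (fun k => (P.diag k)⁻¹ • mixY ρ (rowMul (incMat μ) x) (rowMul (incMat μ) v) k)) k =
    edgeVec e k • (ρ * μ e / (P.sigA μ * p e)) • P.edgeGrad μ (mixY ρ x v) e := by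
  rw [Pi.smul_apply, rowMul_wMat, Problem.edgeGrad, rowMul_mixY, Problem.stepSize, smul_comm,
    smul_smul (_ / _)]
  congr 2
  ring

theorem edgeVec_inr_self {G : SimpleGraph (Fin n)} (ij : Fin n × Fin m) :
    edgeVec (Sum.inr ij : Edge G m) (Sum.inr ij) = -1 := by
  simp [edgeVec, src, dst]

theorem edgeVec_inr_root {G : SimpleGraph (Fin n)} (ij : Fin n × Fin m) :
    edgeVec (Sum.inr ij : Edge G m) (Sum.inl ij.1) = 1 := by
  simp [edgeVec, src, dst]

theorem edgeVec_inr_of_ne {G : SimpleGraph (Fin n)} (ij : Fin n × Fin m) {k : Node n m}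
    (h1 : k ≠ Sum.inl ij.1) (h2 : k ≠ Sum.inr ij) :
    edgeVec (Sum.inr ij : Edge G m) k = 0 := by
  simp [edgeVec, src, dst, h1, h2]

/-- The gradient step is a multiple of `e^(k) - e^(l)`, and the correction at `i` compensates the
proximal change at `(i, j)`; so `v' - w` is `A` applied to a vector supported on the sampled edge.
-/
theorem Problem.step_lift (hμ : ∀ e, 0 < μ e) (s : LiftState P) (e : Edge P.G m) :
    P.step μ p ρ (rowMul (incMat μ) s.1.1, rowMul (incMat μ) s.1.2) e =
      (rowMul (incMat μ) (P.liftStep μ p ρ s e).1.1,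
        rowMul (incMat μ) (P.liftStep μ p ρ s e).1.2) := by
  obtain ⟨⟨x, v⟩, X, V⟩ := s
  set y := mixY ρ (rowMul (incMat μ) x) (rowMul (incMat μ) v) with hy
  set w := mixW ρ (rowMul (incMat μ) x) (rowMul (incMat μ) v) with hw
  set z : Node n m → Param d :=
    w - P.stepSize μ p ρ e • rowMul (wMat e) (fun k => (P.diag k)⁻¹ • y k) with hz
  have hzk : ∀ k, z k = w k - edgeVec e k • (ρ * μ e / (P.sigA μ * p e)) •
      P.edgeGrad μ (mixY ρ x v) e := by
    intro k
    rw [hz, Pi.sub_apply, stepSize_smul_rowMul_wMat]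
  have hsingle : ∀ k, rowMul (incMat μ) (Pi.single e (P.edgeStep μ p ρ x v e)) k =
      edgeVec e k • μ e • P.edgeStep μ p ρ x v e := by
    intro k
    rw [rowMul_single, incMat, Matrix.of_apply, mul_comm, mul_smul]
  have hv : P.proxStep μ p ρ z e =
      w + rowMul (incMat μ) (Pi.single e (P.edgeStep μ p ρ x v e)) := by
    ext1 k
    rw [Pi.add_apply, hsingle]
    rcases e with e | ij
    · rw [Problem.proxStep, hzk, Problem.edgeStep, sub_eq_add_neg, smul_neg, smul_neg]
      match_scalars <;> ring
    · have hzij : z (Sum.inr ij) = rowMul (incMat μ) (mixW ρ x v) (Sum.inr ij) +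
          (ρ * μ (Sum.inr ij) / (P.sigA μ * p (Sum.inr ij))) •
          P.edgeGrad μ (mixY ρ x v) (Sum.inr ij) := by
        rw [hzk, edgeVec_inr_self, neg_one_smul, sub_neg_eq_add, rowMul_mixW]
      have hu : prox (P.stepSize μ p ρ (Sum.inr ij)) (P.fTilde ij) (z (Sum.inr ij)) =
          P.proxPoint μ p ρ x v ij := by
        rw [hzij, Problem.proxPoint]
      have hδ : μ (Sum.inr ij) • P.edgeStep μ p ρ x v (Sum.inr ij) =
          w (Sum.inr ij) - P.proxPoint μ p ρ x v ij := by
        rw [Problem.edgeStep, smul_smul, mul_inv_cancel₀ (hμ _).ne', one_smul, rowMul_mixW]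
      rw [hδ, Problem.proxStep, hu]
      by_cases h1 : k = Sum.inl ij.1
      · subst h1
        rw [Function.update_self, hzk, hzk, edgeVec_inr_self, edgeVec_inr_root]
        module
      · rw [Function.update_of_ne h1]
        by_cases h2 : k = Sum.inr ij
        · subst h2
          rw [Function.update_self, edgeVec_inr_self]
          module
        · rw [Function.update_of_ne h2, hzk, edgeVec_inr_of_ne _ h1 h2, zero_smul, zero_smul]
          module
  have hstep : P.step μ p ρ (rowMul (incMat μ) x, rowMul (incMat μ) v) e =
      (y + (ρ * P.res μ e / p e) • (P.proxStep μ p ρ z e - w), P.proxStep μ p ρ z e) := rfl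
  rw [hstep, hv, add_sub_cancel_left]
  simp only [Problem.liftStep, rowMul_add, rowMul_smul, rowMul_mixY, rowMul_mixW]
  rfl

theorem Problem.run_lift (hμ : ∀ e, 0 < μ e) (r : Fin n × Fin m → ℝ) (t : ℕ)
    (s : Fin t → Edge P.G m) :
    P.run μ p ρ t s = (rowMul (incMat μ) (P.liftRun μ p ρ r t s).1.1,
      rowMul (incMat μ) (P.liftRun μ p ρ r t s).1.2) := by
  induction t with
  | zero => simp [Problem.run, Problem.liftRun, rowMul_zero]
  | succ t ih => rw [Problem.run, ih, Problem.liftRun, P.step_lift μ p ρ hμ]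

variable {μ p ρ}

/-- The optimality condition of the proximal step. -/
theorem Problem.proxPoint_spec (hμ : ∀ e, 0 < μ e) (hp : ∀ e, 0 < p e) (hρ0 : 0 < ρ)
    (x v : Edge P.G m → Param d) (ij : Fin n × Fin m) :
    (P.proxPoint μ p ρ x v ij, (P.fTilde ij (P.proxPoint μ p ρ x v ij)).toReal) ∈
        conjEpi (P.f ij.1 ij.2) (P.L ij.1 ij.2) ∧
      ∀ q ∈ conjEpi (P.f ij.1 ij.2) (P.L ij.1 ij.2),
        (P.fTilde ij (P.proxPoint μ p ρ x v ij)).toReal +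
          inner ℝ ((P.stepSize μ p ρ (Sum.inr ij))⁻¹ •
            (rowMul (incMat μ) (mixW ρ x v) (Sum.inr ij) +
              (ρ * μ (Sum.inr ij) / (P.sigA μ * p (Sum.inr ij))) •
                P.edgeGrad μ (mixY ρ x v) (Sum.inr ij) - P.proxPoint μ p ρ x v ij))
            (q.1 - P.proxPoint μ p ρ x v ij) ≤ q.2 := by
  have hη : 0 < P.stepSize μ p ρ (Sum.inr ij) :=
    div_pos (mul_pos hρ0 (pow_pos (hμ _) 2)) (mul_pos (P.sigA_spec hμ (Sum.inr ij)).1 (hp _))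
  obtain ⟨r, h1, h2, h3⟩ := prox_spec (P.L_pos ij.1 ij.2) (P.convex _ _) (P.differentiable _ _)
    (P.smooth ij.1 ij.2) hη (rowMul (incMat μ) (mixW ρ x v) (Sum.inr ij) +
      (ρ * μ (Sum.inr ij) / (P.sigA μ * p (Sum.inr ij))) •
        P.edgeGrad μ (mixY ρ x v) (Sum.inr ij)) (g := P.fTilde ij) rfl
  have h4 : (P.fTilde ij (P.proxPoint μ p ρ x v ij)).toReal = r := by
    rw [Problem.proxPoint, h1, EReal.toReal_coe]
  rw [h4]
  exact ⟨h2, h3⟩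

/-- The pair formed by the node variable `(i, j)` and the associated bound. -/
def pairAt (μ : Edge P.G m → ℝ) (x : Edge P.G m → Param d) (X : Fin n × Fin m → ℝ)
    (ij : Fin n × Fin m) : Param d × ℝ :=
  (rowMul (incMat μ) x (Sum.inr ij), X ij)

theorem pairAt_mixY (x v : Edge P.G m → Param d) (X V : Fin n × Fin m → ℝ)
    (ij : Fin n × Fin m) :
    pairAt P μ (mixY ρ x v) (mixY ρ X V) ij = mixY ρ (pairAt P μ x X ij) (pairAt P μ v V ij) := by
  rw [pairAt, rowMul_mixY]
  rfl

theorem pairAt_mixW (x v : Edge P.G m → Param d) (X V : Fin n × Fin m → ℝ)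
    (ij : Fin n × Fin m) :
    pairAt P μ (mixW ρ x v) (mixW ρ X V) ij = mixW ρ (pairAt P μ x X ij) (pairAt P μ v V ij) := by
  rw [pairAt, rowMul_mixW]
  rfl

/-- The bounds are the values of a function above the non-smooth part of the dual function. -/
def Problem.LiftInv (μ p : Edge P.G m → ℝ) (ρ : ℝ) (s : LiftState P) : Prop :=
  ∀ ij : Fin n × Fin m, IsMix (conjEpi (P.f ij.1 ij.2) (P.L ij.1 ij.2)) (ρ / p (Sum.inr ij))
    (pairAt P μ s.1.1 s.2.1 ij) (pairAt P μ s.1.2 s.2.2 ij)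

theorem Problem.liftInv_step (hμ : ∀ e, 0 < μ e) (hp : ∀ e, 0 < p e) (hρ0 : 0 < ρ)
    (hρ1 : ρ ≤ 1) (hρp : ∀ ij, ρ ≤ p (Sum.inr ij)) (s : LiftState P) (e : Edge P.G m)
    (hs : P.LiftInv μ p ρ s) : P.LiftInv μ p ρ (P.liftStep μ p ρ s e) := by
  intro ij
  obtain ⟨⟨x, v⟩, X, V⟩ := s
  have hmix := (hs ij).mix (convex_conjEpi (P.L_pos _ _) (P.differentiable _ _) (P.smooth _ _))
    hρ0 hρ1 (div_pos hρ0 (hp _)).le (div_le_one_of_le₀ (hρp ij) (hp _).le)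
  simp only at hmix
  rw [← pairAt_mixY, ← pairAt_mixW] at hmix
  by_cases he : e = Sum.inr ij
  · subst he
    have hmem := (P.proxPoint_spec hμ hp hρ0 x v ij).1
    have hA : rowMul (incMat μ) (Pi.single (Sum.inr ij)
        (P.edgeStep μ p ρ x v (Sum.inr ij))) (Sum.inr ij) =
        P.proxPoint μ p ρ x v ij - rowMul (incMat μ) (mixW ρ x v) (Sum.inr ij) := by
      rw [rowMul_single, incMat_inr, if_pos rfl, Problem.edgeStep, smul_smul, neg_mul,
        mul_inv_cancel₀ (hμ _).ne', neg_one_smul, neg_sub]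
    convert hmix.replace hmem using 1
    · simp only [pairAt, Problem.liftStep, Problem.boundStep, P.res_inr hμ, mul_one, rowMul_add,
        rowMul_smul, Pi.add_apply, Pi.smul_apply, hA, Pi.single_eq_same]
      rfl
    · simp only [pairAt, Problem.liftStep, Problem.boundStep, rowMul_add, Pi.add_apply, hA,
        Pi.single_eq_same, add_sub_cancel]
  · have hA : ∀ δ : Param d, rowMul (incMat μ) (Pi.single e δ) (Sum.inr ij) = 0 := by
      intro δ
      rw [rowMul_single, incMat_inr, if_neg he, zero_smul]
    have hB : P.boundStep μ p ρ x v X V e ij = 0 := by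
      rcases e with e | kl
      · rfl
      · have : ij ≠ kl := fun h => he (by rw [h])
        rw [Problem.boundStep, Pi.single_eq_of_ne this]
    convert hmix using 1
    · simp only [pairAt, Problem.liftStep, rowMul_add, rowMul_smul, Pi.add_apply, Pi.smul_apply,
        hA, hB, smul_zero, add_zero]
    · simp only [pairAt, Problem.liftStep, rowMul_add, Pi.add_apply, hA, hB, add_zero]

/-- The Lyapunov function. -/
def Problem.lyap (μ : Edge P.G m → ℝ) (lams : Edge P.G m → Param d) (F : ℝ)
    (s : LiftState P) : ℝ :=
  sqNorm (rowMul (pinvMul (incMat μ)) (s.1.2 - lams)) +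
    2 / P.sigA μ * (P.qA μ s.1.1 + ∑ ij, s.2.1 ij - F)

theorem rowMul_pinvMul_inr (hμ : ∀ e, 0 < μ e) (z : Edge P.G m → Param d)
    (ij : Fin n × Fin m) :
    rowMul (pinvMul (incMat μ)) z (Sum.inr ij) = z (Sum.inr ij) := by
  have h : ∀ b, pinvMul (incMat μ) (Sum.inr ij) b = if b = Sum.inr ij then 1 else 0 := by
    intro b
    rw [← pinvMul_transpose, Matrix.transpose_apply,
      pinvMul_apply_of_ker _ (incMat_ker_inr P hμ ij)]
  simp only [rowMul, h, ite_smul, one_smul, zero_smul]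
  simp

/-- The contribution of an edge to the decrease of the Lyapunov function. -/
def Problem.boundGap (r X V : Fin n × Fin m → ℝ) (ρ : ℝ) : Edge P.G m → ℝ
  | Sum.inl _ => 0
  | Sum.inr ij => r ij - mixW ρ X V ij

/-- Multiplication by `p e` cancels the importance weight `1 / p e`; summed over the edges, the
right-hand side then contains the full gradient of `q_A` and the full non-smooth gap. -/
theorem Problem.lyap_liftStep_le (hμ : ∀ e, 0 < μ e) (hp : ∀ e, 0 < p e) (hρ0 : 0 < ρ)
    (hρ : ∀ e, ρ ^ 2 * (P.edgeHess μ e * P.res μ e) ≤ P.sigA μ * p e ^ 2)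
    {lams : Edge P.G m → Param d} {r : Fin n × Fin m → ℝ}
    (hr : ∀ ij, (rowMul (incMat μ) lams (Sum.inr ij), r ij) ∈
      conjEpi (P.f ij.1 ij.2) (P.L ij.1 ij.2)) (F : ℝ)
    (x v : Edge P.G m → Param d) (X V : Fin n × Fin m → ℝ) (e : Edge P.G m) :
    p e * P.lyap μ lams F (P.liftStep μ p ρ ((x, v), (X, V)) e) ≤
      p e * (sqNorm (rowMul (pinvMul (incMat μ)) (mixW ρ x v - lams)) +
        2 / P.sigA μ * (P.qA μ (mixY ρ x v) + ∑ ij, mixY ρ X V ij - F)) +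
      2 * ρ / P.sigA μ * (-inner ℝ (P.edgeGrad μ (mixY ρ x v) e)
        (rowMul (pinvMul (incMat μ)) (mixW ρ x v - lams) e) + P.boundGap r X V ρ e) := by
  have hσ := (P.sigA_spec hμ e).1
  have hpe := hp e
  have hexp : P.lyap μ lams F (P.liftStep μ p ρ ((x, v), (X, V)) e) =
      sqNorm (rowMul (pinvMul (incMat μ)) (mixW ρ x v - lams)) +
        (2 * inner ℝ (P.edgeStep μ p ρ x v e)
          (rowMul (pinvMul (incMat μ)) (mixW ρ x v - lams) e) +
          P.res μ e * ‖P.edgeStep μ p ρ x v e‖ ^ 2) +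
      2 / P.sigA μ * (P.qA μ (mixY ρ x v) + ((ρ * P.res μ e / p e) *
        inner ℝ (P.edgeGrad μ (mixY ρ x v) e) (P.edgeStep μ p ρ x v e) +
        (ρ * P.res μ e / p e) ^ 2 / 2 * (P.edgeHess μ e * ‖P.edgeStep μ p ρ x v e‖ ^ 2)) +
        (∑ ij, mixY ρ X V ij + (ρ / p e) * ∑ ij, P.boundStep μ p ρ x v X V e ij) - F) := by
    simp only [Problem.lyap, Problem.liftStep]
    rw [add_sub_right_comm, P.sqNorm_pinvMul_add_single, P.qA_add_single]
    simp only [Pi.add_apply, Pi.smul_apply, smul_eq_mul, Finset.sum_add_distrib, Finset.mul_sum]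
  rw [hexp]
  rcases e with e | ij
  · have h := coordinate_descent_le hpe hσ (P.res_pos hμ _) (hρ _)
      (g := P.edgeGrad μ (mixY ρ x v) (Sum.inl e))
      (u := rowMul (pinvMul (incMat μ)) (mixW ρ x v - lams) (Sum.inl e))
      (δ := P.edgeStep μ p ρ x v (Sum.inl e)) rfl
    simp only [Problem.boundStep, Problem.boundGap, Pi.zero_apply, Finset.sum_const_zero,
      mul_zero, add_zero]
    linarith
  · set δ := P.edgeStep μ p ρ x v (Sum.inr ij) with hδ
    set g := P.edgeGrad μ (mixY ρ x v) (Sum.inr ij) with hg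
    set u := (mixW ρ x v - lams) (Sum.inr ij) with hu
    set M := μ (Sum.inr ij) with hM
    set pe := p (Sum.inr ij) with hpe'
    set ψ := (P.fTilde ij (P.proxPoint μ p ρ x v ij)).toReal with hψ
    have hMpos : 0 < M := hμ _
    have hR : P.res μ (Sum.inr ij) = 1 := P.res_inr hμ ij
    rw [rowMul_pinvMul_inr P hμ, hR]
    have hopt := (P.proxPoint_spec hμ hp hρ0 x v ij).2 _ (hr ij)
    have hu1 : P.proxPoint μ p ρ x v ij =
        rowMul (incMat μ) (mixW ρ x v) (Sum.inr ij) - M • δ := by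
      rw [hδ, Problem.edgeStep, smul_smul, mul_inv_cancel₀ hMpos.ne', one_smul, sub_sub_cancel]
    -- Chosen so that `δ = -(ρ / (σ_A p)) (g + s)`; by `e1`, `-s / μ` is the subgradient in the node
    -- variable given by the proximal step.
    set s : Param d := -((P.sigA μ * pe / ρ) • δ) - g with hs
    have e1 : (P.stepSize μ p ρ (Sum.inr ij))⁻¹ •
        (rowMul (incMat μ) (mixW ρ x v) (Sum.inr ij) + (ρ * M / (P.sigA μ * pe)) • g -
          P.proxPoint μ p ρ x v ij) = -(M⁻¹ • s) := by
      rw [hu1, hs, Problem.stepSize, ← hM, ← hpe']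
      have h1 := hρ0.ne'
      have h2 := hMpos.ne'
      have h3 := hpe.ne'
      have h4 := hσ.ne'
      match_scalars <;> field_simp
      ring
    have e2 : rowMul (incMat μ) lams (Sum.inr ij) - P.proxPoint μ p ρ x v ij =
        M • (u + δ) := by
      rw [hu1, rowMul_incMat_inr, rowMul_incMat_inr, hu, Pi.sub_apply, ← hM]
      module
    simp only at hopt
    rw [e1, e2, inner_neg_left, real_inner_smul_left, real_inner_smul_right, ← mul_assoc,
      inv_mul_cancel₀ hMpos.ne', one_mul] at hopt
    have hρ' := hρ (Sum.inr ij)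
    rw [hR, mul_one] at hρ'
    have h := proximal_descent_le (Ψ := ψ - r ij) hpe hρ0 hσ hρ' (g := g) (s := s) (u := u)
      (δ := δ) (by
        have h1 := hρ0.ne'
        have h3 := hpe.ne'
        have h4 := hσ.ne'
        rw [hs]
        match_scalars <;> field_simp
        ring) (by linarith)
    have e3 : ∑ kl, P.boundStep μ p ρ x v X V (Sum.inr ij) kl = ψ - mixW ρ X V ij := by
      rw [Problem.boundStep, Finset.sum_pi_single']
      simp [hψ]
    rw [e3]
    simp only [Problem.boundGap, mul_one, one_mul]
    have e4 : pe * (2 / P.sigA μ * (ρ / pe * (ψ - mixW ρ X V ij))) =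
        2 * ρ / P.sigA μ * (ψ - mixW ρ X V ij) := by
      have h3 := hpe.ne'
      field_simp
    linarith

theorem Problem.lyap_step_le (hμ : ∀ e, 0 < μ e) (hp : ∀ e, 0 < p e) (hp1 : ∑ e, p e = 1)
    (hρ0 : 0 < ρ) (hρ1 : ρ ≤ 1)
    (hρ : ∀ e, ρ ^ 2 * (P.edgeHess μ e * P.res μ e) ≤ P.sigA μ * p e ^ 2)
    (hσ : 0 < P.sigA μ)
    {lams : Edge P.G m → Param d} {r : Fin n × Fin m → ℝ}
    (hr : ∀ ij, (rowMul (incMat μ) lams (Sum.inr ij), r ij) ∈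
      conjEpi (P.f ij.1 ij.2) (P.L ij.1 ij.2)) (s : LiftState P) :
    ∑ e, p e * P.lyap μ lams (P.qA μ lams + ∑ ij, r ij) (P.liftStep μ p ρ s e) ≤
      (1 - ρ) * P.lyap μ lams (P.qA μ lams + ∑ ij, r ij) s := by
  obtain ⟨⟨x, v⟩, X, V⟩ := s
  refine (Finset.sum_le_sum fun e _ => P.lyap_liftStep_le hμ hp hρ0 hρ hr _ x v X V e).trans ?_
  rw [Finset.sum_add_distrib, ← Finset.sum_mul, hp1, one_mul, ← Finset.mul_sum,
    Finset.sum_add_distrib, Finset.sum_neg_distrib]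
  have h1 : ∑ e, inner ℝ (P.edgeGrad μ (mixY ρ x v) e)
      (rowMul (pinvMul (incMat μ)) (mixW ρ x v - lams) e) =
      P.hessInner μ (mixY ρ x v) (mixW ρ x v - lams) := by
    rw [← P.hessInner_pinvMul, ← P.colInner_edgeGrad, colInner]
  have h2 : ∑ e, P.boundGap r X V ρ e = ∑ ij, r ij - ∑ ij, mixW ρ X V ij := by
    rw [Fintype.sum_sum_type]
    simp [Problem.boundGap]
  -- The identity `y - ρ w = (1 - ρ) x` makes the bounds contract exactly.
  have h3 : ∑ ij, mixY ρ X V ij - ρ * ∑ ij, mixW ρ X V ij = (1 - ρ) * ∑ ij, X ij := by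
    rw [Finset.mul_sum, Finset.mul_sum, ← Finset.sum_sub_distrib]
    refine Finset.sum_congr rfl fun ij _ => ?_
    have : 1 + ρ ≠ 0 := by linarith
    simp only [mixW, mixY, Pi.add_apply, Pi.smul_apply, smul_eq_mul]
    field_simp
    ring
  have h4 := P.momentum_le hσ hρ0 hρ1 x v lams
  rw [h1, h2]
  have h5 : ∑ ij, mixY ρ X V ij = (1 - ρ) * ∑ ij, X ij + ρ * ∑ ij, mixW ρ X V ij := by linarith
  rw [h5]
  simp only [Problem.lyap]
  have h6 : 2 * ρ / P.sigA μ = ρ * (2 / P.sigA μ) := by ring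
  rw [h6]
  linarith

theorem Problem.expect_lyap_le (hμ : ∀ e, 0 < μ e) (hp : ∀ e, 0 < p e) (hp1 : ∑ e, p e = 1)
    (hρ0 : 0 < ρ) (hρ1 : ρ ≤ 1)
    (hρ : ∀ e, ρ ^ 2 * (P.edgeHess μ e * P.res μ e) ≤ P.sigA μ * p e ^ 2)
    (hρp : ∀ ij, ρ ≤ p (Sum.inr ij)) (hσ : 0 < P.sigA μ) {θ : Param d}
    {lams : Edge P.G m → Param d} {r r₀ : Fin n × Fin m → ℝ}
    (hr : ∀ ij, (rowMul (incMat μ) lams (Sum.inr ij), r ij) ∈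
      conjEpi (P.f ij.1 ij.2) (P.L ij.1 ij.2))
    (hval : P.qA μ lams + ∑ ij, r ij = -P.primal θ)
    (hr₀ : ∀ ij, ((0 : Param d), r₀ ij) ∈ conjEpi (P.f ij.1 ij.2) (P.L ij.1 ij.2)) (t : ℕ) :
    expect p t (fun s => sqNorm (rowMul (pinvMul (incMat μ))
      ((P.liftRun μ p ρ r₀ t s).1.2 - lams))) ≤
      (1 - ρ) ^ t * (sqNorm (rowMul (pinvMul (incMat μ)) lams) +
        2 / P.sigA μ * (P.qA μ 0 + ∑ ij, r₀ ij - -P.primal θ)) := by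
  -- Initially `x = v`, so the relation holds for every weight.
  have hinv₀ : P.LiftInv μ p ρ ((0, 0), (r₀, r₀)) := by
    intro ij
    have h1 : pairAt P μ 0 r₀ ij = (0, r₀ ij) := by simp [pairAt, rowMul_zero]
    exact ⟨by rw [h1]; exact hr₀ ij, (0, r₀ ij), hr₀ ij, by simp only [h1]; module⟩
  have hinv := fun s e => P.liftInv_step hμ hp hρ0 hρ1 hρp s e
  have hall : ∀ t s, P.LiftInv μ p ρ (P.liftRun μ p ρ r₀ t s) := by
    intro t
    induction t with
    | zero => intro s; exact hinv₀
    | succ t ih => intro s; exact hinv _ _ (ih _)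
  have h := expect_run_le (fun e => (hp e).le) (P.liftStep μ p ρ) (P.liftRun μ p ρ r₀)
    ((0, 0), (r₀, r₀)) (fun _ => rfl) (fun _ _ => rfl) (P.LiftInv μ p ρ) hinv₀ hinv
    (P.lyap μ lams (P.qA μ lams + ∑ ij, r ij)) (sub_nonneg.2 hρ1)
    (fun s _ => P.lyap_step_le hμ hp hp1 hρ0 hρ1 hρ hσ hr s) t
  have h0 : P.lyap μ lams (P.qA μ lams + ∑ ij, r ij) ((0, 0), (r₀, r₀)) =
      sqNorm (rowMul (pinvMul (incMat μ)) lams) +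
        2 / P.sigA μ * (P.qA μ 0 + ∑ ij, r₀ ij - -P.primal θ) := by
    rw [Problem.lyap, hval, rowMul_sub]
    simp [rowMul_zero, sqNorm]
  rw [h0] at h
  refine le_trans (expect_mono (fun e => (hp e).le) fun s => ?_) h
  rw [Problem.lyap, le_add_iff_nonneg_right, hval]
  -- Weak duality applies to the surrogate value because the pairs for `x` are still in the
  -- epigraph; the gap can thus be dropped.
  refine mul_nonneg (div_pos two_pos hσ).le (sub_nonneg.2 (P.neg_primal_le' _ θ fun ij => ?_))
  exact (hall t s ij).mem (convex_conjEpi (P.L_pos _ _) (P.differentiable _ _) (P.smooth _ _))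
    (div_pos hρ0 (hp _)).le (div_le_one_of_le₀ (hρp ij) (hp _).le)

end Lift

/-! ### Convergence of the output -/

section Output

variable {n m d : ℕ} (P : Problem n m d) {μ p : Edge P.G m → ℝ} {ρ : ℝ}

/-- Since `A = A A†A`, the error depends only on the projection of `v - lams`, which the Lyapunov
function controls. -/
theorem Problem.sqNorm_output_sub_le (hμ : ∀ e, 0 < μ e) (lams : Edge P.G m → Param d)
    (r : Fin n × Fin m → ℝ) (t : ℕ) (s : Fin t → Edge P.G m) :
    sqNorm (P.output μ p ρ t s - P.primalPoint μ lams) ≤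
      lamMax ((incMat μ).transpose * Matrix.diagonal (fun k => (P.diag k)⁻¹ ^ 2) * incMat μ) *
        sqNorm (rowMul (pinvMul (incMat μ)) ((P.liftRun μ p ρ r t s).1.2 - lams)) := by
  have h := colInner_rowMul_le_lamMax (posSemidef_transpose_diagonal_mul (incMat μ)
    (w := fun k => (P.diag k)⁻¹ ^ 2) fun k => sq_nonneg _).1
    (rowMul (pinvMul (incMat μ)) ((P.liftRun μ p ρ r t s).1.2 - lams))
  rw [colInner_transpose_diagonal_mul, rowMul_rowMul, mul_pinvMul] at h
  refine le_of_eq_of_le (Finset.sum_congr rfl fun k _ => ?_) h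
  rw [Pi.sub_apply, Problem.output, P.run_lift μ p ρ hμ r, Problem.primalPoint, ← smul_sub,
    norm_smul, mul_pow, Real.norm_eq_abs, sq_abs, rowMul_sub, Pi.sub_apply]

theorem one_sub_pow_ceil_le {ρ ε : ℝ} (hρ0 : 0 < ρ) (hρ1 : ρ ≤ 1) (hε : 0 < ε) :
    (1 - ρ) ^ ⌈ρ⁻¹ * Real.log ε⁻¹⌉₊ ≤ ε := by
  set K := ⌈ρ⁻¹ * Real.log ε⁻¹⌉₊
  -- This also holds when `1 ≤ ε`: the logarithm is then nonpositive and the natural ceiling is `0`.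
  have h1 : ρ⁻¹ * Real.log ε⁻¹ ≤ K := Nat.le_ceil _
  rw [Real.log_inv, inv_mul_le_iff₀ hρ0] at h1
  calc (1 - ρ) ^ K ≤ Real.exp (-ρ) ^ K :=
        pow_le_pow_left₀ (by linarith) (Real.one_sub_le_exp_neg ρ) K
    _ = Real.exp (-(ρ * K)) := by rw [← Real.exp_nat_mul]; ring_nf
    _ ≤ Real.exp (Real.log ε) := Real.exp_le_exp.2 (by linarith)
    _ = ε := Real.exp_log hε

theorem Problem.expect_output_le (hμ : ∀ e, 0 < μ e) (hp : ∀ e, 0 < p e) (hp1 : ∑ e, p e = 1)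
    (hρ0 : 0 < ρ) (hρ1 : ρ ≤ 1)
    (hρ : ∀ e, ρ ^ 2 * (P.edgeHess μ e * P.res μ e) ≤ P.sigA μ * p e ^ 2)
    (hρp : ∀ ij, ρ ≤ p (Sum.inr ij)) (e₀ : Edge P.G m) {θ : Param d}
    {lams : Edge P.G m → Param d} (hθ : ∀ θ', P.primal θ ≤ P.primal θ')
    (hlams : ∀ lam, P.dual μ lams ≤ P.dual μ lam) {ε : ℝ} (hε : 0 < ε) :
    ((expect p ⌈ρ⁻¹ * Real.log ε⁻¹⌉₊ fun s =>
      sqNorm (P.output μ p ρ _ s - P.primalPoint μ lams) : ℝ) : EReal) ≤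
      P.c0 μ lams * (ε : EReal) := by
  have hσ := (P.sigA_spec hμ e₀).1
  have hd2 : ∀ k, 0 < (P.diag k)⁻¹ ^ 2 := fun k => pow_pos (inv_pos.2 (P.diag_pos k)) 2
  have hmax := lamMax_pos (posSemidef_transpose_diagonal_mul (incMat μ) fun k => (hd2 k).le)
    (transpose_diagonal_mul_ne_zero P hμ hd2 e₀)
  obtain ⟨-, hF, r, hr, hval⟩ := P.dual_minimizer hμ hθ hlams
  rw [Problem.c0, hF]
  -- If the dual function is infinite at `0`, so is `C₀ ε`, since `lamMax` and `ε` are positive.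
  rcases P.dual_eq_top_or_coe μ 0 with h0 | ⟨r₀, hr₀, h0⟩
  · rw [h0, EReal.top_sub_coe, EReal.coe_mul_top_of_pos (by positivity), EReal.coe_add_top,
      EReal.coe_mul_top_of_pos hmax, EReal.top_mul_coe_of_pos hε]
    exact le_top
  · rw [h0]
    simp only [← EReal.coe_sub, ← EReal.coe_mul, ← EReal.coe_add]
    refine EReal.coe_le_coe_iff.2 ?_
    simp only [rowMul_zero, Pi.zero_apply] at hr₀
    set K := ⌈ρ⁻¹ * Real.log ε⁻¹⌉₊
    have h1 := P.expect_lyap_le hμ hp hp1 hρ0 hρ1 hρ hρp hσ hr hval hr₀ K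
    refine (expect_mono (fun e => (hp e).le)
      fun s => P.sqNorm_output_sub_le hμ lams r₀ K s).trans ?_
    rw [expect_const_mul, mul_assoc]
    refine mul_le_mul_of_nonneg_left (h1.trans ?_) hmax.le
    rw [mul_comm _ ε, ← div_eq_mul_inv]
    refine mul_le_mul_of_nonneg_right (one_sub_pow_ceil_le hρ0 hρ1 hε) ?_
    refine add_nonneg (sqNorm_nonneg _) (mul_nonneg (div_pos two_pos hσ).le (sub_nonneg.2 ?_))
    exact P.neg_primal_le' (μ := μ) 0 θ fun ij => by
      rw [rowMul_zero]
      exact hr₀ ij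

end Output

/-! ### Bounds on the parameters -/

section Parameters

variable {n m d : ℕ} (P : Problem n m d) {μ p : Edge P.G m → ℝ}

theorem Problem.sComp_pos (hn : 0 < n) (hm : 1 ≤ m) : 0 < P.sComp := by
  refine mul_pos (inv_pos.2 (by exact_mod_cast hn)) ?_
  refine Finset.sum_pos (fun i _ => Finset.sum_pos (fun j _ => Real.sqrt_pos.2 ?_)
    ⟨⟨0, hm⟩, Finset.mem_univ _⟩) ⟨⟨0, hn⟩, Finset.mem_univ _⟩
  have := mul_pos (P.L_pos i j) (inv_pos.2 (P.σ_pos i))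
  linarith

theorem Problem.sComp_le (hn : 0 < n) : P.sComp ≤ m + √(m * P.kapS) := by
  have hn' : (0 : ℝ) < n := by exact_mod_cast hn
  rw [Problem.sComp, inv_mul_le_iff₀ hn']
  have h : ∀ i, ∑ j, √(1 + P.L i j * (P.σ i)⁻¹) ≤ m + √(m * P.kapS) := by
    intro i
    have hk := P.le_kapS i
    have hk1 := P.one_le_kap i
    have hm : (0 : ℝ) ≤ m := Nat.cast_nonneg m
    refine abs_le_of_sq_le_sq' ?_ (by positivity) |>.2
    -- Cauchy–Schwarz gives `m (m + κ i - 1) ≤ m² + m κ_s`, which is below the square of the target.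
    have h1 := sq_sum_le_card_mul_sum_sq (s := Finset.univ)
      (f := fun j => √(1 + P.L i j * (P.σ i)⁻¹))
    have h2 : ∑ j, √(1 + P.L i j * (P.σ i)⁻¹) ^ 2 = m + (P.kap i - 1) := by
      rw [Problem.kap, add_sub_cancel_left, Finset.mul_sum]
      calc _ = ∑ j, (1 + (P.σ i)⁻¹ * P.L i j) := by
            refine Finset.sum_congr rfl fun j _ => ?_
            have := mul_pos (P.L_pos i j) (inv_pos.2 (P.σ_pos i))
            rw [Real.sq_sqrt (by linarith), mul_comm]
        _ = _ := by rw [Finset.sum_add_distrib]; simp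
    rw [h2, Finset.card_univ, Fintype.card_fin] at h1
    have h3 : √(m * P.kapS) ^ 2 = m * P.kapS := Real.sq_sqrt (by nlinarith)
    have h4 := Real.sqrt_nonneg (m * P.kapS)
    nlinarith [mul_nonneg hm h4, mul_le_mul_of_nonneg_left hk hm]
  calc _ ≤ ∑ _i : Fin n, ((m : ℝ) + √(m * P.kapS)) := Finset.sum_le_sum fun i _ => h i
    _ = _ := by rw [Finset.sum_const, Finset.card_univ, Fintype.card_fin, nsmul_eq_mul]

theorem Problem.kapMin_pos (hn : 0 < n) : 0 < P.kapMin := by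
  have : Nonempty (Fin n) := ⟨⟨0, hn⟩⟩
  exact zero_lt_one.trans_le (le_ciInf fun i => P.one_le_kap i)

theorem Problem.kapS_pos (hn : 0 < n) : 0 < P.kapS :=
  zero_lt_one.trans_le ((P.one_le_kap ⟨0, hn⟩).trans (P.le_kapS _))

theorem Problem.sigMax_pos (hn : 0 < n) : 0 < P.sigMax :=
  (P.σ_pos ⟨0, hn⟩).trans_le (P.le_sigMax _)

theorem Problem.numComm_pos (hn : 2 ≤ n) : 0 < P.numComm := by
  have := nonempty_commEdge P.connected hn
  exact Nat.cast_pos.2 Fintype.card_pos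

theorem Problem.gam_pos (hn : 2 ≤ n) (hμ : ∀ e, 0 < μ e) : 0 < P.gam μ := by
  have := nonempty_commEdge P.connected hn
  obtain ⟨e, he⟩ := exists_eq_ciInf_of_finite (f := fun e : CommEdge P.G =>
    lamMinPos (commLap μ) * (n : ℝ) ^ 2 / (μ (Sum.inl e) ^ 2 * P.res μ (Sum.inl e) *
      P.numComm ^ 2))
  rw [Problem.gam, ← he]
  have hn' : (0 : ℝ) < n := by exact_mod_cast (by omega : 0 < n)
  exact div_pos (mul_pos (lamMinPos_commLap_pos P.connected hn hμ) (pow_pos hn' 2))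
    (mul_pos (mul_pos (pow_pos (hμ _) 2) (P.res_pos hμ _)) (pow_pos (P.numComm_pos hn) 2))

theorem Problem.gam_mul_le (hn : 2 ≤ n) (hμ : ∀ e, 0 < μ e) (e : CommEdge P.G) :
    P.gam μ * (μ (Sum.inl e) ^ 2 * P.res μ (Sum.inl e) * P.numComm ^ 2) ≤
      lamMinPos (commLap μ) * (n : ℝ) ^ 2 := by
  rw [← le_div_iff₀ (mul_pos (mul_pos (pow_pos (hμ _) 2) (P.res_pos hμ _))
    (pow_pos (P.numComm_pos hn) 2))]
  exact ciInf_le (Set.finite_range fun e : CommEdge P.G =>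
    lamMinPos (commLap μ) * (n : ℝ) ^ 2 / (μ (Sum.inl e) ^ 2 * P.res μ (Sum.inl e) *
      P.numComm ^ 2)).bddBelow e

/-- Lower bound on the rate. -/
theorem Problem.le_rate (hn : 2 ≤ n) (hm : 1 ≤ m) (hμ : ∀ e, 0 < μ e)
    (hμc : ∀ e, μ (Sum.inl e) ^ 2 = 1 / 2)
    (hμv : ∀ i j, μ (Sum.inr (i, j)) ^ 2 =
      lamMinPos (commLap μ) / (P.sigMax * P.kap i) * P.L i j)
    {pc q Δ : ℝ} (hΔ : 0 < Δ) (hq : 0 < q)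
    (hpv : ∀ i j, p (Sum.inr (i, j)) = pc * √(1 + P.L i j * (P.σ i)⁻¹) / (n * P.sComp))
    (hpe : ∀ e, Δ * q / P.numComm ≤ p (Sum.inl e))
    (hσ : ∀ i, P.σ i = P.sigMax) :
    P.kapMin * pc ^ 2 ≤ (n * P.rate μ p) ^ 2 * (2 * P.kapS * P.sComp ^ 2) ∨
      Δ ^ 2 * q ^ 2 * P.gam μ ≤ (n * P.rate μ p) ^ 2 * (4 * P.kapS) := by
  have hn0 : 0 < n := by omega
  have hn' : (0 : ℝ) < n := by exact_mod_cast hn0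
  have hne : Nonempty (Edge P.G m) := ⟨Sum.inr (⟨0, hn0⟩, ⟨0, hm⟩)⟩
  obtain ⟨e, he⟩ := P.rate_eq (p := p) hμ
  have hlam := lamMinPos_commLap_pos P.connected hn hμ
  have hle := P.lamMinPos_le_sigA hn0 hμ e hlam.le hμv
  have hS := P.sComp_pos hn0 hm
  have hks := P.kapS_pos hn0
  have hsm := P.sigMax_pos hn0
  set lam := lamMinPos (commLap μ)
  set ρ := P.rate μ p
  set sA := P.sigA μ
  rcases e with e | ⟨i, j⟩
  · right
    have hR := P.res_pos hμ (Sum.inl e)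
    have hE := P.numComm_pos hn
    -- With `μ² = 1 / 2` and equal `σ i`, the two endpoint contributions add up to `1 / σ`.
    have hM : P.edgeHess μ (Sum.inl e) = P.sigMax⁻¹ := by
      rw [Problem.edgeHess, hμc]
      simp only [src, dst, Problem.diag, hσ]
      ring
    have hg := P.gam_mul_le hn hμ e
    rw [hμc] at hg
    rw [hM] at he
    set R := P.res μ (Sum.inl e)
    have h1 : ρ ^ 2 * R = P.sigMax * sA * p (Sum.inl e) ^ 2 := by
      rw [mul_assoc, ← he]
      field_simp
    have h3 : (Δ * q) ^ 2 ≤ (P.numComm * p (Sum.inl e)) ^ 2 := by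
      refine pow_le_pow_left₀ (by positivity) ?_ 2
      have := hpe e
      rwa [div_le_iff₀' hE] at this
    have h4 : lam * (P.numComm * p (Sum.inl e)) ^ 2 ≤
        2 * P.kapS * P.numComm ^ 2 * (ρ ^ 2 * R) := by
      rw [h1]
      have := mul_le_mul_of_nonneg_right hle (sq_nonneg (P.numComm * p (Sum.inl e)))
      linarith
    have h5 := mul_le_mul_of_nonneg_left h3 hlam.le
    have h6 : lam * (Δ * q) ^ 2 * P.gam μ ≤
        4 * P.kapS * ρ ^ 2 * (P.gam μ * (1 / 2 * R * P.numComm ^ 2)) := by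
      have := mul_le_mul_of_nonneg_right (h5.trans h4) (P.gam_pos hn hμ).le
      linarith
    have h7 : lam * (Δ * q) ^ 2 * P.gam μ ≤ 4 * P.kapS * ρ ^ 2 * (lam * (n : ℝ) ^ 2) :=
      h6.trans (mul_le_mul_of_nonneg_left hg (by positivity))
    refine le_of_mul_le_mul_left ?_ hlam
    linarith
  · left
    have hk : 0 < P.kap i := zero_lt_one.trans_le (P.one_le_kap i)
    have hL := P.L_pos i j
    have hs := P.σ_pos i
    set b := 1 + P.L i j * (P.σ i)⁻¹ with hb
    have hb0 : 0 < b := by positivity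
    -- The curvature is proportional to `b`, and so is `p_ij ^ 2`; `b` cancels, which is the purpose
    -- of the square-root sampling.
    have hM : P.edgeHess μ (Sum.inr (i, j)) * (P.sigMax * P.kap i) = lam * b := by
      rw [Problem.edgeHess, hμv]
      simp only [src, dst, Problem.diag, hb]
      field_simp
      ring
    have hp2 : p (Sum.inr (i, j)) ^ 2 * (n * P.sComp) ^ 2 = pc ^ 2 * b := by
      rw [hpv, div_pow, mul_pow, Real.sq_sqrt hb0.le]
      field_simp
    rw [P.res_inr hμ, mul_one] at he
    have h1 : ρ ^ 2 * (lam * b) * (n * P.sComp) ^ 2 =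
        sA * (P.sigMax * P.kap i) * (pc ^ 2 * b) := by
      rw [← hM, ← hp2]
      linear_combination (P.sigMax * P.kap i * (n * P.sComp) ^ 2) * he
    have h2 : (n * ρ) ^ 2 * P.sComp ^ 2 * lam = sA * P.sigMax * (P.kap i * pc ^ 2) := by
      refine mul_right_cancel₀ hb0.ne' ?_
      linear_combination h1
    have h3 : lam * (P.kapMin * pc ^ 2) ≤
        2 * (P.sigMax * P.kapS) * sA * (P.kap i * pc ^ 2) := by
      refine mul_le_mul hle (mul_le_mul_of_nonneg_right (P.kapMin_le i) (sq_nonneg _))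
        (mul_nonneg (P.kapMin_pos hn0).le (sq_nonneg _)) (hlam.le.trans hle)
    refine le_of_mul_le_mul_left ?_ hlam
    refine h3.trans (le_of_eq ?_)
    linear_combination (-2 * P.kapS) * h2

/-- The comparison of the iteration cost and of the rate. -/
theorem cost_le_rate_mul {S A B G Δ q c τ W N g M : ℝ} (hS : 0 < S) (hA : 0 < A) (hB : 0 < B)
    (hG : 0 < G) (hΔ : 0 < Δ) (hc : 0 ≤ c) (hτ : 0 ≤ τ) (hW : S ≤ W)
    (hg : g = Δ * (G / B) * S) (hq0 : 0 < q) (hq1 : q * (1 + g) ≤ 1)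
    (hq2 : 1 ≤ q * (2 + g)) (hqh : q ≤ 1 / 2) (hM : M ≤ c * q) (hN : 0 < N)
    (h : B ^ 2 * (1 - q) ^ 2 ≤ N ^ 2 * (2 * A ^ 2 * S ^ 2) ∨
      Δ ^ 2 * q ^ 2 * G ^ 2 ≤ N ^ 2 * (4 * A ^ 2)) :
    1 - q + 2 * τ * M ≤
      4 * N * (W / (√2 * (B / A)) + (1 + 4 * c * τ) / Δ * (A / G)) := by
  have h20 : 0 < √2 := by positivity
  have h22 : √2 ^ 2 = 2 := Real.sq_sqrt (by norm_num)
  have h2l : 1 ≤ √2 := by nlinarith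
  have h2u : √2 ≤ 2 := by nlinarith
  generalize √2 = b at *
  have hg0 : 0 < g := by rw [hg]; positivity
  have hcτ : 0 ≤ c * τ * q := by positivity
  have hMτ : 2 * τ * M ≤ 2 * (c * τ * q) := by
    have := mul_le_mul_of_nonneg_left hM hτ
    linarith
  rcases h with h | h
  · have h1 : B * (1 - q) ≤ N * (b * A * S) := by
      refine (abs_le_of_sq_le_sq' ?_ (by positivity)).2
      calc (B * (1 - q)) ^ 2 = B ^ 2 * (1 - q) ^ 2 := by ring
        _ ≤ N ^ 2 * (2 * A ^ 2 * S ^ 2) := h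
        _ = (N * (b * A * S)) ^ 2 := by rw [← h22]; ring
    have h3 : 1 - q ≤ 2 * N * (W / (b * (B / A))) := by
      have e1 : 2 * N * (S / (b * (B / A))) = N * (b * A * S) / B := by
        have : (2 : ℝ) = b * b := by rw [← sq, h22]
        rw [this]
        field_simp
      have h4 : 1 - q ≤ 2 * N * (S / (b * (B / A))) := by
        rw [e1, le_div_iff₀ hB]
        linarith
      refine h4.trans ?_
      gcongr
    -- When a virtual edge limits the rate, `q g ≤ 1 - q` transfers the bound on `1 - q` to `q`.
    have h5 : 2 * (c * τ * q) ≤ 4 * N * ((1 + 4 * c * τ) / Δ * (A / G)) := by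
      have e2 : q * (Δ * G) ≤ N * (b * A) := by
        have e3 : q * g ≤ 1 - q := by linarith
        have e4 : B * (q * g) = q * (Δ * G) * S := by
          rw [hg]
          field_simp
        refine le_of_mul_le_mul_right ?_ hS
        have := mul_le_mul_of_nonneg_left e3 hB.le
        linarith
      have e5 : q ≤ 2 * (N * (A / (Δ * G))) := by
        rw [← mul_div_assoc, ← mul_div_assoc, le_div_iff₀ (by positivity)]
        have := mul_le_mul_of_nonneg_left h2u (mul_pos hN hA).le
        linarith
      have e6 : (1 + 4 * c * τ) / Δ * (A / G) = (1 + 4 * c * τ) * (A / (Δ * G)) := by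
        field_simp
      have e7 := mul_le_mul_of_nonneg_left e5 (mul_nonneg hc hτ)
      have e8 : 0 ≤ N * (A / (Δ * G)) := by positivity
      have e9 : 0 ≤ c * τ * (N * (A / (Δ * G))) := by positivity
      rw [e6]
      linarith
    have h6 : 0 ≤ 2 * N * (W / (b * (B / A))) := by
      have : 0 < W := hS.trans_le hW
      positivity
    linarith
  · have h1 : Δ * q * G ≤ N * (2 * A) := by
      refine (abs_le_of_sq_le_sq' ?_ (by positivity)).2
      calc (Δ * q * G) ^ 2 = Δ ^ 2 * q ^ 2 * G ^ 2 := by ring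
        _ ≤ N ^ 2 * (4 * A ^ 2) := h
        _ = (N * (2 * A)) ^ 2 := by ring
    have h2 : q ≤ 2 * (N * (A / (Δ * G))) := by
      rw [← mul_div_assoc, ← mul_div_assoc, le_div_iff₀ (by positivity)]
      linarith
    -- When a communication edge limits the rate, `q` is bounded directly, and `1 - q ≤ q (1 + g)`
    -- reduces the local cost to `q` and `q g`.
    have h3 : q * g ≤ 4 * N * (W / (b * (B / A))) := by
      have e1 : q * g = Δ * q * G * S / B := by
        rw [hg]
        field_simp
      have e2 : q * g ≤ N * (2 * A) * S / B := by
        rw [e1]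
        gcongr
      have e3 : N * (2 * A) * S / B ≤ 4 * N * (S / (b * (B / A))) := by
        have e4 : 4 * N * (S / (b * (B / A))) = b * (N * (2 * A) * S / B) := by
          have : (4 : ℝ) = 2 * (b * b) := by rw [← sq, h22]; norm_num
          rw [this]
          field_simp
        rw [e4]
        have : 0 ≤ N * (2 * A) * S / B := by positivity
        nlinarith
      refine (e2.trans e3).trans ?_
      gcongr
    have e6 : (1 + 4 * c * τ) / Δ * (A / G) = (1 + 4 * c * τ) * (A / (Δ * G)) := by
      field_simp
    have e7 := mul_le_mul_of_nonneg_left h2 (mul_nonneg hc hτ)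
    have e9 : 0 ≤ c * τ * (N * (A / (Δ * G))) := by positivity
    rw [mul_add, e6]
    linarith

end Parameters

end ADFS

end

/-! ### Assembly of the main theorem -/

theorem theorem6 :
    ∃ C : ℝ, C < 24 ∧ ADFS.IsSyncConstant C ∧
    ∀ (n m d : ℕ) (P : ADFS.Problem n m d) (μ p : ADFS.Edge P.G m → ℝ) (τ Δp cτ ρ : ℝ),
      2 ≤ n → 1 ≤ m → 0 ≤ τ → 0 < Δp → Δp ≤ 1 → 0 < cτ →
      -- the weights of the edges
      (∀ e, 0 < μ e) →
      (∀ e, μ (Sum.inl e) ^ 2 = 1 / 2) →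
      (∀ i j, μ (Sum.inr (i, j)) ^ 2 =
        ADFS.lamMinPos (ADFS.commLap μ) / (P.sigMax * P.kap i) * P.L i j) →
      -- the sampling probabilities
      ∑ e, p e = 1 →
      ADFS.pComm p = min (1 / 2) (1 + Δp * √(P.gam μ / P.kapMin) * P.sComp)⁻¹ →
      (∀ i j, p (Sum.inr (i, j)) =
        ADFS.pComp p * √(1 + P.L i j * (P.σ i)⁻¹) / (n * P.sComp)) →
      (∀ i i', ∑ j, p (Sum.inr (i, j)) = ∑ j, p (Sum.inr (i', j))) →
      (∀ e, Δp * ADFS.pComm p / P.numComm ≤ p (Sum.inl e)) →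
      ADFS.pMax p ≤ cτ * ADFS.pComm p →
      ρ = P.rate μ p →
      -- the primal and dual problems have solutions
      (∃! θs : ADFS.Param d, ∀ θ, P.primal θs ≤ P.primal θ) ∧
      (∃ lams : ADFS.Edge P.G m → ADFS.Param d, ∀ lam, P.dual μ lams ≤ P.dual μ lam) ∧
      -- the rate is positive and the error after `K` iterations is at most `C₀ ε`
      0 < ρ ∧
      (∀ (θs : ADFS.Param d) (lams : ADFS.Edge P.G m → ADFS.Param d),
        (∀ θ, P.primal θs ≤ P.primal θ) →
        (∀ lam, P.dual μ lams ≤ P.dual μ lam) →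
        (∀ i, P.primalPoint μ lams (Sum.inl i) = θs) ∧
        ∀ ε : ℝ, 0 < ε →
          ((ADFS.expect p ⌈ρ⁻¹ * Real.log ε⁻¹⌉₊ fun s =>
            ADFS.sqNorm (P.output μ p ρ _ s - P.primalPoint μ lams) : ℝ) : EReal) ≤
              P.c0 μ lams * (ε : EReal)) ∧
      -- the execution time of these `K` iterations
      ((∀ i, P.σ i = P.sigMax) → (ADFS.pMax p ≤ ADFS.pComp p ∨ 1 < τ) →
        Tendsto (fun ε : ℝ => ADFS.prob p ⌈ρ⁻¹ * Real.log ε⁻¹⌉₊ fun s =>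
          ADFS.execTime τ _ s ≤
            2 * C * ((m + √(m * P.kapS)) / √(2 * P.rKap) +
              (1 + 4 * cτ * τ) / Δp * √(P.kapS / P.gam μ)) * Real.log (1 / ε))
          (𝓝[>] 0) (𝓝 1)) := by
  -- The synchronization bound already holds with `5`; the value `20` absorbs the factor `4` of
  -- `cost_le_rate_mul`.
  refine ⟨20, by norm_num, ADFS.isSyncConstant_of_le (by norm_num), ?_⟩
  intro n m d P μ p τ Δp cτ ρ hn hm hτ hΔ _ hcτ hμ hμc hμv hp1 hpc hpv hloc hpe hpM hρ
  have hn0 : 0 < n := by omega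
  have hn' : (0 : ℝ) < n := by exact_mod_cast hn0
  have hS := P.sComp_pos hn0 hm
  have hks := P.kapS_pos hn0
  have hkm := P.kapMin_pos hn0
  have hgam := P.gam_pos hn hμ
  set g := Δp * √(P.gam μ / P.kapMin) * P.sComp with hg
  have hg0 : 0 < g := by positivity
  set q := ADFS.pComm p with hq
  have hq0 : 0 < q := by rw [hpc]; positivity
  have hqh : q ≤ 1 / 2 := by rw [hpc]; exact min_le_left _ _
  have hq1 : q * (1 + g) ≤ 1 := by
    have : q ≤ (1 + g)⁻¹ := by rw [hpc]; exact min_le_right _ _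
    calc q * (1 + g) ≤ (1 + g)⁻¹ * (1 + g) := by gcongr
      _ = 1 := inv_mul_cancel₀ (by linarith)
  -- A lower bound on `q` valid in both branches of the minimum.
  have hq2 : 1 ≤ q * (2 + g) := by
    rcases min_choice (1 / 2) (1 + g)⁻¹ with h | h <;> rw [hpc, h]
    · linarith
    · rw [inv_mul_eq_div, le_div_iff₀ (by linarith)]
      linarith
  have hpcomp : ADFS.pComp p = 1 - q := by
    rw [← hp1, Fintype.sum_sum_type, hq, ADFS.pComm, ADFS.pComp, add_sub_cancel_left]
  have hp : ∀ e, 0 < p e := by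
    rintro (e | ⟨i, j⟩)
    · refine lt_of_lt_of_le ?_ (hpe e)
      have := P.numComm_pos hn
      positivity
    · rw [hpv, hpcomp]
      have := mul_pos (P.L_pos i j) (inv_pos.2 (P.σ_pos i))
      have : 0 < 1 - q := by linarith
      positivity
  have e₀ : ADFS.Edge P.G m := Sum.inr (⟨0, hn0⟩, ⟨0, hm⟩)
  have hne : Nonempty (ADFS.Edge P.G m) := ⟨e₀⟩
  have hρ0 : 0 < ρ := by rw [hρ]; exact P.rate_pos hμ hp
  have hρp : ∀ ij, ρ ≤ p (Sum.inr ij) := by rw [hρ]; exact P.rate_le_inr hμ hp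
  have hρ1 : ρ ≤ 1 := by
    refine (hρp (⟨0, hn0⟩, ⟨0, hm⟩)).trans ?_
    rw [← hp1]
    exact Finset.single_le_sum (fun e _ => (hp e).le) (Finset.mem_univ _)
  obtain ⟨θ, hθ, huniq⟩ := P.existsUnique_primal hn0
  refine ⟨⟨θ, hθ, huniq⟩, ?_, hρ0, ?_, ?_⟩
  · obtain ⟨lams, hlams⟩ := P.exists_dual_le hμ hθ
    exact ⟨lams, fun lam => hlams.trans (P.neg_primal_le_dual lam θ)⟩
  · intro θs lams hθs hlams
    refine ⟨(P.dual_minimizer hμ hθs hlams).1, fun ε hε => ?_⟩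
    exact P.expect_output_le hμ hp hp1 hρ0 hρ1 (by rw [hρ]; exact P.rate_sq_le hμ) hρp e₀
      hθs hlams hε
  · intro hσ hor
    have hloc' : ∀ i, ∑ j, p (Sum.inr (i, j)) = ADFS.pComp p / n := by
      intro i
      rw [ADFS.pComp, Fintype.sum_prod_type, Finset.sum_congr rfl fun i' _ => hloc i' i]
      simp
      field_simp
    have hrate := P.le_rate hn hm hμ hμc hμv hΔ hq0 hpv hpe hσ
    rw [← hρ, hpcomp] at hrate
    have hsqrt1 : √(2 * P.rKap) = √2 * (√P.kapMin / √P.kapS) := by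
      rw [ADFS.Problem.rKap, Real.sqrt_mul zero_le_two, Real.sqrt_div hkm.le]
    have hcost := ADFS.cost_le_rate_mul (A := √P.kapS) (B := √P.kapMin) (G := √(P.gam μ))
      (N := n * ρ) hS (Real.sqrt_pos.2 hks) (Real.sqrt_pos.2 hkm) (Real.sqrt_pos.2 hgam) hΔ
      hcτ.le hτ (P.sComp_le hn0) (by rw [hg, Real.sqrt_div hgam.le]) hq0 hq1 hq2 hqh hpM
      (by positivity) (by
        rw [Real.sq_sqrt hks.le, Real.sq_sqrt hkm.le, Real.sq_sqrt hgam.le]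
        exact hrate)
    rw [← hsqrt1, ← Real.sqrt_div hks.le, ← hpcomp] at hcost
    set T := (m + √(m * P.kapS)) / √(2 * P.rKap) +
      (1 + 4 * cτ * τ) / Δp * √(P.kapS / P.gam μ)
    have hlog : Tendsto (fun ε : ℝ => Real.log ε⁻¹) (𝓝[>] 0) atTop :=
      Real.tendsto_log_atTop.comp tendsto_inv_nhdsGT_zero
    have hK : Tendsto (fun ε : ℝ => ⌈ρ⁻¹ * Real.log ε⁻¹⌉₊) (𝓝[>] 0) atTop :=
      tendsto_nat_ceil_atTop.comp (hlog.const_mul_atTop (inv_pos.2 hρ0))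
    refine tendsto_of_tendsto_of_tendsto_of_le_of_le'
      ((ADFS.tendsto_prob_execTime (fun e => (hp e).le) hp1 hn0 hloc' hτ hor).comp hK)
      tendsto_const_nhds ?_
      (Eventually.of_forall fun ε => ADFS.prob_le_one (fun e => (hp e).le) hp1 _ _)
    -- For such `ε`, `ρ⁻¹ log (1 / ε) ≥ 1`, so rounding up at most doubles it.
    filter_upwards [hlog.eventually_ge_atTop ρ] with ε hε
    refine ADFS.prob_mono (fun e => (hp e).le) fun s hs => hs.trans ?_
    rw [one_div]
    set ℓ := Real.log ε⁻¹
    have hℓ : 0 < ℓ := hρ0.trans_le hε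
    have h1 : (⌈ρ⁻¹ * ℓ⌉₊ : ℝ) ≤ 2 * (ρ⁻¹ * ℓ) := by
      have h2 := (Nat.ceil_lt_add_one (mul_pos (inv_pos.2 hρ0) hℓ).le).le
      have h3 : 1 ≤ ρ⁻¹ * ℓ := by rwa [inv_mul_eq_div, one_le_div hρ0]
      linarith
    have hM0 := ADFS.pMax_nonneg fun e => (hp e).le
    have hc0 : 0 ≤ ADFS.pComp p + 2 * τ * ADFS.pMax p := by
      have : 0 ≤ ADFS.pComp p := by rw [hpcomp]; linarith
      positivity
    calc 5 / n * (ADFS.pComp p + 2 * τ * ADFS.pMax p) * (⌈ρ⁻¹ * ℓ⌉₊ : ℝ)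
        ≤ 5 / n * (4 * (n * ρ) * T) * (2 * (ρ⁻¹ * ℓ)) := by
          gcongr
      _ = 2 * 20 * T * ℓ := by
          field_simp
          ring
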